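/- Let $n\ge 3$ and let $K\ge 0$. There is a constant $C=C(n,K)>0$ with the following property. Let $\Omega\subset\mathbb R^n$ be open, $u\in C^3(\Omega)$, and let $f\in C^1(\Omega)$ satisfy $f\ge 1$ in $\Omega$. Equip $\Omega\times\mathbb R^n\subset\mathbb R^n\times\mathbb R^n$ with the Riemannian metric $\overline g=f^2(x)\,dx^2+dy^2$, let $\mathcal M=\{(x,Du(x)) : x\in\Omega\}$ be the gradient graph of $u$, and let $g$ be the metric induced by $\overline g$ on $\mathcal M$; in the coordinates $x$ it is $g_{ij}=f^2\delta_{ij}+\sum_k u_{ik}u_{jk}$. Functions on $\mathcal M$ and subsets of $\mathcal M$ are identified with functions on $\Omega$ and subsets of $\Omega$. Write - $dv_g=\sqrt{\det g}\,dx$ for the volume of $g$, and $|\nabla_g\phi|=(\sum_{i,j}g^{ij}\phi_i\phi_j)^{1/2}$; - $T_{g^{-1}}=\sum_i g^{ii}=\sum_{i=1}^n\frac1{f^2+\lambda_i^2}$ for the trace of the inverse metric, where $\lambda_1,\dots,\lambda_n$ are the eigenvalues of $D^2u$; - $H=\sum_{i,j}g^{ij}(\overline\nabla_{\partial_i}\partial_j)^{\perp}$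 for the mean curvature vector of $\mathcal M$, where $\partial_i=\partial_i(x,Du)$, $\overline\nabla$ is the Levi-Civita connection of $\overline g$ and $\perp$ is the $\overline g$-orthogonal projection onto the normal space of $\mathcal M$; $|H|$ is its length in $\overline g$. Let $U\subset\mathcal M$ be open (that is, an open subset of $\Omega$) with $$\|f\|_{C^{0,1}(U)}=\sup_{U}|f|+\sup_{x\ne y\in U}\frac{|f(x)-f(y)|}{|x-y|}\le K,$$ and let $\phi\ge 0$ be a $C^1(U)$ function vanishing outside a compact subset of $U$ (extended by zero). Then $$ \Big[\int_{\mathcal M}\phi^{\frac n{n-1}}\,dv_g\Big]^{\frac{n-1}n}\le C\Big[1+\Big(\int_{\mathrm{supp}\,\phi}T_{g^{-1}}\,dv_g\Big)^{\frac1{n(n-1)}}\Big]\int_{\mathcal M}\Big[|\nabla_g\phi|+\phi\big(|H|+\sqrt{T_{g^{-1}}}\big)\Big]dv_g . $$ -/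

import Mathlib

open MeasureTheory

open scoped NNReal ENNReal

noncomputable section

namespace GradientGraph

/-- The partial derivative `∂ᵢ h` at the point `x` of `ℝⁿ`. -/
def pderiv {n : ℕ} (i : Fin n) (h : EuclideanSpace ℝ (Fin n) → ℝ)
    (x : EuclideanSpace ℝ (Fin n)) : ℝ :=
  fderiv ℝ h x (EuclideanSpace.single i 1)

/-! ### A Riemannian metric `G` on a coordinate space `ℝ^ι` -/

/-- The partial derivative `∂ h / ∂ z_a` of a function on the coordinate space `ℝ^ι`. -/
def ambientPderiv {ι : Type} [Fintype ι] [DecidableEq ι] (a : ι) (h : (ι → ℝ) → ℝ)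
    (z : ι → ℝ) : ℝ :=
  fderiv ℝ h z (Pi.single a 1)

/-- The Christoffel symbol `Γ^c_{ab}` of the metric `G` at `z`, i.e.
`(1/2) ∑_l G^{cl} (∂_a G_{lb} + ∂_b G_{al} - ∂_l G_{ab})`. -/
def christoffel {ι : Type} [Fintype ι] [DecidableEq ι] (G : (ι → ℝ) → Matrix ι ι ℝ)
    (z : ι → ℝ) (c a b : ι) : ℝ :=
  (1 / 2) * ∑ l, (G z)⁻¹ c l *
    (ambientPderiv a (fun w => G w l b) z + ambientPderiv b (fun w => G w a l) z
      - ambientPderiv l (fun w => G w a b) z)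

/-- The inner product `⟨V, W⟩` of two vectors at the point `z`, in the metric `G`. -/
def ambientInner {ι : Type} [Fintype ι] (G : (ι → ℝ) → Matrix ι ι ℝ)
    (z V W : ι → ℝ) : ℝ :=
  ∑ a, ∑ b, G z a b * V a * W b

/-! ### The submanifold parametrized by a map `F` from (an open subset of) `ℝⁿ` to `(ℝ^ι, G)` -/

/-- The coordinate tangent vector `∂ᵢ F` at the point `F x`. -/
def tangentVec {n : ℕ} {ι : Type} (F : EuclideanSpace ℝ (Fin n) → ι → ℝ)
    (x : EuclideanSpace ℝ (Fin n)) (i : Fin n) : ι → ℝ :=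
  fun a => pderiv i (fun y => F y a) x

/-- The induced metric `g_{ij} = ⟨∂ᵢ F, ∂ⱼ F⟩`. -/
def inducedMetric {n : ℕ} {ι : Type} [Fintype ι] (G : (ι → ℝ) → Matrix ι ι ℝ)
    (F : EuclideanSpace ℝ (Fin n) → ι → ℝ) (x : EuclideanSpace ℝ (Fin n)) :
    Matrix (Fin n) (Fin n) ℝ :=
  Matrix.of fun i j => ambientInner G (F x) (tangentVec F x i) (tangentVec F x j)

/-- The Riemannian volume `dv_g = √(det g) dx` of the submanifold parametrized over `Ω`,
as a measure in the parameter `x`. -/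
def volumeMeasure {n : ℕ} {ι : Type} [Fintype ι] (G : (ι → ℝ) → Matrix ι ι ℝ)
    (F : EuclideanSpace ℝ (Fin n) → ι → ℝ) (Ω : Set (EuclideanSpace ℝ (Fin n))) :
    Measure (EuclideanSpace ℝ (Fin n)) :=
  (volume.restrict Ω).withDensity
    fun x => ENNReal.ofReal (Real.sqrt (inducedMetric G F x).det)

/-- The trace `∑ᵢ g^{ii}` of the inverse of the induced metric. -/
def traceInv {n : ℕ} {ι : Type} [Fintype ι] (G : (ι → ℝ) → Matrix ι ι ℝ)
    (F : EuclideanSpace ℝ (Fin n) → ι → ℝ) (x : EuclideanSpace ℝ (Fin n)) : ℝ :=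
  ((inducedMetric G F x)⁻¹).trace

/-- The length `|∇_g φ| = (∑ g^{ij} ∂ᵢφ ∂ⱼφ)^{1/2}` of the gradient in the induced metric. -/
def gradNorm {n : ℕ} {ι : Type} [Fintype ι] (G : (ι → ℝ) → Matrix ι ι ℝ)
    (F : EuclideanSpace ℝ (Fin n) → ι → ℝ) (φ : EuclideanSpace ℝ (Fin n) → ℝ)
    (x : EuclideanSpace ℝ (Fin n)) : ℝ :=
  Real.sqrt (∑ i, ∑ j, (inducedMetric G F x)⁻¹ i j * pderiv i φ x * pderiv j φ x)

/-- The ambient covariant derivative of `∂ⱼ F` in the direction `∂ᵢ F`, with respect to the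
Levi-Civita connection of `G`; its component `c` is
`∂ᵢ∂ⱼ F^c + ∑_{a,b} Γ^c_{ab} ∂ᵢF^a ∂ⱼF^b`. -/
def covDeriv {n : ℕ} {ι : Type} [Fintype ι] [DecidableEq ι] (G : (ι → ℝ) → Matrix ι ι ℝ)
    (F : EuclideanSpace ℝ (Fin n) → ι → ℝ) (x : EuclideanSpace ℝ (Fin n)) (i j : Fin n) :
    ι → ℝ :=
  fun c => pderiv i (fun y => tangentVec F y j c) x
    + ∑ a, ∑ b, christoffel G (F x) c a b * tangentVec F x i a * tangentVec F x j b

/-- The component of an ambient vector `V` at `F x` that is `G`-orthogonal to the submanifold. -/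
def normalPart {n : ℕ} {ι : Type} [Fintype ι] (G : (ι → ℝ) → Matrix ι ι ℝ)
    (F : EuclideanSpace ℝ (Fin n) → ι → ℝ) (x : EuclideanSpace ℝ (Fin n)) (V : ι → ℝ) :
    ι → ℝ :=
  V - ∑ i, ∑ j, ((inducedMetric G F x)⁻¹ i j * ambientInner G (F x) V (tangentVec F x i)) •
    tangentVec F x j

/-- The mean curvature vector: the trace, in the induced metric, of the second fundamental
form `(∂ᵢ F, ∂ⱼ F) ↦ (∇̄_{∂ᵢ F} ∂ⱼ F)^⊥`. -/
def meanCurvature {n : ℕ} {ι : Type} [Fintype ι] [DecidableEq ι]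
    (G : (ι → ℝ) → Matrix ι ι ℝ) (F : EuclideanSpace ℝ (Fin n) → ι → ℝ)
    (x : EuclideanSpace ℝ (Fin n)) : ι → ℝ :=
  ∑ i, ∑ j, (inducedMetric G F x)⁻¹ i j • normalPart G F x (covDeriv G F x i j)

/-- The length `|H|` of the mean curvature vector in the ambient metric. -/
def meanCurvatureNorm {n : ℕ} {ι : Type} [Fintype ι] [DecidableEq ι]
    (G : (ι → ℝ) → Matrix ι ι ℝ) (F : EuclideanSpace ℝ (Fin n) → ι → ℝ)
    (x : EuclideanSpace ℝ (Fin n)) : ℝ :=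
  Real.sqrt (ambientInner G (F x) (meanCurvature G F x) (meanCurvature G F x))

/-! ### The gradient graph in the weighted Euclidean space -/

/-- The metric `f(x)² dx² + dy²` on `ℝⁿ × ℝⁿ`. The coordinates `x` are indexed by `Sum.inl`,
the coordinates `y` by `Sum.inr`. -/
def weightedMetric {n : ℕ} (f : EuclideanSpace ℝ (Fin n) → ℝ) (z : Fin n ⊕ Fin n → ℝ) :
    Matrix (Fin n ⊕ Fin n) (Fin n ⊕ Fin n) ℝ :=
  Matrix.fromBlocks
    ((f (WithLp.toLp 2 fun i => z (Sum.inl i)) ^ 2) • (1 : Matrix (Fin n) (Fin n) ℝ)) 0 0 1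

/-- The graph map `x ↦ (x, Du(x))`. -/
def gradGraph {n : ℕ} (u : EuclideanSpace ℝ (Fin n) → ℝ) (x : EuclideanSpace ℝ (Fin n)) :
    Fin n ⊕ Fin n → ℝ :=
  Sum.elim (fun i => x i) (fun i => pderiv i u x)

/-- The `C^{0,1}` norm on a set `U`: the supremum of `|f|` plus the least Lipschitz constant
(`∞` if one of them is not finite). -/
def c01Norm {n : ℕ} (f : EuclideanSpace ℝ (Fin n) → ℝ) (U : Set (EuclideanSpace ℝ (Fin n))) :
    ℝ≥0∞ :=
  (⨆ x ∈ U, ‖f x‖ₑ) + ⨆ x ∈ U, ⨆ y ∈ U, edist (f x) (f y) / edist x y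

end GradientGraph

end

/-!
This is a Sobolev inequality of Michael–Simon type for the gradient graph, with a constant depending
on `n` and `K` only. Since the trace of the inverse metric is nonnegative, the bracket
`1 + (∫ T) ^ (1 / (n (n - 1)))` is at least `1`, and it suffices to prove the inequality without it
(`exists_integral_rpow_le`).

The starting point is a monotonicity inequality. Around a point `x₀`, let `r` be the distance in the
flat ambient metric `f(x₀)² dx² + dy²`, restricted to the graph. On a submanifold of Euclidean
space, `Δ (r² / 2) = n + ⟨D (r² / 2), H⟩` and `|∇ (r² / 2)| ≤ r`. Here both relations hold up to errors
controlled by `r (|H| + T)`, where `T` is the trace of the inverse metric, because `f` and `f(x₀)`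
differ by at most `K r` and because the Christoffel symbols of the ambient metric enter only through
contractions with the inverse of the induced metric (`lapOf_dHalfSq`, `pointwise_estimates`). As
`f ≥ 1`, one has `T ≤ n √T`. Integrating the divergence of `ψ (σ² + r²) ^ (-n / 2) ∇ (r² / 2)` gives,
at every scale `σ`, a bound of `σ ^ (-n) ∫_{r < σ} ψ` by the Riesz potential
`∫ r ^ (1 - n) (|∇ψ| + ψ (|H| + √T))` (`IsAdmissible.lintegral_le_kernel`).

This potential estimate, the lower bound for the density at small scales
(`IsAdmissible.exists_pow_le_lintegral`) and the Vitali covering lemma yield the weak-type inequality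
`vol {ψ ≥ 1} ≤ C (∫ |∇ψ| + ψ (|H| + √T)) ^ (n / (n - 1))` (`measure_le_rpow_lintegral`): with
`R ^ (n - 1)` a large multiple of the integral on the right, each point of `{ψ ≥ 1}` has a scale
`ρ ≤ R` at which the `ψ`-mass of a dilated ball is at most `C R` times the energy of the ball.
Applied to the truncations of `φ` between the levels `t` and `2 t` and integrated over `t`, it implies
the strong inequality (`lintegral_rpow_le_of_truncation`).
-/

noncomputable section

namespace GradientGraph

/-! ### Potential estimates and the covering argument -/

lemma kernel_le_tsum_indicator {n : ℕ} (hn : 2 ≤ n) {R s : ℝ} (hR : 0 < R) (hs : 0 ≤ s) :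
    ENNReal.ofReal (s / s ^ n) ≤ ENNReal.ofReal (1 / R ^ (n - 1)) +
      ∑' j : ℕ, (if s < R * (1 / 2) ^ j then
        ENNReal.ofReal (1 / (R * (1 / 2) ^ (j + 1)) ^ (n - 1)) else 0) := by
  rcases hs.eq_or_lt with h0 | h0
  · rw [← h0]; simp
  have hk : s / s ^ n = 1 / s ^ (n - 1) := by
    obtain ⟨m, rfl⟩ : ∃ m, n = m + 1 := ⟨n - 1, by omega⟩
    rw [Nat.add_sub_cancel, pow_succ]; field_simp
  rw [hk]
  rcases le_or_gt R s with h | h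
  · refine le_trans ?_ le_self_add
    apply ENNReal.ofReal_le_ofReal
    gcongr
  · -- the dyadic shell containing `s`
    have hex : ∃ j : ℕ, R * (1 / 2) ^ j ≤ s := by
      obtain ⟨j, hj⟩ := exists_pow_lt_of_lt_one (div_pos h0 hR) (by norm_num : (1 / 2 : ℝ) < 1)
      exact ⟨j, by rw [lt_div_iff₀ hR] at hj; linarith⟩
    classical
    have hj := Nat.find_spec hex
    obtain ⟨i, hi⟩ : ∃ i, Nat.find hex = i + 1 := by
      refine ⟨Nat.find hex - 1, ?_⟩
      have : Nat.find hex ≠ 0 := by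
        intro h'
        rw [h'] at hj
        simp at hj
        linarith
      omega
    have hi' : s < R * (1 / 2) ^ i := not_le.1 (Nat.find_min hex (m := i) (by omega))
    rw [hi] at hj
    refine le_trans ?_ le_add_self
    refine le_trans ?_ (ENNReal.le_tsum i)
    rw [if_pos hi']
    apply ENNReal.ofReal_le_ofReal
    gcongr

/-- If the `G`-mass of the sets `{r < ρ}` is at most `B ρ ^ n` at all scales `ρ ≤ R`, then the
Riesz potential `∫ r ^ (1 - n) G` is controlled by the scale `R`: the part `r ≥ R` contributes
`R ^ (1 - n) ∫ G`, and the dyadic shells `r ∼ 2 ^ (-j) R` sum to a geometric series. -/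
lemma lintegral_kernel_le {X : Type*} [MeasurableSpace X] {μ : Measure X} {n : ℕ} (hn : 2 ≤ n)
    {r : X → ℝ} (hr : AEMeasurable r μ) (hr0 : ∀ x, 0 ≤ r x) {G : X → ℝ≥0∞}
    (hG : AEMeasurable G μ) {R B : ℝ} (hR : 0 < R) (hB : 0 ≤ B)
    (h : ∀ ρ, 0 < ρ → ρ ≤ R → ∫⁻ x in {x | r x < ρ}, G x ∂μ ≤ ENNReal.ofReal (B * ρ ^ n)) :
    ∫⁻ x, ENNReal.ofReal (r x / r x ^ n) * G x ∂μ ≤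
      ENNReal.ofReal (1 / R ^ (n - 1)) * ∫⁻ x, G x ∂μ + ENNReal.ofReal (B * 2 ^ n * R) := by
  have hset : ∀ ρ, NullMeasurableSet {x | r x < ρ} μ := fun ρ =>
    nullMeasurableSet_lt hr aemeasurable_const
  have hind : ∀ j : ℕ, ∀ x, (if r x < R * (1 / 2) ^ j then
        ENNReal.ofReal (1 / (R * (1 / 2) ^ (j + 1)) ^ (n - 1)) else 0) * G x =
      {x | r x < R * (1 / 2) ^ j}.indicator
        (fun x => ENNReal.ofReal (1 / (R * (1 / 2) ^ (j + 1)) ^ (n - 1)) * G x) x := by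
    intro j x
    simp only [Set.indicator_apply, Set.mem_ofPred_eq]
    split_ifs <;> simp
  calc ∫⁻ x, ENNReal.ofReal (r x / r x ^ n) * G x ∂μ
      ≤ ∫⁻ x, (ENNReal.ofReal (1 / R ^ (n - 1)) * G x + ∑' j : ℕ,
          {x | r x < R * (1 / 2) ^ j}.indicator
            (fun x => ENNReal.ofReal (1 / (R * (1 / 2) ^ (j + 1)) ^ (n - 1)) * G x) x) ∂μ := by
        refine lintegral_mono fun x => ?_
        simp_rw [← hind]
        rw [ENNReal.tsum_mul_right, ← add_mul]
        gcongr
        exact kernel_le_tsum_indicator hn hR (hr0 x)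
    _ = ENNReal.ofReal (1 / R ^ (n - 1)) * ∫⁻ x, G x ∂μ + ∑' j : ℕ,
          ENNReal.ofReal (1 / (R * (1 / 2) ^ (j + 1)) ^ (n - 1)) *
            ∫⁻ x in {x | r x < R * (1 / 2) ^ j}, G x ∂μ := by
        rw [lintegral_add_left' (hG.const_mul _), lintegral_const_mul'' _ hG, lintegral_tsum]
        · congr 1
          refine tsum_congr fun j => ?_
          rw [lintegral_indicator₀ (hset _), lintegral_const_mul'' _ hG.restrict]
        · exact fun j => (hG.const_mul _).indicator₀ (hset _)
    _ ≤ ENNReal.ofReal (1 / R ^ (n - 1)) * ∫⁻ x, G x ∂μ + ∑' j : ℕ,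
          ENNReal.ofReal (B * 2 ^ (n - 1) * R * (1 / 2) ^ j) := by
        gcongr with j
        have hj : R * (1 / 2 : ℝ) ^ j ≤ R := by
          have : (1 / 2 : ℝ) ^ j ≤ 1 := pow_le_one₀ (by norm_num) (by norm_num)
          nlinarith
        refine (mul_le_mul_right (h _ (by positivity) hj) _).trans ?_
        rw [← ENNReal.ofReal_mul (by positivity)]
        apply ENNReal.ofReal_le_ofReal
        obtain ⟨m, rfl⟩ : ∃ m, n = m + 1 := ⟨n - 1, by omega⟩
        rw [Nat.add_sub_cancel]
        have : R * (1 / 2 : ℝ) ^ (j + 1) = (R * (1 / 2) ^ j) / 2 := by ring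
        rw [this]
        have hp : 0 < R * (1 / 2 : ℝ) ^ j := by positivity
        rw [show B * 2 ^ m * R * (1 / 2 : ℝ) ^ j = B * 2 ^ m * (R * (1 / 2 : ℝ) ^ j) by ring]
        generalize R * (1 / 2 : ℝ) ^ j = t at hp
        apply le_of_eq
        rw [div_pow, pow_succ]
        field_simp
    _ = _ := by
        congr 1
        rw [← ENNReal.ofReal_tsum_of_nonneg (fun j => by positivity)
          (summable_geometric_two.mul_left _), tsum_mul_left, tsum_geometric_two]
        congr 1
        obtain ⟨m, rfl⟩ : ∃ m, n = m + 1 := ⟨n - 1, by omega⟩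
        rw [Nat.add_sub_cancel]; ring

/-- Selection of a good scale. The potential estimate `h1` says that the density ratios of `ψ` at
the centre are controlled by the Riesz potential of `G`. If at every scale `ρ ≤ R` the `ψ`-mass of
`{r < Λ ρ}` dominated `C R` times the `G`-mass of `{r < ρ}`, then the supremum of
the density ratios would be absorbed, and so would be at most `2 C₁ R ^ (1 - n) ∫ G`, which is
less than the lower density `c`. -/
lemma exists_scale {X : Type*} [MeasurableSpace X] {μ : Measure X} {n : ℕ} (hn : 2 ≤ n)
    {r : X → ℝ} (hr : AEMeasurable r μ) (hr0 : ∀ x, 0 ≤ r x) {ψ G : X → ℝ≥0∞}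
    (hG : AEMeasurable G μ) {c C₁ Λ R Q : ℝ} (hC₁ : 0 < C₁) (hΛ : 0 < Λ) (hR : 0 < R)
    (hQ : ∫⁻ x, G x ∂μ = ENNReal.ofReal Q) (hQR : 2 * C₁ * (Q / R ^ (n - 1)) < c)
    (h1 : ∀ σ, 0 < σ → ∫⁻ x in {x | r x < σ}, ψ x ∂μ ≤
      ENNReal.ofReal (C₁ * σ ^ n) * ∫⁻ x, ENNReal.ofReal (r x / r x ^ n) * G x ∂μ)
    {M : ℝ} (h2 : ∀ σ, 0 < σ → ∫⁻ x in {x | r x < σ}, ψ x ∂μ ≤ ENNReal.ofReal (M * σ ^ n))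
    (h3 : ∃ σ, 0 < σ ∧ ENNReal.ofReal (c * σ ^ n) ≤ ∫⁻ x in {x | r x < σ}, ψ x ∂μ)
    (hQ0 : 0 ≤ Q) :
    ∃ ρ, 0 < ρ ∧ ρ ≤ R ∧ ∫⁻ x in {x | r x < Λ * ρ}, ψ x ∂μ ≤
      ENNReal.ofReal (C₁ * 2 ^ (n + 1) * Λ ^ n * R) * ∫⁻ x in {x | r x < ρ}, G x ∂μ := by
  by_contra! hcon
  set I : ℝ → ℝ≥0∞ := fun σ => ∫⁻ x in {x | r x < σ}, ψ x ∂μ with hI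
  have hIfin : ∀ σ, 0 < σ → I σ ≠ ⊤ := fun σ hσ =>
    ((h2 σ hσ).trans_lt ENNReal.ofReal_lt_top).ne
  have hbdd : BddAbove (Set.range fun σ : Set.Ioi (0 : ℝ) => (I σ).toReal / (σ : ℝ) ^ n) := by
    refine ⟨max M 0, ?_⟩
    rintro _ ⟨⟨σ, hσ⟩, rfl⟩
    have hσ' : (0 : ℝ) < σ := hσ
    simp only
    rw [div_le_iff₀ (by positivity)]
    refine ENNReal.toReal_le_of_le_ofReal (by positivity) ((h2 σ hσ).trans ?_)
    apply ENNReal.ofReal_le_ofReal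
    gcongr
    exact le_max_left _ _
  set S : ℝ := ⨆ σ : Set.Ioi (0 : ℝ), (I σ).toReal / (σ : ℝ) ^ n with hS
  have hIS : ∀ σ, 0 < σ → (I σ).toReal ≤ S * σ ^ n := fun σ hσ => by
    rw [← div_le_iff₀ (by positivity)]
    exact le_ciSup hbdd (⟨σ, hσ⟩ : Set.Ioi (0 : ℝ))
  have hIS' : ∀ σ, 0 < σ → I σ ≤ ENNReal.ofReal (S * σ ^ n) := fun σ hσ => by
    rw [← ENNReal.ofReal_toReal (hIfin σ hσ)]
    exact ENNReal.ofReal_le_ofReal (hIS σ hσ)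
  have hcS : c ≤ S := by
    obtain ⟨σ, hσ, h⟩ := h3
    have h' : ENNReal.ofReal (c * σ ^ n) ≤ ENNReal.ofReal (S * σ ^ n) := h.trans (hIS' σ hσ)
    have hS0 : 0 ≤ S := by
      have := hIS 1 one_pos
      simp only [one_pow, mul_one] at this
      exact ENNReal.toReal_nonneg.trans this
    rw [ENNReal.ofReal_le_ofReal_iff (by positivity)] at h'
    exact le_of_mul_le_mul_right h' (by positivity)
  have hS0 : 0 ≤ S := by
    have := hIS 1 one_pos
    simp only [one_pow, mul_one] at this
    exact ENNReal.toReal_nonneg.trans this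
  set B : ℝ := S * Λ ^ n / (C₁ * 2 ^ (n + 1) * Λ ^ n * R) with hB
  have hpos : 0 < C₁ * 2 ^ (n + 1) * Λ ^ n * R := by positivity
  have hGB : ∀ ρ, 0 < ρ → ρ ≤ R → ∫⁻ x in {x | r x < ρ}, G x ∂μ ≤ ENNReal.ofReal (B * ρ ^ n) := by
    intro ρ hρ hρR
    have h' := (hcon ρ hρ hρR).le.trans (hIS' (Λ * ρ) (by positivity))
    have : B * ρ ^ n = (S * (Λ * ρ) ^ n) / (C₁ * 2 ^ (n + 1) * Λ ^ n * R) := by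
      rw [hB]; ring
    rw [this, ENNReal.ofReal_div_of_pos hpos]
    rw [ENNReal.le_div_iff_mul_le (Or.inl (by simpa using hpos)) (Or.inl ENNReal.ofReal_ne_top),
      mul_comm]
    exact h'
  have hker := lintegral_kernel_le hn hr hr0 hG hR (by positivity) hGB
  have hSle : S ≤ C₁ * (Q / R ^ (n - 1) + B * 2 ^ n * R) := by
    have : Nonempty (Set.Ioi (0 : ℝ)) := ⟨⟨1, Set.mem_Ioi.2 one_pos⟩⟩
    refine ciSup_le ?_
    rintro ⟨σ, hσ⟩
    have hσ' : (0 : ℝ) < σ := hσ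
    simp only
    rw [div_le_iff₀ (by positivity)]
    refine ENNReal.toReal_le_of_le_ofReal (by positivity) ((h1 σ hσ).trans ?_)
    refine (mul_le_mul_right hker _).trans ?_
    rw [hQ, ← ENNReal.ofReal_mul (by positivity), ← ENNReal.ofReal_add (by positivity)
      (by positivity), ← ENNReal.ofReal_mul (by positivity)]
    apply ENNReal.ofReal_le_ofReal
    apply le_of_eq
    ring
  have hhalf : C₁ * (B * 2 ^ n * R) = S / 2 := by
    rw [hB, pow_succ]; field_simp
  have : S ≤ 2 * C₁ * (Q / R ^ (n - 1)) := by linarith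
  linarith

/-- A weak-type isoperimetric inequality. Each point of `A` is the centre of a
set `{r < 6 L ρ}` whose `ψ`-mass is at most `C R` times the `G`-mass of `{r < ρ}`, with
`R ^ (n - 1) ∼ ∫ G`; the Vitali covering lemma, applied to balls of the metric space `Y` with which
the functions `r x₀` are comparable, makes these estimates add up. -/
theorem measure_le_rpow_lintegral {X Y : Type*} [MeasurableSpace X] [PseudoMetricSpace Y]
    [TopologicalSpace.SeparableSpace Y]
    {μ : Measure X} {n : ℕ} (hn : 2 ≤ n) {F : X → Y} {r : X → X → ℝ} {ψ G : X → ℝ≥0∞} {A : Set X}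
    {c C₁ L : ℝ} (hc : 0 < c) (hC₁ : 0 < C₁) (hL : 1 ≤ L)
    (hr : ∀ x₀ ∈ A, AEMeasurable (r x₀) μ) (hψ : AEMeasurable ψ μ) (hG : AEMeasurable G μ)
    (hdr : ∀ x₀ ∈ A, ∀ x, dist (F x) (F x₀) ≤ r x₀ x)
    (hrd : ∀ x₀ ∈ A, ∀ x, r x₀ x ≤ L * dist (F x) (F x₀))
    (hA : ∀ x ∈ A, 1 ≤ ψ x)
    (h1 : ∀ x₀ ∈ A, ∀ σ, 0 < σ → ∫⁻ x in {x | r x₀ x < σ}, ψ x ∂μ ≤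
      ENNReal.ofReal (C₁ * σ ^ n) *
        ∫⁻ x, ENNReal.ofReal (r x₀ x / r x₀ x ^ n) * G x ∂μ)
    (h2 : ∀ x₀ ∈ A, ∃ M : ℝ, ∀ σ, 0 < σ →
      ∫⁻ x in {x | r x₀ x < σ}, ψ x ∂μ ≤ ENNReal.ofReal (M * σ ^ n))
    (h3 : ∀ x₀ ∈ A, ∃ σ, 0 < σ ∧
      ENNReal.ofReal (c * σ ^ n) ≤ ∫⁻ x in {x | r x₀ x < σ}, ψ x ∂μ) :
    μ A ≤ ENNReal.ofReal (C₁ * 2 ^ (n + 1) * (6 * L) ^ n *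
        (4 * C₁ / c) ^ (1 / ((n : ℝ) - 1))) *
      (∫⁻ x, G x ∂μ) ^ ((n : ℝ) / ((n : ℝ) - 1)) := by
  have hn' : (2 : ℝ) ≤ n := by exact_mod_cast hn
  have hn1 : (0 : ℝ) < (n : ℝ) - 1 := by linarith
  have hr0 : ∀ x₀ ∈ A, ∀ x, 0 ≤ r x₀ x := fun x₀ h x => dist_nonneg.trans (hdr x₀ h x)
  have hDpos : 0 < C₁ * 2 ^ (n + 1) * (6 * L) ^ n * (4 * C₁ / c) ^ (1 / ((n : ℝ) - 1)) := by
    positivity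
  rcases eq_or_ne (∫⁻ x, G x ∂μ) ⊤ with htop | htop
  · rw [htop, ENNReal.top_rpow_of_pos (by positivity),
      ENNReal.mul_top (by simpa using hDpos)]
    exact le_top
  obtain ⟨Q, hQ0, hQ⟩ : ∃ Q : ℝ, 0 ≤ Q ∧ ∫⁻ x, G x ∂μ = ENNReal.ofReal Q :=
    ⟨_, ENNReal.toReal_nonneg, (ENNReal.ofReal_toReal htop).symm⟩
  rcases hQ0.eq_or_lt with hz | hQpos
  · -- if `G` vanishes almost everywhere, the lower density bound is violated at any point of `A`
    have hG0 : G =ᵐ[μ] 0 := by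
      rw [← lintegral_eq_zero_iff' hG, hQ, ← hz, ENNReal.ofReal_zero]
    have hAe : A = ∅ := by
      refine Set.eq_empty_of_forall_notMem fun x₀ hx₀ => ?_
      obtain ⟨σ, hσ, h⟩ := h3 x₀ hx₀
      have h0 : ∫⁻ x, ENNReal.ofReal (r x₀ x / r x₀ x ^ n) * G x ∂μ = 0 := by
        rw [lintegral_congr_ae (g := fun _ => 0)]
        · simp
        · filter_upwards [hG0] with x hx
          simp [hx]
      have h' := h.trans (h1 x₀ hx₀ σ hσ)
      rw [h0, mul_zero, nonpos_iff_eq_zero, ENNReal.ofReal_eq_zero] at h'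
      have : 0 < c * σ ^ n := by positivity
      linarith
    rw [hAe]; simp
  set R : ℝ := (4 * C₁ / c * Q) ^ (1 / ((n : ℝ) - 1)) with hRdef
  have hR : 0 < R := by positivity
  have hRpow : R ^ (n - 1) = 4 * C₁ / c * Q := by
    rw [hRdef, ← Real.rpow_natCast, ← Real.rpow_mul (by positivity),
      Nat.cast_sub (by omega), Nat.cast_one, one_div_mul_cancel hn1.ne', Real.rpow_one]
  have hQR : 2 * C₁ * (Q / R ^ (n - 1)) < c := by
    rw [hRpow]
    have : 2 * C₁ * (Q / (4 * C₁ / c * Q)) = c / 2 := by field_simp; norm_num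
    rw [this]; linarith
  have hscale : ∀ x₀ : A, ∃ ρ, 0 < ρ ∧ ρ ≤ R ∧ ∫⁻ x in {x | r x₀ x < 6 * L * ρ}, ψ x ∂μ ≤
      ENNReal.ofReal (C₁ * 2 ^ (n + 1) * (6 * L) ^ n * R) *
        ∫⁻ x in {x | r x₀ x < ρ}, G x ∂μ := by
    rintro ⟨x₀, hx₀⟩
    obtain ⟨M, hM⟩ := h2 x₀ hx₀
    exact exists_scale hn (hr x₀ hx₀) (hr0 x₀ hx₀) hG hC₁ (by positivity) hR hQ hQR
      (h1 x₀ hx₀) hM (h3 x₀ hx₀) hQ0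
  choose ρ hρ0 hρR hρ using hscale
  obtain ⟨v, -, hdisj, hcov⟩ :=
    Vitali.exists_disjoint_subfamily_covering_enlargement_closedBall (Set.univ : Set A)
      (fun x => F x) ρ R (fun x _ => hρR x) 5 (by norm_num)
  have hvc : v.Countable := by
    refine hdisj.countable_of_nonempty_interior fun x _ => ?_
    exact ⟨F x, Metric.ball_subset_interior_closedBall (Metric.mem_ball_self (hρ0 x))⟩
  have hsub : A ⊆ ⋃ x ∈ v, {y | r x y < 6 * L * ρ x} ∩ A := by
    intro y hy
    obtain ⟨x, hxv, hx⟩ := hcov ⟨y, hy⟩ (Set.mem_univ _)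
    have hyx : F y ∈ Metric.closedBall (F x) (5 * ρ x) :=
      hx (Metric.mem_closedBall_self (hρ0 ⟨y, hy⟩).le)
    rw [Metric.mem_closedBall] at hyx
    refine Set.mem_iUnion₂.2 ⟨x, hxv, ?_, hy⟩
    have h5 := hrd x x.2 y
    have : L * dist (F y) (F x) ≤ L * (5 * ρ x) := by gcongr
    have hp := hρ0 x
    simp only [Set.mem_ofPred_eq]
    nlinarith
  have hball : ∀ x : A, {y | r x y < ρ x} ⊆ F ⁻¹' Metric.closedBall (F x) (ρ x) := by
    intro x y hy
    exact (hdr x x.2 y).trans (le_of_lt hy)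
  have hmeasA : ∀ x : A, μ ({y | r x y < 6 * L * ρ x} ∩ A) ≤
      ∫⁻ y in {y | r x y < 6 * L * ρ x}, ψ y ∂μ := by
    intro x
    calc μ ({y | r x y < 6 * L * ρ x} ∩ A)
        ≤ μ.restrict {y | r x y < 6 * L * ρ x} A := by
          rw [Set.inter_comm]; exact Measure.le_restrict_apply _ _
      _ ≤ μ.restrict {y | r x y < 6 * L * ρ x} {y | 1 ≤ ψ y} := measure_mono hA
      _ ≤ ∫⁻ y in {y | r x y < 6 * L * ρ x}, ψ y ∂μ := by
          have := mul_meas_ge_le_lintegral₀ (hψ.restrict (s := {y | r x y < 6 * L * ρ x})) 1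
          rwa [one_mul] at this
  calc μ A ≤ μ (⋃ x ∈ v, {y | r x y < 6 * L * ρ x} ∩ A) := measure_mono hsub
    _ ≤ ∑' x : v, μ ({y | r x y < 6 * L * ρ x} ∩ A) := measure_biUnion_le μ hvc _
    _ ≤ ∑' x : v, ENNReal.ofReal (C₁ * 2 ^ (n + 1) * (6 * L) ^ n * R) *
          ∫⁻ y in {y | r x y < ρ x}, G y ∂μ :=
        ENNReal.tsum_le_tsum fun x => (hmeasA x).trans (hρ x)
    _ = ENNReal.ofReal (C₁ * 2 ^ (n + 1) * (6 * L) ^ n * R) *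
          ∫⁻ y in ⋃ x ∈ v, {y | r x y < ρ x}, G y ∂μ := by
        rw [ENNReal.tsum_mul_left, lintegral_biUnion₀ hvc]
        · exact fun x _ => nullMeasurableSet_lt (hr x x.2) aemeasurable_const
        · intro x hx y hy hxy
          refine Disjoint.aedisjoint ?_
          exact ((hdisj hx hy hxy).preimage F).mono (hball x) (hball y)
    _ ≤ ENNReal.ofReal (C₁ * 2 ^ (n + 1) * (6 * L) ^ n * R) * ∫⁻ y, G y ∂μ := by
        exact mul_le_mul_right (setLIntegral_le_lintegral _ _) _
    _ = _ := by
        rw [hQ, ENNReal.ofReal_rpow_of_pos hQpos, ← ENNReal.ofReal_mul (by positivity),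
          ← ENNReal.ofReal_mul (by positivity)]
        congr 1
        rw [hRdef, Real.mul_rpow (by positivity) hQ0,
          show (n : ℝ) / ((n : ℝ) - 1) = 1 / ((n : ℝ) - 1) + 1 by field_simp; ring,
          Real.rpow_add hQpos, Real.rpow_one]
        ring

/-! ### From the weak-type inequality to the Sobolev inequality by truncation -/

/-- The energy density of the truncation of `φ` between the levels `t` and `2 t`, where `D` stands
for the length of the gradient of `φ` and `h` for the zeroth-order weight. -/
def truncEnergy {X : Type*} (c : ℝ) (φ : X → ℝ) (D h : X → ℝ≥0∞) (t : ℝ) (x : X) : ℝ≥0∞ :=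
  (if t ≤ φ x ∧ φ x ≤ 2 * t then ENNReal.ofReal (c / t) * D x else 0) +
    if t < φ x then h x else 0

lemma measurable_truncEnergy {X : Type*} [MeasurableSpace X] {c : ℝ} {φ : X → ℝ}
    {D h : X → ℝ≥0∞} (hφ : Measurable φ) (hD : Measurable D) (hh : Measurable h) :
    Measurable (Function.uncurry (truncEnergy c φ D h)) := by
  have hφ' : Measurable fun z : ℝ × X => φ z.2 := hφ.comp measurable_snd
  have hD' : Measurable fun z : ℝ × X => D z.2 := hD.comp measurable_snd
  have hh' : Measurable fun z : ℝ × X => h z.2 := hh.comp measurable_snd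
  refine Measurable.add (Measurable.ite ?_ ?_ measurable_const)
    (Measurable.ite (measurableSet_lt measurable_fst hφ') hh' measurable_const)
  · exact (measurableSet_le measurable_fst hφ').inter
      (measurableSet_le hφ' (measurable_fst.const_mul 2))
  · exact (Measurable.ennreal_ofReal (measurable_const.div measurable_fst)).mul hD'

lemma mul_truncEnergy_le {X : Type*} {c : ℝ} (hc : 1 ≤ c) {φ : X → ℝ} {D h : X → ℝ≥0∞} {t : ℝ}
    (ht : 0 < t) (x : X) :
    ENNReal.ofReal t * truncEnergy c φ D h t x ≤
      ENNReal.ofReal c * (D x + ENNReal.ofReal (φ x) * h x) := by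
  rw [truncEnergy, mul_add, mul_add]
  refine add_le_add ?_ ?_
  · split_ifs
    · rw [← mul_assoc, ← ENNReal.ofReal_mul ht.le, mul_div_cancel₀ _ ht.ne']
    · simp
  · split_ifs with h'
    · rw [← mul_assoc]
      gcongr
      rw [← ENNReal.ofReal_mul (by linarith)]
      apply ENNReal.ofReal_le_ofReal
      nlinarith
    · simp

lemma lintegral_truncEnergy_le {X : Type*} {c : ℝ} (hc : 1 ≤ c) {φ : X → ℝ} {D h : X → ℝ≥0∞}
    (x : X) :
    ∫⁻ t in Set.Ioi (0 : ℝ), truncEnergy c φ D h t x ≤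
      ENNReal.ofReal c * (D x + ENNReal.ofReal (φ x) * h x) := by
  simp only [truncEnergy]
  have e1 : ∀ t ∈ Set.Ioi (0 : ℝ),
      (if t ≤ φ x ∧ φ x ≤ 2 * t then ENNReal.ofReal (c / t) * D x else 0) +
      (if t < φ x then h x else 0) ≤
      (Set.Icc (φ x / 2) (φ x)).indicator (fun _ => ENNReal.ofReal (c * (2 / φ x)) * D x) t +
      (Set.Ioo 0 (φ x)).indicator (fun _ => h x) t := by
    intro t ht
    have ht' : (0 : ℝ) < t := ht
    refine add_le_add ?_ ?_
    · split_ifs with h'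
      · rw [Set.indicator_of_mem (show t ∈ Set.Icc (φ x / 2) (φ x) from ⟨by linarith, h'.1⟩)]
        gcongr ENNReal.ofReal ?_ * _
        rw [mul_div_assoc', div_le_div_iff₀ ht' (by linarith)]
        nlinarith
      · exact zero_le
    · split_ifs with h'
      · rw [Set.indicator_of_mem (show t ∈ Set.Ioo 0 (φ x) from ⟨ht', h'⟩)]
      · exact zero_le
  refine (setLIntegral_mono' measurableSet_Ioi e1).trans ?_
  refine (setLIntegral_le_lintegral _ _).trans ?_
  rw [lintegral_add_right _ (measurable_const.indicator measurableSet_Ioo),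
    lintegral_indicator measurableSet_Icc, lintegral_indicator measurableSet_Ioo,
    setLIntegral_const, setLIntegral_const, Real.volume_Icc, Real.volume_Ioo, sub_zero, mul_add]
  gcongr ?_ + ?_
  · rw [mul_right_comm]
    gcongr
    rcases le_or_gt (φ x) 0 with h0 | h0
    · rw [ENNReal.ofReal_of_nonpos (p := φ x - φ x / 2) (by linarith), mul_zero]
      exact zero_le
    · rw [← ENNReal.ofReal_mul (by positivity)]
      apply ENNReal.ofReal_le_ofReal
      apply le_of_eq
      field_simp
      ring
  · rw [mul_comm]
    refine le_mul_of_one_le_left' ?_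
    simpa using hc

/-- Truncation argument of Maz'ya: applying the weak-type inequality to the
truncations of `φ` at all levels `t` and integrating in `t` yields the strong-type inequality,
because `t * truncEnergy t` is bounded pointwise, and `∫ truncEnergy t dt` is bounded
pointwise too, by the energy density of `φ`. -/
theorem lintegral_rpow_le_of_truncation {X : Type*} [MeasurableSpace X] {μ : Measure X} [SFinite μ]
    {p c : ℝ} (hp : 1 ≤ p) (hc : 1 ≤ c) {W : ℝ≥0∞} {φ : X → ℝ} {D h : X → ℝ≥0∞}
    (hφ0 : ∀ x, 0 ≤ φ x)
    (hφ : Measurable φ) (hD : Measurable D) (hh : Measurable h)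
    (hweak : ∀ t, 0 < t → μ {x | 2 * t ≤ φ x} ≤ W * (∫⁻ x, truncEnergy c φ D h t x ∂μ) ^ p) :
    ∫⁻ x, ENNReal.ofReal (φ x ^ p) ∂μ ≤
      ENNReal.ofReal (2 ^ p * p) * W *
        (ENNReal.ofReal c * ∫⁻ x, (D x + ENNReal.ofReal (φ x) * h x) ∂μ) ^ p := by
  set E : ℝ≥0∞ := ENNReal.ofReal c * ∫⁻ x, (D x + ENNReal.ofReal (φ x) * h x) ∂μ with hE
  have hlevel : ∀ t ∈ Set.Ioi (0 : ℝ), μ {x | t ≤ φ x / 2} * ENNReal.ofReal (t ^ (p - 1)) ≤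
      W * E ^ (p - 1) * ∫⁻ x, truncEnergy c φ D h t x ∂μ := by
    intro t ht
    have ht' : (0 : ℝ) < t := ht
    have hset : {x | t ≤ φ x / 2} = {x | 2 * t ≤ φ x} := by
      ext x
      simp only [Set.mem_ofPred_eq]
      constructor <;> intro h <;> linarith
    set I := ∫⁻ x, truncEnergy c φ D h t x ∂μ with hI
    have hIE : ENNReal.ofReal t * I ≤ E := by
      rw [hI, hE, ← lintegral_const_mul' _ _ ENNReal.ofReal_ne_top,
        ← lintegral_const_mul' _ _ ENNReal.ofReal_ne_top]
      exact lintegral_mono fun x => mul_truncEnergy_le hc ht' x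
    rw [hset]
    calc μ {x | 2 * t ≤ φ x} * ENNReal.ofReal (t ^ (p - 1))
        ≤ W * I ^ p * ENNReal.ofReal (t ^ (p - 1)) := by gcongr; exact hweak t ht'
      _ = W * (ENNReal.ofReal t * I) ^ (p - 1) * I := by
          rw [ENNReal.mul_rpow_of_nonneg _ _ (by linarith), ENNReal.ofReal_rpow_of_pos ht']
          have : I ^ p = I ^ (p - 1) * I := by
            conv_lhs => rw [show p = (p - 1) + 1 by ring]
            rw [ENNReal.rpow_add_of_nonneg _ _ (by linarith) zero_le_one, ENNReal.rpow_one]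
          rw [this]; ring
      _ ≤ W * E ^ (p - 1) * I := by
          gcongr
  have hmain : ∫⁻ x, ENNReal.ofReal ((φ x / 2) ^ p) ∂μ ≤ ENNReal.ofReal p * (W * E ^ p) := by
    rw [lintegral_rpow_eq_lintegral_meas_le_mul μ
      (Filter.Eventually.of_forall fun x => by have := hφ0 x; simp only [Pi.zero_apply]; positivity)
      (hφ.div_const 2).aemeasurable (by linarith)]
    gcongr
    calc ∫⁻ t in Set.Ioi (0 : ℝ), μ {x | t ≤ φ x / 2} * ENNReal.ofReal (t ^ (p - 1))
        ≤ ∫⁻ t in Set.Ioi (0 : ℝ), W * E ^ (p - 1) * ∫⁻ x, truncEnergy c φ D h t x ∂μ :=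
          setLIntegral_mono' measurableSet_Ioi hlevel
      _ = W * E ^ (p - 1) *
            ∫⁻ x, (∫⁻ t in Set.Ioi (0 : ℝ), truncEnergy c φ D h t x) ∂μ := by
          rw [lintegral_const_mul, lintegral_lintegral_swap]
          · exact (measurable_truncEnergy hφ hD hh).aemeasurable
          · exact (measurable_truncEnergy (c := c) hφ hD hh).lintegral_prod_right'
      _ ≤ W * E ^ (p - 1) * E := by
          gcongr
          rw [hE, ← lintegral_const_mul' _ _ ENNReal.ofReal_ne_top]
          exact lintegral_mono fun x => lintegral_truncEnergy_le hc x
      _ = W * E ^ p := by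
          conv_rhs => rw [show p = (p - 1) + 1 by ring]
          rw [ENNReal.rpow_add_of_nonneg _ _ (by linarith) zero_le_one, ENNReal.rpow_one, mul_assoc]
  calc ∫⁻ x, ENNReal.ofReal (φ x ^ p) ∂μ
      = ENNReal.ofReal (2 ^ p) * ∫⁻ x, ENNReal.ofReal ((φ x / 2) ^ p) ∂μ := by
        rw [← lintegral_const_mul' _ _ ENNReal.ofReal_ne_top]
        refine lintegral_congr fun x => ?_
        rw [← ENNReal.ofReal_mul (by positivity),
          ← Real.mul_rpow (by norm_num) (by have := hφ0 x; positivity)]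
        congr 2
        ring
    _ ≤ ENNReal.ofReal (2 ^ p) * (ENNReal.ofReal p * (W * E ^ p)) := by gcongr
    _ = _ := by rw [ENNReal.ofReal_mul (by positivity)]; ring

open Matrix Filter Topology

/-! ### Positive definite matrices -/

section LinearAlgebra

variable {n : ℕ}

lemma dotProduct_sq_le (a b : Fin n → ℝ) : (a ⬝ᵥ b) ^ 2 ≤ (a ⬝ᵥ a) * (b ⬝ᵥ b) := by
  have := Finset.sum_mul_sq_le_sq_mul_sq Finset.univ a b
  simpa [dotProduct, sq] using this

lemma _root_.Matrix.PosSemidef.exists_eq_transpose_mul_self {M : Matrix (Fin n) (Fin n) ℝ}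
    (hM : M.PosSemidef) : ∃ B : Matrix (Fin n) (Fin n) ℝ, M = Bᵀ * B := by
  open scoped MatrixOrder in
  obtain ⟨B, hB⟩ := CStarAlgebra.nonneg_iff_eq_star_mul_self.mp hM.nonneg
  exact ⟨B, by rw [hB, Matrix.star_eq_conjTranspose, Matrix.conjTranspose_eq_transpose_of_trivial]⟩

lemma dotProduct_transpose_mul_self_mulVec (B : Matrix (Fin n) (Fin n) ℝ) (a b : Fin n → ℝ) :
    a ⬝ᵥ ((Bᵀ * B) *ᵥ b) = (B *ᵥ a) ⬝ᵥ (B *ᵥ b) := by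
  rw [← mulVec_mulVec, dotProduct_mulVec, vecMul_transpose]

lemma dotProduct_mulVec_self_nonneg {M : Matrix (Fin n) (Fin n) ℝ} (hM : M.PosSemidef)
    (a : Fin n → ℝ) : 0 ≤ a ⬝ᵥ (M *ᵥ a) := by
  simpa using hM.dotProduct_mulVec_nonneg a

lemma dotProduct_mulVec_sq_le {M : Matrix (Fin n) (Fin n) ℝ} (hM : M.PosSemidef)
    (a b : Fin n → ℝ) : (a ⬝ᵥ (M *ᵥ b)) ^ 2 ≤ (a ⬝ᵥ (M *ᵥ a)) * (b ⬝ᵥ (M *ᵥ b)) := by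
  obtain ⟨B, rfl⟩ := hM.exists_eq_transpose_mul_self
  simp_rw [dotProduct_transpose_mul_self_mulVec]
  exact dotProduct_sq_le _ _

lemma mulVec_inv_mulVec {g : Matrix (Fin n) (Fin n) ℝ} (hg : g.PosDef) (a : Fin n → ℝ) :
    g *ᵥ (g⁻¹ *ᵥ a) = a := by
  rw [mulVec_mulVec, mul_nonsing_inv _ ((isUnit_iff_isUnit_det _).1 hg.isUnit), one_mulVec]

lemma inv_mulVec_mulVec {g : Matrix (Fin n) (Fin n) ℝ} (hg : g.PosDef) (a : Fin n → ℝ) :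
    g⁻¹ *ᵥ (g *ᵥ a) = a := by
  rw [mulVec_mulVec, nonsing_inv_mul _ ((isUnit_iff_isUnit_det _).1 hg.isUnit), one_mulVec]

/-- The eigenvalues of `g⁻¹` are at most its trace. -/
lemma dotProduct_self_le_trace_inv_mul {g : Matrix (Fin n) (Fin n) ℝ} (hg : g.PosDef)
    (ξ : Fin n → ℝ) : ξ ⬝ᵥ ξ ≤ g⁻¹.trace * (ξ ⬝ᵥ (g *ᵥ ξ)) := by
  have key : ∀ i, ξ i * ξ i ≤ g⁻¹ i i * (ξ ⬝ᵥ (g *ᵥ ξ)) := by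
    intro i
    have h := dotProduct_mulVec_sq_le hg.inv.posSemidef (Pi.single i 1) (g *ᵥ ξ)
    rw [inv_mulVec_mulVec hg] at h
    simp only [single_dotProduct, one_mul, mulVec_single_one, col_apply] at h
    rw [dotProduct_comm (g *ᵥ ξ) ξ] at h
    nlinarith
  rw [trace, Finset.sum_mul]
  exact Finset.sum_le_sum fun i _ => key i

lemma trace_inv_nonneg {g : Matrix (Fin n) (Fin n) ℝ} (hg : g.PosDef) : 0 ≤ g⁻¹.trace :=
  hg.inv.posSemidef.trace_nonneg

lemma trace_inv_le {g : Matrix (Fin n) (Fin n) ℝ} (hg : g.PosDef)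
    (h : ∀ ξ, ξ ⬝ᵥ ξ ≤ ξ ⬝ᵥ (g *ᵥ ξ)) : g⁻¹.trace ≤ n := by
  have key : ∀ i, g⁻¹ i i ≤ 1 := by
    intro i
    have h' := h (g⁻¹ *ᵥ Pi.single i 1)
    rw [mulVec_inv_mulVec hg] at h'
    simp only [dotProduct_single, mul_one] at h'
    have h2 : (g⁻¹ *ᵥ Pi.single i 1) i * (g⁻¹ *ᵥ Pi.single i 1) i ≤
        (g⁻¹ *ᵥ Pi.single i 1) ⬝ᵥ (g⁻¹ *ᵥ Pi.single i 1) :=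
      Finset.single_le_sum (f := fun j => (g⁻¹ *ᵥ Pi.single i 1) j * (g⁻¹ *ᵥ Pi.single i 1) j)
        (fun j _ => mul_self_nonneg _) (Finset.mem_univ i)
    simp only [mulVec_single_one, col_apply] at h' h2
    nlinarith
  calc g⁻¹.trace = ∑ i, g⁻¹ i i := rfl
    _ ≤ ∑ _i : Fin n, (1 : ℝ) := Finset.sum_le_sum fun i _ => key i
    _ = n := by simp

variable {f : ℝ} {h : Matrix (Fin n) (Fin n) ℝ}

lemma dotProduct_graphMetric_mulVec (ξ : Fin n → ℝ) :
    ξ ⬝ᵥ ((f ^ 2 • (1 : Matrix (Fin n) (Fin n) ℝ) + h * hᵀ) *ᵥ ξ) =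
      f ^ 2 * (ξ ⬝ᵥ ξ) + (hᵀ *ᵥ ξ) ⬝ᵥ (hᵀ *ᵥ ξ) := by
  rw [add_mulVec, dotProduct_add, smul_mulVec, one_mulVec, dotProduct_smul, smul_eq_mul]
  congr 1
  have := dotProduct_transpose_mul_self_mulVec hᵀ ξ ξ
  rwa [transpose_transpose] at this

lemma posDef_smul_one_add_mul_transpose (hf : 1 ≤ f) :
    (f ^ 2 • (1 : Matrix (Fin n) (Fin n) ℝ) + h * hᵀ).PosDef := by
  refine PosDef.of_dotProduct_mulVec_pos ?_ ?_
  · rw [IsHermitian, conjTranspose_eq_transpose_of_trivial]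
    simp
  · intro ξ hξ
    rw [star_trivial, dotProduct_graphMetric_mulVec]
    have h1 : 0 < ξ ⬝ᵥ ξ := by
      have := dotProduct_star_self_pos_iff.2 hξ
      simpa using this
    have h2 : 0 ≤ (hᵀ *ᵥ ξ) ⬝ᵥ (hᵀ *ᵥ ξ) := by
      simpa using dotProduct_star_self_nonneg (hᵀ *ᵥ ξ)
    positivity

/-- Bounds for the covector `d = f₀² v + h y` in the metric inverse to `g = f² + h hᵀ`. By duality
`N = g⁻¹(d, d)` satisfies `N² ≤ (f₀² |v|² + |y|²) (N + (f₀² - f²) |ξ|²)` with `ξ = g⁻¹ d`, and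
`|ξ|² ≤ (tr g⁻¹) N`. -/
lemma dotProduct_inv_mulVec_le {f₀ : ℝ} (hf : 1 ≤ f) (v y : Fin n → ℝ) {d : Fin n → ℝ}
    (hd : d = f₀ ^ 2 • v + h *ᵥ y) {g : Matrix (Fin n) (Fin n) ℝ}
    (hg : g = f ^ 2 • (1 : Matrix (Fin n) (Fin n) ℝ) + h * hᵀ) :
    (d ⬝ᵥ (g⁻¹ *ᵥ d) ≤ (f₀ ^ 2 * (v ⬝ᵥ v) + y ⬝ᵥ y) * (1 + |f₀ ^ 2 - f ^ 2| * g⁻¹.trace)) ∧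
    ∀ k : ℝ, 1 ≤ k → f₀ ≤ k → 0 ≤ f₀ →
      d ⬝ᵥ (g⁻¹ *ᵥ d) ≤ k ^ 2 * (f₀ ^ 2 * (v ⬝ᵥ v) + y ⬝ᵥ y) := by
  have hgp : g.PosDef := hg ▸ posDef_smul_one_add_mul_transpose hf
  set ξ := g⁻¹ *ᵥ d with hξ
  set N := d ⬝ᵥ ξ with hN
  set R := f₀ ^ 2 * (v ⬝ᵥ v) + y ⬝ᵥ y with hR
  have nn : ∀ a : Fin n → ℝ, 0 ≤ a ⬝ᵥ a := fun a => by
    simpa using dotProduct_star_self_nonneg a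
  have hR0 : 0 ≤ R := by have := nn v; have := nn y; positivity
  have hN0 : 0 ≤ N := dotProduct_mulVec_self_nonneg hgp.inv.posSemidef d
  have hNg : N = f ^ 2 * (ξ ⬝ᵥ ξ) + (hᵀ *ᵥ ξ) ⬝ᵥ (hᵀ *ᵥ ξ) := by
    rw [← dotProduct_graphMetric_mulVec, ← hg, hξ, mulVec_inv_mulVec hgp, hN, dotProduct_comm]
  have hNd : N = f₀ ^ 2 * (v ⬝ᵥ ξ) + y ⬝ᵥ (hᵀ *ᵥ ξ) := by
    rw [dotProduct_mulVec y, vecMul_transpose, hN]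
    conv_lhs => rw [hd]
    rw [add_dotProduct, smul_dotProduct, smul_eq_mul]
  have hCS : N ^ 2 ≤ R * (f₀ ^ 2 * (ξ ⬝ᵥ ξ) + (hᵀ *ᵥ ξ) ⬝ᵥ (hᵀ *ᵥ ξ)) := by
    have h1 := dotProduct_sq_le v ξ
    have h2 := dotProduct_sq_le y (hᵀ *ᵥ ξ)
    rw [hNd, hR]
    generalize v ⬝ᵥ ξ = a at *
    generalize y ⬝ᵥ (hᵀ *ᵥ ξ) = b at *
    have hA := nn v
    have hB := nn y
    have hX := nn ξ
    have hY := nn (hᵀ *ᵥ ξ)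
    generalize v ⬝ᵥ v = A at *
    generalize y ⬝ᵥ y = B at *
    generalize ξ ⬝ᵥ ξ = X at *
    generalize (hᵀ *ᵥ ξ) ⬝ᵥ (hᵀ *ᵥ ξ) = Y at *
    have h3 : 2 * (a * b) ≤ A * Y + B * X := by
      have hab : (a * b) ^ 2 ≤ (A * X) * (B * Y) := by
        rw [mul_pow]; exact mul_le_mul h1 h2 (sq_nonneg _) (by positivity)
      have h4 : (2 * (a * b)) ^ 2 ≤ (A * Y + B * X) ^ 2 := by
        nlinarith [sq_nonneg (A * Y - B * X)]
      exact (abs_le_of_sq_le_sq' h4 (by positivity)).2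
    have h5 : f₀ ^ 4 * a ^ 2 ≤ f₀ ^ 4 * (A * X) := by gcongr
    have h6 : f₀ ^ 2 * (2 * (a * b)) ≤ f₀ ^ 2 * (A * Y + B * X) := by gcongr
    nlinarith
  have hT := dotProduct_self_le_trace_inv_mul hgp ξ
  have hT0 := trace_inv_nonneg hgp
  have hgξ : ξ ⬝ᵥ (g *ᵥ ξ) = N := by
    rw [hξ, mulVec_inv_mulVec hgp, hN, dotProduct_comm]
  rw [hgξ] at hT
  have hX := nn ξ
  have hY := nn (hᵀ *ᵥ ξ)
  constructor
  · rcases hN0.eq_or_lt with h0 | h0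
    · rw [← h0]; positivity
    refine le_of_mul_le_mul_right ?_ h0
    have h7 : (f₀ ^ 2 - f ^ 2) * (ξ ⬝ᵥ ξ) ≤ |f₀ ^ 2 - f ^ 2| * (g⁻¹.trace * N) :=
      mul_le_mul (le_abs_self _) hT hX (abs_nonneg _)
    have h8 : f₀ ^ 2 * (ξ ⬝ᵥ ξ) + (hᵀ *ᵥ ξ) ⬝ᵥ (hᵀ *ᵥ ξ) ≤
        N * (1 + |f₀ ^ 2 - f ^ 2| * g⁻¹.trace) := by nlinarith
    calc N * N = N ^ 2 := (sq N).symm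
      _ ≤ _ := hCS
      _ ≤ R * (N * (1 + |f₀ ^ 2 - f ^ 2| * g⁻¹.trace)) := by gcongr
      _ = _ := by ring
  · intro k hk hfk hf0
    rcases hN0.eq_or_lt with h0 | h0
    · rw [← h0]; positivity
    refine le_of_mul_le_mul_right ?_ h0
    have h9 : f₀ ^ 2 * (ξ ⬝ᵥ ξ) + (hᵀ *ᵥ ξ) ⬝ᵥ (hᵀ *ᵥ ξ) ≤ k ^ 2 * N := by
      have a1 : f₀ ^ 2 ≤ k ^ 2 := by gcongr
      have a2 : f₀ ^ 2 * (ξ ⬝ᵥ ξ) ≤ k ^ 2 * (f ^ 2 * (ξ ⬝ᵥ ξ)) := by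
        exact mul_le_mul a1 (le_mul_of_one_le_left hX (one_le_pow₀ hf)) hX (by positivity)
      have a3 : (hᵀ *ᵥ ξ) ⬝ᵥ (hᵀ *ᵥ ξ) ≤ k ^ 2 * ((hᵀ *ᵥ ξ) ⬝ᵥ (hᵀ *ᵥ ξ)) :=
        le_mul_of_one_le_left hY (one_le_pow₀ hk)
      rw [hNg]; linarith
    calc N * N = N ^ 2 := (sq N).symm
      _ ≤ _ := hCS
      _ ≤ R * (k ^ 2 * N) := by gcongr
      _ = _ := by ring

end LinearAlgebra

/-! ### Calculus of partial derivatives -/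

section Calculus

variable {n : ℕ} {x : EuclideanSpace ℝ (Fin n)} {i : Fin n}

lemma pderiv_add {a b : EuclideanSpace ℝ (Fin n) → ℝ} (ha : DifferentiableAt ℝ a x)
    (hb : DifferentiableAt ℝ b x) :
    pderiv i (fun y => a y + b y) x = pderiv i a x + pderiv i b x := by
  simp [pderiv, fderiv_fun_add ha hb]

lemma pderiv_mul {a b : EuclideanSpace ℝ (Fin n) → ℝ} (ha : DifferentiableAt ℝ a x)
    (hb : DifferentiableAt ℝ b x) :
    pderiv i (fun y => a y * b y) x = a x * pderiv i b x + pderiv i a x * b x := by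
  simp [pderiv, fderiv_fun_mul ha hb, mul_comm]

lemma pderiv_sum {ι : Type*} {s : Finset ι} {a : ι → EuclideanSpace ℝ (Fin n) → ℝ}
    (ha : ∀ k ∈ s, DifferentiableAt ℝ (a k) x) :
    pderiv i (fun y => ∑ k ∈ s, a k y) x = ∑ k ∈ s, pderiv i (a k) x := by
  simp [pderiv, fderiv_fun_sum ha]

@[simp] lemma pderiv_const (c : ℝ) : pderiv i (fun _ => c) x = 0 := by
  simp [pderiv]

lemma pderiv_sub_const (a : EuclideanSpace ℝ (Fin n) → ℝ) (c : ℝ) :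
    pderiv i (fun y => a y - c) x = pderiv i a x := by
  rw [pderiv, pderiv, _root_.fderiv_sub_const]

lemma pderiv_const_mul {a : EuclideanSpace ℝ (Fin n) → ℝ} (ha : DifferentiableAt ℝ a x) (c : ℝ) :
    pderiv i (fun y => c * a y) x = c * pderiv i a x := by
  simp [pderiv, fderiv_const_mul ha]

lemma pderiv_coord (k : Fin n) :
    pderiv i (fun y : EuclideanSpace ℝ (Fin n) => y k) x = if k = i then 1 else 0 := by
  have : (fun y : EuclideanSpace ℝ (Fin n) => y k) =
      (EuclideanSpace.proj k : EuclideanSpace ℝ (Fin n) →L[ℝ] ℝ) := rfl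
  rw [pderiv, this, ContinuousLinearMap.fderiv]
  simp

lemma pderiv_comp {β : ℝ → ℝ} {β' : ℝ} {a : EuclideanSpace ℝ (Fin n) → ℝ}
    (hβ : HasDerivAt β β' (a x)) (ha : DifferentiableAt ℝ a x) :
    pderiv i (fun y => β (a y)) x = β' * pderiv i a x := by
  have := (hβ.comp_hasFDerivAt x ha.hasFDerivAt).fderiv
  rw [pderiv]
  change fderiv ℝ (β ∘ a) x _ = _
  rw [this]; simp [pderiv]

lemma pderiv_congr {a b : EuclideanSpace ℝ (Fin n) → ℝ} (h : a =ᶠ[𝓝 x] b) :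
    pderiv i a x = pderiv i b x := by
  rw [pderiv, pderiv, h.fderiv_eq]

lemma contDiffOn_pderiv {a : EuclideanSpace ℝ (Fin n) → ℝ} {U : Set (EuclideanSpace ℝ (Fin n))}
    (hU : IsOpen U) {m k : WithTop ℕ∞} (ha : ContDiffOn ℝ k a U) (hm : m + 1 ≤ k) :
    ContDiffOn ℝ m (fun y => pderiv i a y) U :=
  (ha.fderiv_of_isOpen hU hm).clm_apply contDiffOn_const

lemma pderiv_comm {a : EuclideanSpace ℝ (Fin n) → ℝ} {U : Set (EuclideanSpace ℝ (Fin n))}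
    (hU : IsOpen U) (ha : ContDiffOn ℝ 2 a U) (hx : x ∈ U) (j : Fin n) :
    pderiv i (fun y => pderiv j a y) x = pderiv j (fun y => pderiv i a y) x := by
  have hat : ContDiffAt ℝ 2 a x := ha.contDiffAt (hU.mem_nhds hx)
  have hd : DifferentiableAt ℝ (fderiv ℝ a) x :=
    (hat.fderiv_right (m := 1) (by norm_num)).differentiableAt (by norm_num)
  have hs : IsSymmSndFDerivAt ℝ a x := hat.isSymmSndFDerivAt (by simp)
  have e : ∀ k l : Fin n, pderiv k (fun y => pderiv l a y) x =
      fderiv ℝ (fderiv ℝ a) x (EuclideanSpace.single k 1) (EuclideanSpace.single l 1) := by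
    intro k l
    unfold pderiv
    rw [fderiv_clm_apply hd (differentiableAt_const _)]
    simp
  rw [e, e]
  exact hs _ _

/-! ### Functions of a matrix -/

lemma contDiffOn_det {E : Type*} [NormedAddCommGroup E] [NormedSpace ℝ E] {U : Set E}
    {g : E → Matrix (Fin n) (Fin n) ℝ} {m : WithTop ℕ∞}
    (hg : ∀ a b, ContDiffOn ℝ m (fun y => g y a b) U) :
    ContDiffOn ℝ m (fun y => (g y).det) U := by
  simp_rw [Matrix.det_apply]
  refine ContDiffOn.sum fun σ _ => ?_
  simp_rw [Units.smul_def, zsmul_eq_mul]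
  exact contDiffOn_const.mul (contDiffOn_prod fun k _ => hg _ _)

lemma contDiffOn_inv_apply {E : Type*} [NormedAddCommGroup E] [NormedSpace ℝ E] {U : Set E}
    {g : E → Matrix (Fin n) (Fin n) ℝ} {m : WithTop ℕ∞}
    (hg : ∀ a b, ContDiffOn ℝ m (fun y => g y a b) U) (hdet : ∀ y ∈ U, (g y).det ≠ 0)
    (a b : Fin n) : ContDiffOn ℝ m (fun y => (g y)⁻¹ a b) U := by
  simp_rw [Matrix.inv_def, Matrix.smul_apply, Ring.inverse_eq_inv', smul_eq_mul, adjugate_apply]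
  refine ((contDiffOn_det hg).inv hdet).mul (contDiffOn_det fun c d => ?_)
  by_cases hc : c = b
  · subst hc
    simp only [updateRow_self]
    exact contDiffOn_const
  · simp only [updateRow_ne hc]
    exact hg c d

lemma differentiable_det :
    Differentiable ℝ (fun M : Fin n → Fin n → ℝ => (Matrix.of M).det) := by
  have : ContDiffOn ℝ 1 (fun M : Fin n → Fin n → ℝ => (Matrix.of M).det) Set.univ :=
    contDiffOn_det fun a b => by
      simp only [of_apply]
      exact (contDiff_apply_apply ℝ ℝ a b).contDiffOn
  exact (contDiffOn_univ.1 this).differentiable (by norm_num)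

/-- Jacobi's formula for the directional derivative of the determinant. -/
lemma fderiv_det_apply {A : Fin n → Fin n → ℝ} (hA : (of A).det ≠ 0) (B : Fin n → Fin n → ℝ) :
    fderiv ℝ (fun M : Fin n → Fin n → ℝ => (Matrix.of M).det) A B =
      (of A).det * ((of A)⁻¹ * of B).trace := by
  have hline : HasDerivAt (fun t : ℝ => A + t • B) B 0 := by
    simpa using ((hasDerivAt_id (0 : ℝ)).smul_const B).const_add A
  have h1 : HasDerivAt (fun t : ℝ => (of (A + t • B)).det)
      (fderiv ℝ (fun M : Fin n → Fin n → ℝ => (Matrix.of M).det) A B) 0 := by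
    have hd' : HasFDerivAt (fun M : Fin n → Fin n → ℝ => (Matrix.of M).det)
        (fderiv ℝ (fun M : Fin n → Fin n → ℝ => (Matrix.of M).det) A)
        (A + (0 : ℝ) • B) := by
      rw [zero_smul, add_zero]; exact (differentiable_det A).hasFDerivAt
    exact hd'.comp_hasDerivAt (0 : ℝ) hline
  -- along the line through `A` in the direction `B`, the determinant is an explicit polynomial
  set M : Matrix (Fin n) (Fin n) ℝ := (of A)⁻¹ * of B with hM
  set P := (1 + (Polynomial.X : Polynomial ℝ) • M.map Polynomial.C).det.divX.divX with hP
  have h2 : HasDerivAt (fun t : ℝ => (of A).det * (1 + M.trace * t + P.eval t * t ^ 2))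
      ((of A).det * M.trace) 0 := by
    have := ((((hasDerivAt_id (0 : ℝ)).const_mul M.trace).const_add 1).add
      ((P.hasDerivAt 0).mul ((hasDerivAt_id (0 : ℝ)).pow 2))).const_mul (of A).det
    simpa using this
  have heq : (fun t : ℝ => (of (A + t • B)).det) =
      fun t : ℝ => (of A).det * (1 + M.trace * t + P.eval t * t ^ 2) := by
    funext t
    rw [hP, ← det_one_add_smul, ← det_mul, mul_add, mul_one, Matrix.mul_smul, hM, ← mul_assoc,
      mul_nonsing_inv _ (isUnit_iff_ne_zero.2 hA), one_mul]
    rfl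
  rw [heq] at h1
  exact h1.unique h2

lemma pderiv_det {U : Set (EuclideanSpace ℝ (Fin n))} (hU : IsOpen U)
    {g : EuclideanSpace ℝ (Fin n) → Matrix (Fin n) (Fin n) ℝ}
    (hg : ∀ a b, ContDiffOn ℝ 1 (fun y => g y a b) U) (hx : x ∈ U) (hdet : (g x).det ≠ 0) :
    pderiv i (fun y => (g y).det) x =
      (g x).det * ∑ a, ∑ b, (g x)⁻¹ a b * pderiv i (fun y => g y b a) x := by
  have hgd : ∀ a b, DifferentiableAt ℝ (fun y => g y a b) x := fun a b =>
    ((hg a b).contDiffAt (hU.mem_nhds hx)).differentiableAt (by norm_num)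
  have hgf : HasFDerivAt (fun y => (g y : Fin n → Fin n → ℝ))
      (ContinuousLinearMap.pi fun a => ContinuousLinearMap.pi fun b =>
        fderiv ℝ (fun y => g y a b) x) x :=
    hasFDerivAt_pi.2 fun a => hasFDerivAt_pi.2 fun b => (hgd a b).hasFDerivAt
  have hcomp := ((differentiable_det (g x)).hasFDerivAt.comp x hgf).fderiv
  have e : pderiv i (fun y => (g y).det) x =
      fderiv ℝ (fun M : Fin n → Fin n → ℝ => (Matrix.of M).det) (g x)
        (fun a b => pderiv i (fun y => g y a b) x) := by
    rw [pderiv]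
    change fderiv ℝ ((fun M : Fin n → Fin n → ℝ => (Matrix.of M).det) ∘ fun y => g y) x _ = _
    rw [hcomp]
    rfl
  rw [e]
  refine (fderiv_det_apply (A := g x) hdet _).trans ?_
  simp only [trace, diag_apply, mul_apply, of_apply]
  rfl

lemma pderiv_inv_apply {U : Set (EuclideanSpace ℝ (Fin n))} (hU : IsOpen U)
    {g : EuclideanSpace ℝ (Fin n) → Matrix (Fin n) (Fin n) ℝ}
    (hg : ∀ a b, ContDiffOn ℝ 1 (fun y => g y a b) U) (hdet : ∀ y ∈ U, (g y).det ≠ 0)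
    (hx : x ∈ U) (a b : Fin n) :
    pderiv i (fun y => (g y)⁻¹ a b) x =
      -∑ c, ∑ d, (g x)⁻¹ a c * pderiv i (fun y => g y c d) x * (g x)⁻¹ d b := by
  have hgd : ∀ a b, DifferentiableAt ℝ (fun y => g y a b) x := fun a b =>
    ((hg a b).contDiffAt (hU.mem_nhds hx)).differentiableAt (by norm_num)
  have hid : ∀ a b, DifferentiableAt ℝ (fun y => (g y)⁻¹ a b) x := fun a b =>
    ((contDiffOn_inv_apply hg hdet a b).contDiffAt (hU.mem_nhds hx)).differentiableAt (by norm_num)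
  set Dg : Matrix (Fin n) (Fin n) ℝ := of fun c d => pderiv i (fun y => g y c d) x with hDg
  set Di : Matrix (Fin n) (Fin n) ℝ := of fun c d => pderiv i (fun y => (g y)⁻¹ c d) x with hDi
  have hprod : (g x)⁻¹ * Dg + Di * g x = 0 := by
    ext c d
    have h0 : pderiv i (fun y => ∑ k, (g y)⁻¹ c k * g y k d) x = 0 := by
      have : (fun y => ∑ k, (g y)⁻¹ c k * g y k d) =ᶠ[𝓝 x]
          fun _ => (1 : Matrix (Fin n) (Fin n) ℝ) c d := by
        filter_upwards [hU.mem_nhds hx] with y hy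
        rw [← nonsing_inv_mul (g y) (isUnit_iff_ne_zero.2 (hdet y hy)), mul_apply]
      rw [pderiv_congr this, pderiv_const]
    rw [pderiv_sum (a := fun k y => (g y)⁻¹ c k * g y k d) fun k _ => (hid c k).mul (hgd k d)] at h0
    simp_rw [fun k => pderiv_mul (i := i) (hid c k) (hgd k d), Finset.sum_add_distrib] at h0
    simpa [mul_apply, hDg, hDi] using h0
  have hinv := mul_nonsing_inv (g x) (isUnit_iff_ne_zero.2 (hdet x hx))
  have hDi' : Di = -((g x)⁻¹ * Dg * (g x)⁻¹) := by
    calc Di = Di * (g x * (g x)⁻¹) := by rw [hinv, mul_one]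
      _ = (Di * g x) * (g x)⁻¹ := by rw [mul_assoc]
      _ = _ := by rw [eq_neg_of_add_eq_zero_right hprod, neg_mul]
  have := congrFun (congrFun hDi' a) b
  rw [hDi] at this
  simp only [of_apply] at this
  rw [this]
  simp only [Matrix.neg_apply, mul_apply, hDg, of_apply, Finset.sum_mul]
  rw [Finset.sum_comm]

/-! ### Extension by zero and the divergence theorem -/

lemma eventually_eq_zero_of_notMem {E : Type*} [TopologicalSpace E] [T2Space E] {S : Set E}
    (hS : IsCompact S) {v : E → ℝ} (hv : ∀ x, x ∉ S → v x = 0) {x : E} (hx : x ∉ S) :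
    v =ᶠ[𝓝 x] fun _ => 0 := by
  filter_upwards [hS.isClosed.isOpen_compl.mem_nhds hx] with y hy using hv y hy

lemma contDiff_of_contDiffOn_of_eq_zero {E : Type*} [NormedAddCommGroup E] [NormedSpace ℝ E]
    {U S : Set E} (hU : IsOpen U) (hSU : S ⊆ U) (hS : IsCompact S) {v : E → ℝ}
    {m : WithTop ℕ∞} (h : ContDiffOn ℝ m v U) (hv : ∀ x, x ∉ S → v x = 0) : ContDiff ℝ m v := by
  rw [contDiff_iff_contDiffAt]
  intro x
  by_cases hx : x ∈ U
  · exact h.contDiffAt (hU.mem_nhds hx)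
  · exact contDiffAt_const.congr_of_eventuallyEq
      (eventually_eq_zero_of_notMem hS hv fun h' => hx (hSU h'))

lemma continuous_of_continuousOn_of_eq_zero {E : Type*} [TopologicalSpace E] [T2Space E]
    {U S : Set E} (hU : IsOpen U) (hSU : S ⊆ U) (hS : IsCompact S) {v : E → ℝ}
    (h : ContinuousOn v U) (hv : ∀ x, x ∉ S → v x = 0) : Continuous v := by
  rw [continuous_iff_continuousAt]
  intro x
  by_cases hx : x ∈ U
  · exact h.continuousAt (hU.mem_nhds hx)
  · exact continuousAt_const.congr
      (eventually_eq_zero_of_notMem hS hv fun h' => hx (hSU h')).symm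

lemma integral_pderiv_eq_zero {v : EuclideanSpace ℝ (Fin n) → ℝ} (hv : ContDiff ℝ 1 v)
    {S : Set (EuclideanSpace ℝ (Fin n))} (hS : IsCompact S) (h : ∀ x, x ∉ S → v x = 0) :
    ∫ x, pderiv i v x = 0 := by
  have hcs : HasCompactSupport v := HasCompactSupport.intro hS h
  have hint : Integrable (fun x => fderiv ℝ v x (EuclideanSpace.single i 1)) :=
    ((hv.continuous_fderiv (by norm_num)).clm_apply continuous_const).integrable_of_hasCompactSupport
      (hcs.fderiv_apply ℝ _)
  have := integral_mul_fderiv_eq_neg_fderiv_mul_of_integrable (μ := volume) (f := v)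
    (g := fun _ => (1 : ℝ)) (v := EuclideanSpace.single i 1)
    (by simpa using hint) (by simp)
    (by simpa using hv.continuous.integrable_of_hasCompactSupport hcs)
    (fun x _ => (hv.differentiable (by norm_num)) x) (fun x _ => differentiableAt_const _)
  simpa [pderiv] using this.symm

end Calculus

/-! ### The geometry of the gradient graph in coordinates -/

section Geometry

variable {n : ℕ}

/-- The Hessian matrix of `u`. -/
def hess (u : EuclideanSpace ℝ (Fin n) → ℝ) (x : EuclideanSpace ℝ (Fin n)) :
    Matrix (Fin n) (Fin n) ℝ :=
  of fun i a => pderiv i (fun y => pderiv a u y) x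

/-- The third derivatives `∂ᵢ ∂ⱼ ∂ₘ u`. -/
def thirdDeriv (u : EuclideanSpace ℝ (Fin n) → ℝ) (x : EuclideanSpace ℝ (Fin n))
    (i j m : Fin n) : ℝ :=
  pderiv i (fun y => hess u y j m) x

/-- The metric `f² δ + D²u (D²u)ᵀ` of the gradient graph. -/
def graphMetric (f u : EuclideanSpace ℝ (Fin n) → ℝ) (x : EuclideanSpace ℝ (Fin n)) :
    Matrix (Fin n) (Fin n) ℝ :=
  f x ^ 2 • (1 : Matrix (Fin n) (Fin n) ℝ) + hess u x * (hess u x)ᵀ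

/-- The Christoffel symbols of the first kind `⟨∇̄_{∂ᵢ} ∂ⱼ, ∂ₖ⟩` of the gradient graph. -/
def christoffelFirst (f u : EuclideanSpace ℝ (Fin n) → ℝ) (x : EuclideanSpace ℝ (Fin n))
    (i j k : Fin n) : ℝ :=
  f x * ((if j = k then pderiv i f x else 0) + (if i = k then pderiv j f x else 0)
    - (if i = j then pderiv k f x else 0)) + ∑ m, thirdDeriv u x i j m * hess u x k m

lemma tangentVec_inl (u : EuclideanSpace ℝ (Fin n) → ℝ) (x : EuclideanSpace ℝ (Fin n))
    (i a : Fin n) : tangentVec (gradGraph u) x i (Sum.inl a) = if a = i then 1 else 0 :=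
  pderiv_coord a

lemma tangentVec_inr (u : EuclideanSpace ℝ (Fin n) → ℝ) (x : EuclideanSpace ℝ (Fin n))
    (i a : Fin n) : tangentVec (gradGraph u) x i (Sum.inr a) = hess u x i a := rfl

lemma weightedMetric_gradGraph (f u : EuclideanSpace ℝ (Fin n) → ℝ)
    (x : EuclideanSpace ℝ (Fin n)) :
    weightedMetric f (gradGraph u x) = fromBlocks (f x ^ 2 • 1) 0 0 1 := rfl

lemma ambientInner_weightedMetric (f u : EuclideanSpace ℝ (Fin n) → ℝ)
    (x : EuclideanSpace ℝ (Fin n)) (V W : Fin n ⊕ Fin n → ℝ) :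
    ambientInner (weightedMetric f) (gradGraph u x) V W =
      f x ^ 2 * ∑ a, V (Sum.inl a) * W (Sum.inl a) + ∑ a, V (Sum.inr a) * W (Sum.inr a) := by
  simp only [ambientInner, weightedMetric_gradGraph, Fintype.sum_sum_type, fromBlocks_apply₁₁,
    fromBlocks_apply₁₂, fromBlocks_apply₂₁, fromBlocks_apply₂₂, Matrix.smul_apply,
    Matrix.one_apply, Matrix.zero_apply, smul_eq_mul, mul_ite, ite_mul, mul_one, mul_zero,
    zero_mul, one_mul, Finset.sum_ite_eq, Finset.mem_univ, if_true, Finset.sum_const_zero,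
    add_zero, zero_add, Finset.mul_sum]
  simp only [mul_assoc]

lemma inducedMetric_eq (f u : EuclideanSpace ℝ (Fin n) → ℝ) (x : EuclideanSpace ℝ (Fin n)) :
    inducedMetric (weightedMetric f) (gradGraph u) x = graphMetric f u x := by
  ext i j
  simp only [inducedMetric, of_apply, ambientInner_weightedMetric, tangentVec_inl, tangentVec_inr,
    graphMetric, Matrix.add_apply, Matrix.smul_apply, Matrix.one_apply, mul_apply, transpose_apply,
    smul_eq_mul]
  congr 2
  simp [eq_comm]

lemma inv_weightedMetric {f u : EuclideanSpace ℝ (Fin n) → ℝ}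
    {x : EuclideanSpace ℝ (Fin n)} (hf : f x ≠ 0) :
    (weightedMetric f (gradGraph u x))⁻¹ =
      fromBlocks ((f x ^ 2)⁻¹ • (1 : Matrix (Fin n) (Fin n) ℝ)) 0 0 1 := by
  rw [weightedMetric_gradGraph]
  refine inv_eq_right_inv ?_
  rw [fromBlocks_multiply]
  simp [smul_smul, hf, ← fromBlocks_one]

lemma ambientPderiv_weightedMetric {f u : EuclideanSpace ℝ (Fin n) → ℝ}
    {x : EuclideanSpace ℝ (Fin n)} (hf : DifferentiableAt ℝ f x) (a l b : Fin n) :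
    ambientPderiv (Sum.inl a) (fun w => weightedMetric f w (Sum.inl l) (Sum.inl b))
      (gradGraph u x) = if l = b then 2 * f x * pderiv a f x else 0 := by
  simp only [weightedMetric, fromBlocks_apply₁₁, Matrix.smul_apply, Matrix.one_apply, smul_eq_mul,
    mul_ite, mul_one, mul_zero]
  split_ifs with h
  · set p : (Fin n ⊕ Fin n → ℝ) →L[ℝ] EuclideanSpace ℝ (Fin n) :=
      ((EuclideanSpace.equiv (Fin n) ℝ).symm : (Fin n → ℝ) →L[ℝ] EuclideanSpace ℝ (Fin n)).comp
        (ContinuousLinearMap.pi fun i => ContinuousLinearMap.proj (Sum.inl i)) with hp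
    have hpx : p (gradGraph u x) = x := rfl
    have h1 : HasFDerivAt (fun w => f (p w)) ((fderiv ℝ f x).comp p) (gradGraph u x) := by
      have : HasFDerivAt f (fderiv ℝ f x) (p (gradGraph u x)) := hf.hasFDerivAt
      exact this.comp _ p.hasFDerivAt
    have h2 := (h1.pow 2).fderiv
    have h3 : p (Pi.single (Sum.inl a) 1) = EuclideanSpace.single a 1 := by
      ext c
      simp [hp, Pi.single_apply]
    rw [ambientPderiv]
    change fderiv ℝ (fun w => f (p w) ^ 2) _ _ = _
    rw [h2]
    simp [hpx, h3, pderiv]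
  · simp [ambientPderiv]

lemma ambientPderiv_inr_weightedMetric {f u : EuclideanSpace ℝ (Fin n) → ℝ}
    {x : EuclideanSpace ℝ (Fin n)} (hf : DifferentiableAt ℝ f x) (a l b : Fin n) :
    ambientPderiv (Sum.inr a) (fun w => weightedMetric f w (Sum.inl l) (Sum.inl b))
      (gradGraph u x) = 0 := by
  simp only [weightedMetric, fromBlocks_apply₁₁, Matrix.smul_apply, Matrix.one_apply, smul_eq_mul,
    mul_ite, mul_one, mul_zero]
  split_ifs with h
  · set p : (Fin n ⊕ Fin n → ℝ) →L[ℝ] EuclideanSpace ℝ (Fin n) :=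
      ((EuclideanSpace.equiv (Fin n) ℝ).symm : (Fin n → ℝ) →L[ℝ] EuclideanSpace ℝ (Fin n)).comp
        (ContinuousLinearMap.pi fun i => ContinuousLinearMap.proj (Sum.inl i)) with hp
    have hpx : p (gradGraph u x) = x := rfl
    have h1 : HasFDerivAt (fun w => f (p w)) ((fderiv ℝ f x).comp p) (gradGraph u x) := by
      have : HasFDerivAt f (fderiv ℝ f x) (p (gradGraph u x)) := hf.hasFDerivAt
      exact this.comp _ p.hasFDerivAt
    have h2 := (h1.pow 2).fderiv
    have h3 : p (Pi.single (Sum.inr a) 1) = 0 := by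
      ext c
      simp [hp]
    rw [ambientPderiv]
    change fderiv ℝ (fun w => f (p w) ^ 2) _ _ = _
    rw [h2]
    simp [h3]
  · simp [ambientPderiv]

lemma christoffel_inl {f u : EuclideanSpace ℝ (Fin n) → ℝ} {x : EuclideanSpace ℝ (Fin n)}
    (hf : DifferentiableAt ℝ f x) (hf0 : f x ≠ 0) (c a b : Fin n) :
    christoffel (weightedMetric f) (gradGraph u x) (Sum.inl c) (Sum.inl a) (Sum.inl b) =
      (f x)⁻¹ * ((if c = b then pderiv a f x else 0) + (if a = c then pderiv b f x else 0)
        - (if a = b then pderiv c f x else 0)) := by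
  rw [christoffel, Fintype.sum_sum_type]
  simp only [inv_weightedMetric hf0, fromBlocks_apply₁₁, fromBlocks_apply₁₂, Matrix.smul_apply,
    Matrix.one_apply, Matrix.zero_apply, zero_mul, Finset.sum_const_zero, add_zero, smul_eq_mul,
    ambientPderiv_weightedMetric hf, mul_ite, mul_one, mul_zero, ite_mul, Finset.sum_ite_eq,
    Finset.mem_univ, if_true]
  have hf1 := hf0
  split_ifs <;> field_simp <;> ring

lemma christoffel_eq_zero {f u : EuclideanSpace ℝ (Fin n) → ℝ} {x : EuclideanSpace ℝ (Fin n)}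
    (hf : DifferentiableAt ℝ f x) (hf0 : f x ≠ 0) :
    (∀ c a b, christoffel (weightedMetric f) (gradGraph u x) (Sum.inr c) a b = 0) ∧
    (∀ c a b, christoffel (weightedMetric f) (gradGraph u x) c (Sum.inr a) b = 0) ∧
    (∀ c a b, christoffel (weightedMetric f) (gradGraph u x) c a (Sum.inr b) = 0) := by
  have z12 : ∀ d l b, ambientPderiv d (fun w => weightedMetric f w (Sum.inl l) (Sum.inr b))
      (gradGraph u x) = 0 := by
    intro d l b; simp [weightedMetric, ambientPderiv]
  have z21 : ∀ d l b, ambientPderiv d (fun w => weightedMetric f w (Sum.inr l) (Sum.inl b))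
      (gradGraph u x) = 0 := by
    intro d l b; simp [weightedMetric, ambientPderiv]
  have z22 : ∀ d l b, ambientPderiv d (fun w => weightedMetric f w (Sum.inr l) (Sum.inr b))
      (gradGraph u x) = 0 := by
    intro d l b; simp [weightedMetric, ambientPderiv]
  have z11 := @ambientPderiv_inr_weightedMetric n f u x hf
  refine ⟨?_, ?_, ?_⟩
  · intro c a b
    rw [christoffel, Fintype.sum_sum_type]
    rcases a with a | a <;> rcases b with b | b <;>
      simp [inv_weightedMetric hf0, z12, z21, z22, z11]
  · intro c a b
    rw [christoffel, Fintype.sum_sum_type]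
    rcases c with c | c <;> rcases b with b | b <;>
      simp [inv_weightedMetric hf0, z12, z21, z22, z11]
  · intro c a b
    rw [christoffel, Fintype.sum_sum_type]
    rcases c with c | c <;> rcases a with a | a <;>
      simp [inv_weightedMetric hf0, z12, z21, z22, z11]

lemma covDeriv_inl {f u : EuclideanSpace ℝ (Fin n) → ℝ} {x : EuclideanSpace ℝ (Fin n)}
    (hf : DifferentiableAt ℝ f x) (hf0 : f x ≠ 0) (i j c : Fin n) :
    covDeriv (weightedMetric f) (gradGraph u) x i j (Sum.inl c) =
      (f x)⁻¹ * ((if j = c then pderiv i f x else 0) + (if i = c then pderiv j f x else 0)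
        - (if i = j then pderiv c f x else 0)) := by
  obtain ⟨-, z2, z3⟩ := christoffel_eq_zero (u := u) hf hf0
  simp only [covDeriv, Fintype.sum_sum_type, tangentVec_inl, tangentVec_inr, z2, z3,
    christoffel_inl hf hf0, pderiv_const]
  simp [eq_comm]

lemma covDeriv_inr {f u : EuclideanSpace ℝ (Fin n) → ℝ} {x : EuclideanSpace ℝ (Fin n)}
    (hf : DifferentiableAt ℝ f x) (hf0 : f x ≠ 0) (i j m : Fin n) :
    covDeriv (weightedMetric f) (gradGraph u) x i j (Sum.inr m) = thirdDeriv u x i j m := by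
  obtain ⟨z1, -, -⟩ := christoffel_eq_zero (u := u) hf hf0
  simp only [covDeriv, z1, tangentVec_inr, thirdDeriv, zero_mul, Finset.sum_const_zero, add_zero]

lemma ambientInner_covDeriv {f u : EuclideanSpace ℝ (Fin n) → ℝ} {x : EuclideanSpace ℝ (Fin n)}
    (hf : DifferentiableAt ℝ f x) (hf0 : f x ≠ 0) (i j k : Fin n) :
    ambientInner (weightedMetric f) (gradGraph u x)
      (covDeriv (weightedMetric f) (gradGraph u) x i j)
      (tangentVec (gradGraph u) x k) = christoffelFirst f u x i j k := by
  rw [ambientInner_weightedMetric, christoffelFirst]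
  simp only [covDeriv_inl hf hf0, covDeriv_inr hf hf0, tangentVec_inl, tangentVec_inr, mul_ite,
    mul_one, mul_zero, Finset.sum_ite_eq', Finset.mem_univ, if_true]
  congr 1
  field_simp

section Pointwise

variable {Ω : Set (EuclideanSpace ℝ (Fin n))} {u f : EuclideanSpace ℝ (Fin n) → ℝ}
  {x : EuclideanSpace ℝ (Fin n)}

lemma contDiffOn_hess (hΩ : IsOpen Ω) (hu : ContDiffOn ℝ 3 u Ω) (i a : Fin n) :
    ContDiffOn ℝ 1 (fun y => hess u y i a) Ω :=
  contDiffOn_pderiv hΩ (contDiffOn_pderiv (m := 2) hΩ hu (by norm_num)) (by norm_num)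

lemma continuousOn_thirdDeriv (hΩ : IsOpen Ω) (hu : ContDiffOn ℝ 3 u Ω) (i j m : Fin n) :
    ContinuousOn (fun y => thirdDeriv u y i j m) Ω :=
  (contDiffOn_pderiv (m := 0) hΩ (contDiffOn_hess hΩ hu j m) (by norm_num)).continuousOn

lemma thirdDeriv_symm (hΩ : IsOpen Ω) (hu : ContDiffOn ℝ 3 u Ω) (hx : x ∈ Ω) (i j m : Fin n) :
    thirdDeriv u x i j m = thirdDeriv u x j i m :=
  pderiv_comm (a := fun y => pderiv m u y) hΩ (contDiffOn_pderiv hΩ hu (by norm_num)) hx j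

lemma christoffelFirst_symm (hΩ : IsOpen Ω) (hu : ContDiffOn ℝ 3 u Ω) (hx : x ∈ Ω)
    (i j k : Fin n) : christoffelFirst f u x i j k = christoffelFirst f u x j i k := by
  simp only [christoffelFirst, thirdDeriv_symm hΩ hu hx i j]
  congr 2
  have : (if i = j then pderiv k f x else 0) = if j = i then pderiv k f x else 0 := by
    simp only [eq_comm]
  rw [this]; ring

lemma graphMetric_apply (y : EuclideanSpace ℝ (Fin n)) (j k : Fin n) : graphMetric f u y j k =
    f y * f y * (if j = k then 1 else 0) + ∑ m, hess u y j m * hess u y k m := by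
  simp [graphMetric, mul_apply, Matrix.one_apply, sq]

lemma contDiffOn_graphMetric (hΩ : IsOpen Ω) (hu : ContDiffOn ℝ 3 u Ω) (hf : ContDiffOn ℝ 1 f Ω)
    (j k : Fin n) : ContDiffOn ℝ 1 (fun y => graphMetric f u y j k) Ω := by
  simp_rw [graphMetric_apply]
  exact ((hf.mul hf).mul contDiffOn_const).add
    (ContDiffOn.sum fun m _ => (contDiffOn_hess hΩ hu j m).mul (contDiffOn_hess hΩ hu k m))

lemma _root_.ContDiffOn.differentiableAt_of_isOpen {a : EuclideanSpace ℝ (Fin n) → ℝ}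
    (ha : ContDiffOn ℝ 1 a Ω) (hΩ : IsOpen Ω) (hx : x ∈ Ω) : DifferentiableAt ℝ a x :=
  (ha.contDiffAt (hΩ.mem_nhds hx)).differentiableAt (by norm_num)

/-- Compatibility of the metric with the connection. -/
lemma pderiv_graphMetric (hΩ : IsOpen Ω) (hu : ContDiffOn ℝ 3 u Ω) (hf : ContDiffOn ℝ 1 f Ω)
    (hx : x ∈ Ω) (i j k : Fin n) :
    pderiv i (fun y => graphMetric f u y j k) x =
      christoffelFirst f u x i j k + christoffelFirst f u x i k j := by
  have hfd := hf.differentiableAt_of_isOpen hΩ hx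
  have hh : ∀ a b, DifferentiableAt ℝ (fun y => hess u y a b) x := fun a b =>
    (contDiffOn_hess hΩ hu a b).differentiableAt_of_isOpen hΩ hx
  have hsum : DifferentiableAt ℝ (fun y => ∑ m, hess u y j m * hess u y k m) x :=
    DifferentiableAt.fun_sum fun m _ => (hh j m).mul (hh k m)
  simp_rw [graphMetric_apply]
  rw [pderiv_add (a := fun y => f y * f y * (if j = k then 1 else 0))
      ((hfd.mul hfd).mul (differentiableAt_const _)) hsum,
    pderiv_mul (a := fun y => f y * f y) (hfd.mul hfd) (differentiableAt_const _),
    pderiv_mul hfd hfd, pderiv_const,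
    pderiv_sum (a := fun m y => hess u y j m * hess u y k m) fun m _ => (hh j m).mul (hh k m)]
  simp_rw [fun m => pderiv_mul (i := i) (hh j m) (hh k m), Finset.sum_add_distrib]
  simp only [christoffelFirst, thirdDeriv]
  have e1 : (if k = j then pderiv i f x else 0) = if j = k then pderiv i f x else 0 := by
    simp only [eq_comm]
  have e2 : ∑ m, hess u x j m * pderiv i (fun y => hess u y k m) x =
      ∑ m, pderiv i (fun y => hess u y k m) x * hess u x j m :=
    Finset.sum_congr rfl fun m _ => mul_comm _ _
  rw [e1, e2]
  split_ifs <;> ring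

/-- Index computation behind `Δ_g = g^{ij} ∂ᵢ∂ⱼ - g^{ij} g^{kl} ⟨∇̄_{∂ᵢ} ∂ⱼ, ∂ₖ⟩ ∂_l`, with `M` in
the role of the inverse metric and `γ` in that of the Christoffel symbols of the first kind. -/
lemma sum_christoffel_contraction {M : Fin n → Fin n → ℝ} (hM : ∀ i j, M i j = M j i)
    {γ : Fin n → Fin n → Fin n → ℝ} (hγ : ∀ i j k, γ i j k = γ j i k) (p : Fin n → ℝ) :
    ∑ i, ∑ l, ((∑ a, ∑ b, M a b * (γ i b a + γ i a b)) / 2 * (M i l * p l) -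
      (∑ c, ∑ d, M i c * (γ i c d + γ i d c) * M d l) * p l) =
    -∑ i, ∑ j, ∑ k, ∑ l, M i j * M k l * γ i j k * p l := by
  have h1 : ∀ i, (∑ a, ∑ b, M a b * (γ i b a + γ i a b)) / 2 = ∑ a, ∑ b, M a b * γ i a b := by
    intro i
    have : ∑ a, ∑ b, M a b * γ i b a = ∑ a, ∑ b, M a b * γ i a b := by
      rw [Finset.sum_comm]
      exact Finset.sum_congr rfl fun a _ => Finset.sum_congr rfl fun b _ => by rw [hM]
    simp only [mul_add, Finset.sum_add_distrib]
    rw [this]; ring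
  have h2 : ∑ i, ∑ l, (∑ c, ∑ d, M i c * γ i d c * M d l) * p l =
      ∑ i, ∑ l, (∑ a, ∑ b, M a b * γ i a b) * (M i l * p l) := by
    rw [Finset.sum_comm]
    conv_rhs => rw [Finset.sum_comm]
    refine Finset.sum_congr rfl fun l _ => ?_
    simp only [Finset.sum_mul]
    calc ∑ i, ∑ c, ∑ d, M i c * γ i d c * M d l * p l
        = ∑ i, ∑ d, ∑ c, M i c * γ i d c * M d l * p l :=
          Finset.sum_congr rfl fun i _ => Finset.sum_comm
      _ = ∑ d, ∑ i, ∑ c, M i c * γ i d c * M d l * p l := Finset.sum_comm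
      _ = _ := Finset.sum_congr rfl fun d _ => Finset.sum_congr rfl fun i _ =>
          Finset.sum_congr rfl fun c _ => by rw [hγ i d c]; ring
  have h3 : ∑ i, ∑ l, (∑ c, ∑ d, M i c * γ i c d * M d l) * p l =
      ∑ i, ∑ j, ∑ k, ∑ l, M i j * M k l * γ i j k * p l := by
    refine Finset.sum_congr rfl fun i _ => ?_
    simp only [Finset.sum_mul]
    calc ∑ l, ∑ c, ∑ d, M i c * γ i c d * M d l * p l
        = ∑ c, ∑ l, ∑ d, M i c * γ i c d * M d l * p l := Finset.sum_comm
      _ = ∑ c, ∑ d, ∑ l, M i c * γ i c d * M d l * p l :=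
          Finset.sum_congr rfl fun c _ => Finset.sum_comm
      _ = _ := Finset.sum_congr rfl fun c _ => Finset.sum_congr rfl fun d _ =>
          Finset.sum_congr rfl fun l _ => by ring
  simp only [h1]
  simp only [mul_add, add_mul, Finset.sum_add_distrib, Finset.sum_sub_distrib]
  rw [h2, h3]; ring

/-- The Laplace–Beltrami operator of the gradient graph applied to a function with differential
`p`, in terms of the Christoffel symbols of the first kind. -/
def lapOf (f u : EuclideanSpace ℝ (Fin n) → ℝ) (p : Fin n → EuclideanSpace ℝ (Fin n) → ℝ)
    (x : EuclideanSpace ℝ (Fin n)) : ℝ :=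
  ∑ i, ∑ l, (graphMetric f u x)⁻¹ i l * pderiv i (p l) x -
    ∑ i, ∑ j, ∑ k, ∑ l, (graphMetric f u x)⁻¹ i j * (graphMetric f u x)⁻¹ k l *
      christoffelFirst f u x i j k * p l x

lemma posDef_graphMetric (hf1 : 1 ≤ f x) : (graphMetric f u x).PosDef :=
  posDef_smul_one_add_mul_transpose hf1

lemma contDiffOn_inv_graphMetric (hΩ : IsOpen Ω) (hu : ContDiffOn ℝ 3 u Ω)
    (hf : ContDiffOn ℝ 1 f Ω) (hf1 : ∀ x ∈ Ω, 1 ≤ f x) (j k : Fin n) :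
    ContDiffOn ℝ 1 (fun y => (graphMetric f u y)⁻¹ j k) Ω :=
  contDiffOn_inv_apply (contDiffOn_graphMetric hΩ hu hf)
    (fun y hy => (posDef_graphMetric (hf1 y hy)).det_pos.ne') j k

lemma contDiffOn_sqrt_det (hΩ : IsOpen Ω) (hu : ContDiffOn ℝ 3 u Ω)
    (hf : ContDiffOn ℝ 1 f Ω) (hf1 : ∀ x ∈ Ω, 1 ≤ f x) :
    ContDiffOn ℝ 1 (fun y => √(graphMetric f u y).det) Ω :=
  (contDiffOn_det (contDiffOn_graphMetric hΩ hu hf)).sqrt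
    fun y hy => (posDef_graphMetric (hf1 y hy)).det_pos.ne'

lemma inv_graphMetric_symm (hf1 : 1 ≤ f x) (i j : Fin n) :
    (graphMetric f u x)⁻¹ i j = (graphMetric f u x)⁻¹ j i := by
  have := (posDef_graphMetric (u := u) hf1).inv.isHermitian.apply j i
  simpa using this

/-- The divergence form `∑ᵢ ∂ᵢ (√g ∑ₗ g^{il} pₗ) = √g Δ_g` of the Laplace–Beltrami operator. -/
lemma sum_pderiv_flux (hΩ : IsOpen Ω) (hu : ContDiffOn ℝ 3 u Ω) (hf : ContDiffOn ℝ 1 f Ω)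
    (hf1 : ∀ x ∈ Ω, 1 ≤ f x) {p : Fin n → EuclideanSpace ℝ (Fin n) → ℝ}
    (hp : ∀ l, DifferentiableAt ℝ (p l) x) (hx : x ∈ Ω) :
    ∑ i, pderiv i (fun y => √(graphMetric f u y).det *
      ∑ l, (graphMetric f u y)⁻¹ i l * p l y) x = √(graphMetric f u x).det * lapOf f u p x := by
  have hdet : ∀ y ∈ Ω, 0 < (graphMetric f u y).det := fun y hy =>
    (posDef_graphMetric (hf1 y hy)).det_pos
  have hdd : DifferentiableAt ℝ (fun y => (graphMetric f u y).det) x :=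
    (contDiffOn_det (contDiffOn_graphMetric hΩ hu hf)).differentiableAt_of_isOpen hΩ hx
  have hw : DifferentiableAt ℝ (fun y => √(graphMetric f u y).det) x :=
    (contDiffOn_sqrt_det hΩ hu hf hf1).differentiableAt_of_isOpen hΩ hx
  have hi : ∀ j k, DifferentiableAt ℝ (fun y => (graphMetric f u y)⁻¹ j k) x := fun j k =>
    (contDiffOn_inv_graphMetric hΩ hu hf hf1 j k).differentiableAt_of_isOpen hΩ hx
  set M : Fin n → Fin n → ℝ := fun i j => (graphMetric f u x)⁻¹ i j with hM
  set w := √(graphMetric f u x).det with hwdef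
  have hwpos : 0 < w := Real.sqrt_pos.2 (hdet x hx)
  have hww : (graphMetric f u x).det = w * w := (Real.mul_self_sqrt (hdet x hx).le).symm
  have hdw : ∀ i, pderiv i (fun y => √(graphMetric f u y).det) x =
      w * ((∑ a, ∑ b, M a b * (christoffelFirst f u x i b a + christoffelFirst f u x i a b)) / 2) := by
    intro i
    rw [pderiv_comp (Real.hasDerivAt_sqrt (hdet x hx).ne') hdd,
      pderiv_det hΩ (contDiffOn_graphMetric hΩ hu hf) hx (hdet x hx).ne', ← hwdef, hww]
    simp_rw [pderiv_graphMetric hΩ hu hf hx]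
    field_simp
    rfl
  have hdi : ∀ i a b, pderiv i (fun y => (graphMetric f u y)⁻¹ a b) x =
      -∑ c, ∑ d, M a c * (christoffelFirst f u x i c d + christoffelFirst f u x i d c) * M d b := by
    intro i a b
    rw [pderiv_inv_apply hΩ (contDiffOn_graphMetric hΩ hu hf) (fun y hy => (hdet y hy).ne') hx]
    simp_rw [pderiv_graphMetric hΩ hu hf hx]
    rfl
  have hterm : ∀ i, pderiv i (fun y => √(graphMetric f u y).det *
      ∑ l, (graphMetric f u y)⁻¹ i l * p l y) x =
      w * ∑ l, M i l * pderiv i (p l) x + w * ∑ l,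
        ((∑ a, ∑ b, M a b * (christoffelFirst f u x i b a + christoffelFirst f u x i a b)) / 2 *
          (M i l * p l x) -
        (∑ c, ∑ d, M i c * (christoffelFirst f u x i c d + christoffelFirst f u x i d c) * M d l) *
          p l x) := by
    intro i
    have hsum : DifferentiableAt ℝ (fun y => ∑ l, (graphMetric f u y)⁻¹ i l * p l y) x :=
      DifferentiableAt.fun_sum fun l _ => (hi i l).mul (hp l)
    rw [pderiv_mul hw hsum,
      pderiv_sum (a := fun l y => (graphMetric f u y)⁻¹ i l * p l y)
        fun l _ => (hi i l).mul (hp l)]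
    simp_rw [fun l => pderiv_mul (i := i) (hi i l) (hp l), hdi, hdw]
    simp only [Finset.sum_add_distrib, Finset.sum_sub_distrib, neg_mul, Finset.sum_neg_distrib,
      ← Finset.mul_sum]
    simp only [hM]
    ring
  simp_rw [hterm]
  rw [Finset.sum_add_distrib, ← Finset.mul_sum, ← Finset.mul_sum,
    sum_christoffel_contraction (fun i j => inv_graphMetric_symm (hf1 x hx) i j)
      (christoffelFirst_symm hΩ hu hx), lapOf, ← mul_add, ← sub_eq_add_neg]

end Pointwise

end Geometry

/-! ### The distance function of the ambient metric frozen at a point -/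

section DistanceFunction

variable {n : ℕ}

/-- Half the squared distance `f₀² |x - x₀|² + |Du(x) - Du(x₀)|²` between two points of the gradient
graph, in the flat metric `f₀² dx² + dy²`. With `f₀ = f x₀` this is the ambient metric frozen at
the point `x₀`. -/
def halfSq (f₀ : ℝ) (u : EuclideanSpace ℝ (Fin n) → ℝ) (x₀ x : EuclideanSpace ℝ (Fin n)) : ℝ :=
  (f₀ ^ 2 * ∑ a, (x a - x₀ a) ^ 2 + ∑ a, (pderiv a u x - pderiv a u x₀) ^ 2) / 2

/-- The distance in the flat metric `f₀² dx² + dy²`. -/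
def flatDist (f₀ : ℝ) (u : EuclideanSpace ℝ (Fin n) → ℝ) (x₀ x : EuclideanSpace ℝ (Fin n)) : ℝ :=
  √(2 * halfSq f₀ u x₀ x)

/-- The partial derivatives of `halfSq f₀ u x₀`. -/
def dHalfSq (f₀ : ℝ) (u : EuclideanSpace ℝ (Fin n) → ℝ) (x₀ : EuclideanSpace ℝ (Fin n))
    (j : Fin n) (x : EuclideanSpace ℝ (Fin n)) : ℝ :=
  f₀ ^ 2 * (x j - x₀ j) + ∑ a, hess u x j a * (pderiv a u x - pderiv a u x₀)

lemma halfSq_nonneg (f₀ : ℝ) (u : EuclideanSpace ℝ (Fin n) → ℝ)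
    (x₀ x : EuclideanSpace ℝ (Fin n)) : 0 ≤ halfSq f₀ u x₀ x := by
  unfold halfSq; positivity

lemma flatDist_nonneg (f₀ : ℝ) (u : EuclideanSpace ℝ (Fin n) → ℝ)
    (x₀ x : EuclideanSpace ℝ (Fin n)) : 0 ≤ flatDist f₀ u x₀ x := Real.sqrt_nonneg _

lemma flatDist_sq (f₀ : ℝ) (u : EuclideanSpace ℝ (Fin n) → ℝ)
    (x₀ x : EuclideanSpace ℝ (Fin n)) : flatDist f₀ u x₀ x ^ 2 =
      f₀ ^ 2 * ∑ a, (x a - x₀ a) ^ 2 + ∑ a, (pderiv a u x - pderiv a u x₀) ^ 2 := by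
  rw [flatDist, Real.sq_sqrt (by have := halfSq_nonneg f₀ u x₀ x; positivity), halfSq]
  ring

lemma norm_sub_le_flatDist {f₀ : ℝ} (hf₀ : 1 ≤ f₀) (u : EuclideanSpace ℝ (Fin n) → ℝ)
    (x₀ x : EuclideanSpace ℝ (Fin n)) : ‖x - x₀‖ ≤ flatDist f₀ u x₀ x := by
  refine le_of_sq_le_sq ?_ (flatDist_nonneg _ _ _ _)
  rw [flatDist_sq, EuclideanSpace.real_norm_sq_eq]
  have h1 : 0 ≤ ∑ a, (pderiv a u x - pderiv a u x₀) ^ 2 := by positivity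
  have h2 : 0 ≤ ∑ a, (x a - x₀ a) ^ 2 := by positivity
  have h3 : ∑ a, (x a - x₀ a) ^ 2 ≤ f₀ ^ 2 * ∑ a, (x a - x₀ a) ^ 2 :=
    le_mul_of_one_le_left h2 (one_le_pow₀ hf₀)
  simp only [PiLp.sub_apply]
  linarith

variable {Ω : Set (EuclideanSpace ℝ (Fin n))} {u f : EuclideanSpace ℝ (Fin n) → ℝ} {f₀ : ℝ}
  {x₀ x : EuclideanSpace ℝ (Fin n)}

lemma contDiffOn_coord_sub (j : Fin n) {m : WithTop ℕ∞} :
    ContDiffOn ℝ m (fun y : EuclideanSpace ℝ (Fin n) => y j - x₀ j) Ω :=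
  ((EuclideanSpace.proj j : EuclideanSpace ℝ (Fin n) →L[ℝ] ℝ).contDiff.contDiffOn).sub
    contDiffOn_const

lemma contDiffOn_halfSq (hΩ : IsOpen Ω) (hu : ContDiffOn ℝ 3 u Ω) :
    ContDiffOn ℝ 2 (halfSq f₀ u x₀) Ω := by
  refine ContDiffOn.div_const (ContDiffOn.add (contDiffOn_const.mul ?_) ?_) 2
  · exact ContDiffOn.sum fun a _ => (contDiffOn_coord_sub a).pow 2
  · exact ContDiffOn.sum fun a _ =>
      ((contDiffOn_pderiv hΩ hu (by norm_num)).sub contDiffOn_const).pow 2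

lemma contDiffOn_dHalfSq (hΩ : IsOpen Ω) (hu : ContDiffOn ℝ 3 u Ω) (j : Fin n) :
    ContDiffOn ℝ 1 (dHalfSq f₀ u x₀ j) Ω := by
  refine ContDiffOn.add (contDiffOn_const.mul (contDiffOn_coord_sub j)) ?_
  exact ContDiffOn.sum fun a _ => (contDiffOn_hess hΩ hu j a).mul
    ((contDiffOn_pderiv hΩ hu (by norm_num)).sub contDiffOn_const)

lemma pderiv_coord_sub (i j : Fin n) :
    pderiv i (fun y : EuclideanSpace ℝ (Fin n) => y j - x₀ j) x = if j = i then 1 else 0 := by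
  rw [pderiv_sub_const (fun y : EuclideanSpace ℝ (Fin n) => y j), pderiv_coord]

lemma pderiv_halfSq (hΩ : IsOpen Ω) (hu : ContDiffOn ℝ 3 u Ω) (hx : x ∈ Ω) (j : Fin n) :
    pderiv j (halfSq f₀ u x₀) x = dHalfSq f₀ u x₀ j x := by
  have hA : ∀ a, DifferentiableAt ℝ (fun y : EuclideanSpace ℝ (Fin n) => y a - x₀ a) x := fun a =>
    (contDiffOn_coord_sub a).differentiableAt_of_isOpen hΩ hx
  have hB : ∀ a, DifferentiableAt ℝ (fun y => pderiv a u y - pderiv a u x₀) x := fun a =>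
    ((contDiffOn_pderiv (m := 1) hΩ hu (by norm_num)).sub
      contDiffOn_const).differentiableAt_of_isOpen hΩ hx
  have hA' : DifferentiableAt ℝ (fun y : EuclideanSpace ℝ (Fin n) =>
      ∑ a, (y a - x₀ a) * (y a - x₀ a)) x := DifferentiableAt.fun_sum fun a _ => (hA a).mul (hA a)
  have hB' : DifferentiableAt ℝ (fun y => ∑ a, (pderiv a u y - pderiv a u x₀) *
      (pderiv a u y - pderiv a u x₀)) x := DifferentiableAt.fun_sum fun a _ => (hB a).mul (hB a)
  have e : halfSq f₀ u x₀ = fun y => (f₀ ^ 2 / 2) * ∑ a, (y a - x₀ a) * (y a - x₀ a) +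
      (1 / 2) * ∑ a, (pderiv a u y - pderiv a u x₀) * (pderiv a u y - pderiv a u x₀) := by
    funext y
    simp only [halfSq, sq]
    ring
  rw [e, pderiv_add (hA'.const_mul _) (hB'.const_mul _), pderiv_const_mul hA', pderiv_const_mul hB',
    pderiv_sum (a := fun a (y : EuclideanSpace ℝ (Fin n)) => (y a - x₀ a) * (y a - x₀ a))
      fun a _ => (hA a).mul (hA a),
    pderiv_sum (a := fun a y => (pderiv a u y - pderiv a u x₀) * (pderiv a u y - pderiv a u x₀))
      fun a _ => (hB a).mul (hB a)]
  simp_rw [fun a => pderiv_mul (i := j) (hA a) (hA a), fun a => pderiv_mul (i := j) (hB a) (hB a),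
    pderiv_coord_sub, fun a => pderiv_sub_const (i := j) (x := x) (fun y => pderiv a u y)
      (pderiv a u x₀)]
  have e2 : ∀ a, pderiv j (fun y => pderiv a u y) x = hess u x j a := fun a => rfl
  simp only [e2, dHalfSq, mul_ite, ite_mul, mul_one, mul_zero, one_mul, zero_mul,
    Finset.sum_add_distrib, Finset.sum_ite_eq', Finset.mem_univ, if_true]
  have e3 : ∑ a, (pderiv a u x - pderiv a u x₀) * hess u x j a =
      ∑ a, hess u x j a * (pderiv a u x - pderiv a u x₀) :=
    Finset.sum_congr rfl fun a _ => mul_comm _ _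
  rw [e3]
  ring

lemma pderiv_dHalfSq (hΩ : IsOpen Ω) (hu : ContDiffOn ℝ 3 u Ω) (hx : x ∈ Ω) (i j : Fin n) :
    pderiv i (dHalfSq f₀ u x₀ j) x = f₀ ^ 2 * (if i = j then 1 else 0) +
      ∑ a, hess u x i a * hess u x j a +
      ∑ a, thirdDeriv u x i j a * (pderiv a u x - pderiv a u x₀) := by
  have hA : DifferentiableAt ℝ (fun y : EuclideanSpace ℝ (Fin n) => y j - x₀ j) x :=
    (contDiffOn_coord_sub j).differentiableAt_of_isOpen hΩ hx
  have hB : ∀ a, DifferentiableAt ℝ (fun y => pderiv a u y - pderiv a u x₀) x := fun a =>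
    ((contDiffOn_pderiv (m := 1) hΩ hu (by norm_num)).sub
      contDiffOn_const).differentiableAt_of_isOpen hΩ hx
  have hh : ∀ a, DifferentiableAt ℝ (fun y => hess u y j a) x := fun a =>
    (contDiffOn_hess hΩ hu j a).differentiableAt_of_isOpen hΩ hx
  have hsum : DifferentiableAt ℝ (fun y => ∑ a, hess u y j a * (pderiv a u y - pderiv a u x₀)) x :=
    DifferentiableAt.fun_sum fun a _ => (hh a).mul (hB a)
  have e : dHalfSq f₀ u x₀ j = fun y => f₀ ^ 2 * (y j - x₀ j) +
    ∑ a, hess u y j a * (pderiv a u y - pderiv a u x₀) := rfl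
  rw [e, pderiv_add (hA.const_mul _) hsum, pderiv_const_mul hA, pderiv_coord_sub,
    pderiv_sum (a := fun a y => hess u y j a * (pderiv a u y - pderiv a u x₀))
      fun a _ => (hh a).mul (hB a)]
  simp_rw [fun a => pderiv_mul (i := i) (hh a) (hB a),
    fun a => pderiv_sub_const (i := i) (x := x) (fun y => pderiv a u y) (pderiv a u x₀)]
  have e2 : ∀ a, pderiv i (fun y => pderiv a u y) x = hess u x i a := fun a => rfl
  simp only [e2, Finset.sum_add_distrib, thirdDeriv]
  have e3 : ∑ a, hess u x j a * hess u x i a = ∑ a, hess u x i a * hess u x j a :=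
    Finset.sum_congr rfl fun a _ => mul_comm _ _
  have e4 : (if j = i then (1 : ℝ) else 0) = if i = j then 1 else 0 := by simp only [eq_comm]
  rw [e3, e4]
  ring

/-- The differential at the point `(x, Du(x))` of half the squared distance in the flat metric
`f₀² dx² + dy²`, as an ambient covector. -/
def ambientCovector (f₀ : ℝ) (u : EuclideanSpace ℝ (Fin n) → ℝ) (x₀ x : EuclideanSpace ℝ (Fin n)) :
    Fin n ⊕ Fin n → ℝ :=
  Sum.elim (fun a => f₀ ^ 2 * (x a - x₀ a)) (fun a => pderiv a u x - pderiv a u x₀)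

lemma sum_ambientCovector_mul_tangentVec (l : Fin n) :
    ∑ c, ambientCovector f₀ u x₀ x c * tangentVec (gradGraph u) x l c = dHalfSq f₀ u x₀ l x := by
  simp only [Fintype.sum_sum_type, ambientCovector, Sum.elim_inl, Sum.elim_inr, tangentVec_inl,
    tangentVec_inr, mul_ite, mul_one, mul_zero, Finset.sum_ite_eq', Finset.mem_univ, if_true,
    dHalfSq]
  congr 1
  exact Finset.sum_congr rfl fun a _ => mul_comm _ _

/-- The pairing of an ambient covector `ω` with the mean curvature vector: the trace of the full
ambient covariant derivative minus its tangential part. -/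
lemma sum_mul_meanCurvature (ω : Fin n ⊕ Fin n → ℝ) (hf : DifferentiableAt ℝ f x)
    (hf0 : f x ≠ 0) :
    ∑ c, ω c * meanCurvature (weightedMetric f) (gradGraph u) x c =
      ∑ i, ∑ j, (graphMetric f u x)⁻¹ i j *
        ∑ c, ω c * covDeriv (weightedMetric f) (gradGraph u) x i j c -
      ∑ i, ∑ j, ∑ k, ∑ l, (graphMetric f u x)⁻¹ i j * (graphMetric f u x)⁻¹ k l *
        christoffelFirst f u x i j k * ∑ c, ω c * tangentVec (gradGraph u) x l c := by
  have e : ∀ i j, ∑ c, ω c * normalPart (weightedMetric f) (gradGraph u) x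
      (covDeriv (weightedMetric f) (gradGraph u) x i j) c =
      ∑ c, ω c * covDeriv (weightedMetric f) (gradGraph u) x i j c -
        ∑ k, ∑ l, (graphMetric f u x)⁻¹ k l * christoffelFirst f u x i j k *
          ∑ c, ω c * tangentVec (gradGraph u) x l c := by
    intro i j
    simp only [normalPart, inducedMetric_eq, ambientInner_covDeriv hf hf0, Pi.sub_apply,
      Finset.sum_apply, Pi.smul_apply, smul_eq_mul, mul_sub, Finset.sum_sub_distrib]
    congr 1
    simp only [Finset.mul_sum]
    rw [Finset.sum_comm]
    refine Finset.sum_congr rfl fun k _ => ?_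
    rw [Finset.sum_comm]
    exact Finset.sum_congr rfl fun l _ => Finset.sum_congr rfl fun c _ => by ring
  simp only [meanCurvature, inducedMetric_eq, Finset.sum_apply, Pi.smul_apply, smul_eq_mul]
  have e1 : ∑ c, ω c * ∑ i, ∑ j, (graphMetric f u x)⁻¹ i j *
      normalPart (weightedMetric f) (gradGraph u) x
        (covDeriv (weightedMetric f) (gradGraph u) x i j) c =
      ∑ i, ∑ j, (graphMetric f u x)⁻¹ i j * ∑ c, ω c *
        normalPart (weightedMetric f) (gradGraph u) x
        (covDeriv (weightedMetric f) (gradGraph u) x i j) c := by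
    simp only [Finset.mul_sum]
    rw [Finset.sum_comm]
    refine Finset.sum_congr rfl fun i _ => ?_
    rw [Finset.sum_comm]
    exact Finset.sum_congr rfl fun j _ => Finset.sum_congr rfl fun c _ => by ring
  rw [e1]
  simp only [e, mul_sub, Finset.sum_sub_distrib]
  congr 1
  simp only [Finset.mul_sum, mul_assoc]

/-- The Laplacian of half the squared distance. The first term is the dimension, as in flat space;
the others are the deviation of `f` from `f₀`, the mean curvature and the Christoffel symbols of
the ambient metric. -/
lemma lapOf_dHalfSq (hΩ : IsOpen Ω) (hu : ContDiffOn ℝ 3 u Ω) (hf : ContDiffOn ℝ 1 f Ω)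
    (hf1 : ∀ x ∈ Ω, 1 ≤ f x) (hx : x ∈ Ω) :
    lapOf f u (dHalfSq f₀ u x₀) x = n + (f₀ ^ 2 - f x ^ 2) * ((graphMetric f u x)⁻¹).trace +
      ∑ c, ambientCovector f₀ u x₀ x c * meanCurvature (weightedMetric f) (gradGraph u) x c -
      f₀ ^ 2 * (f x)⁻¹ * (2 * ∑ i, ∑ j, (graphMetric f u x)⁻¹ i j *
        ((x j - x₀ j) * pderiv i f x) -
        ((graphMetric f u x)⁻¹).trace * ∑ c, (x c - x₀ c) * pderiv c f x) := by
  have hf0 : f x ≠ 0 := by have := hf1 x hx; positivity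
  have hfd := hf.differentiableAt_of_isOpen hΩ hx
  have hsymm := fun i j => inv_graphMetric_symm (u := u) (hf1 x hx) i j
  have hinv := nonsing_inv_mul (graphMetric f u x)
    (isUnit_iff_ne_zero.2 (posDef_graphMetric (u := u) (hf1 x hx)).det_pos.ne')
  rw [sum_mul_meanCurvature _ hfd hf0]
  simp only [sum_ambientCovector_mul_tangentVec]
  rw [lapOf]
  set M := (graphMetric f u x)⁻¹ with hM
  have hn : ∑ i, ∑ j, M i j * graphMetric f u x i j = n := by
    calc ∑ i, ∑ j, M i j * graphMetric f u x i j = (M * graphMetric f u x).trace := by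
          simp only [trace, diag_apply, mul_apply]
          refine Finset.sum_congr rfl fun i _ => Finset.sum_congr rfl fun j _ => ?_
          rw [graphMetric_apply, graphMetric_apply]
          simp only [eq_comm, mul_comm]
      _ = n := by rw [hinv]; simp
  have hcov : ∀ i j, ∑ c, ambientCovector f₀ u x₀ x c *
      covDeriv (weightedMetric f) (gradGraph u) x i j c =
      f₀ ^ 2 * (f x)⁻¹ * ((x j - x₀ j) * pderiv i f x + (x i - x₀ i) * pderiv j f x -
        (if i = j then ∑ c, (x c - x₀ c) * pderiv c f x else 0)) +
      ∑ a, thirdDeriv u x i j a * (pderiv a u x - pderiv a u x₀) := by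
    intro i j
    simp only [Fintype.sum_sum_type, ambientCovector, Sum.elim_inl, Sum.elim_inr,
      covDeriv_inl hfd hf0, covDeriv_inr hfd hf0]
    congr 1
    · have : ∀ c, f₀ ^ 2 * (x c - x₀ c) * ((f x)⁻¹ * ((if j = c then pderiv i f x else 0) +
          (if i = c then pderiv j f x else 0) - (if i = j then pderiv c f x else 0))) =
          f₀ ^ 2 * (f x)⁻¹ * ((if j = c then (x c - x₀ c) * pderiv i f x else 0) +
          (if i = c then (x c - x₀ c) * pderiv j f x else 0) -
          (if i = j then (x c - x₀ c) * pderiv c f x else 0)) := by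
        intro c
        split_ifs <;> ring
      simp only [this]
      rw [← Finset.mul_sum, Finset.sum_sub_distrib, Finset.sum_add_distrib]
      simp only [Finset.sum_ite_eq, Finset.mem_univ, if_true]
      congr 2
      split_ifs <;> simp
    · exact Finset.sum_congr rfl fun a _ => mul_comm _ _
  have hpd : ∀ i j, pderiv i (dHalfSq f₀ u x₀ j) x = graphMetric f u x i j +
      (f₀ ^ 2 - f x ^ 2) * (if i = j then 1 else 0) +
      ∑ a, thirdDeriv u x i j a * (pderiv a u x - pderiv a u x₀) := by
    intro i j
    rw [pderiv_dHalfSq hΩ hu hx, graphMetric_apply]; ring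
  have htr : ∑ i, ∑ j, M i j * ((f₀ ^ 2 - f x ^ 2) * (if i = j then 1 else 0)) =
      (f₀ ^ 2 - f x ^ 2) * M.trace := by
    simp [trace, Finset.mul_sum, mul_comm]
  have htr2 : ∀ s : ℝ, ∑ i, ∑ j, M i j * (if i = j then s else 0) = M.trace * s := by
    intro s
    simp [trace, Finset.sum_mul]
  have hsw : ∑ i, ∑ j, M i j * ((x i - x₀ i) * pderiv j f x) =
      ∑ i, ∑ j, M i j * ((x j - x₀ j) * pderiv i f x) := by
    rw [Finset.sum_comm]
    exact Finset.sum_congr rfl fun i _ => Finset.sum_congr rfl fun j _ => by rw [hsymm]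
  have hc : ∑ i, ∑ j, M i j * (f₀ ^ 2 * (f x)⁻¹ * ((x j - x₀ j) * pderiv i f x +
      (x i - x₀ i) * pderiv j f x - (if i = j then ∑ c, (x c - x₀ c) * pderiv c f x else 0))) =
      f₀ ^ 2 * (f x)⁻¹ * (2 * ∑ i, ∑ j, M i j * ((x j - x₀ j) * pderiv i f x) -
        M.trace * ∑ c, (x c - x₀ c) * pderiv c f x) := by
    have : ∀ i j, M i j * (f₀ ^ 2 * (f x)⁻¹ * ((x j - x₀ j) * pderiv i f x +
      (x i - x₀ i) * pderiv j f x - (if i = j then ∑ c, (x c - x₀ c) * pderiv c f x else 0))) =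
      f₀ ^ 2 * (f x)⁻¹ * (M i j * ((x j - x₀ j) * pderiv i f x) +
        M i j * ((x i - x₀ i) * pderiv j f x) -
        M i j * (if i = j then ∑ c, (x c - x₀ c) * pderiv c f x else 0)) := fun i j => by ring
    simp only [this]
    simp only [← Finset.mul_sum, Finset.sum_sub_distrib, Finset.sum_add_distrib]
    rw [htr2, hsw]; ring
  simp only [hpd, hcov, mul_add, Finset.sum_add_distrib]
  rw [hn, htr]
  rw [hc]
  ring

/-- The largest eigenvalue of the inverse metric is at most its trace. -/
lemma dotProduct_inv_graphMetric_mulVec_le (hf1 : 1 ≤ f x) (a b : Fin n → ℝ) :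
    |a ⬝ᵥ ((graphMetric f u x)⁻¹ *ᵥ b)| ≤
      (graphMetric f u x)⁻¹.trace * (√(a ⬝ᵥ a) * √(b ⬝ᵥ b)) := by
  have hg := posDef_graphMetric (u := u) hf1
  have nn : ∀ a : Fin n → ℝ, 0 ≤ a ⬝ᵥ a := fun a => by
    simpa using dotProduct_star_self_nonneg a
  have hT := trace_inv_nonneg hg
  have hdiag : ∀ v : Fin n → ℝ, v ⬝ᵥ ((graphMetric f u x)⁻¹ *ᵥ v) ≤
      (graphMetric f u x)⁻¹.trace * (v ⬝ᵥ v) := by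
    intro v
    set ξ := (graphMetric f u x)⁻¹ *ᵥ v with hξ
    have h1 := dotProduct_self_le_trace_inv_mul hg ξ
    rw [hξ, mulVec_inv_mulVec hg, ← hξ, dotProduct_comm ξ v] at h1
    have h2 := dotProduct_sq_le v ξ
    have h0 : 0 ≤ v ⬝ᵥ ξ := dotProduct_mulVec_self_nonneg hg.inv.posSemidef v
    rcases h0.eq_or_lt with h | h
    · rw [← h]; have := nn v; positivity
    · refine le_of_mul_le_mul_right ?_ h
      have := mul_le_mul_of_nonneg_left h1 (nn v)
      nlinarith
  have h := dotProduct_mulVec_sq_le hg.inv.posSemidef a b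
  refine abs_le_of_sq_le_sq ?_ (by positivity)
  calc _ ≤ _ := h
    _ ≤ ((graphMetric f u x)⁻¹.trace * (a ⬝ᵥ a)) * ((graphMetric f u x)⁻¹.trace * (b ⬝ᵥ b)) :=
        mul_le_mul (hdiag a) (hdiag b) (dotProduct_mulVec_self_nonneg hg.inv.posSemidef b)
          (by have := nn a; positivity)
    _ = _ := by
        rw [mul_pow, mul_pow, Real.sq_sqrt (nn a), Real.sq_sqrt (nn b)]; ring

lemma sum_pderiv_sq_le {k : ℝ} (hk : ‖fderiv ℝ f x‖ ≤ k) :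
    √(∑ i, pderiv i f x * pderiv i f x) ≤ k := by
  set s := ∑ i, pderiv i f x * pderiv i f x with hs
  have hs0 : 0 ≤ s := Finset.sum_nonneg fun i _ => mul_self_nonneg _
  set v : EuclideanSpace ℝ (Fin n) := WithLp.toLp 2 fun i => pderiv i f x with hv
  have hv2 : ‖v‖ = √s := by
    rw [EuclideanSpace.norm_eq]; congr 1
    refine Finset.sum_congr rfl fun i _ => ?_
    simp [hv, sq]
  have h1 : fderiv ℝ f x v = s := by
    have : v = ∑ i, pderiv i f x • EuclideanSpace.single i (1 : ℝ) := by
      ext c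
      simp [hv, Pi.single_apply]
    rw [this, map_sum]
    simp [hs, pderiv]
  have h2 := (fderiv ℝ f x).le_opNorm v
  rw [h1, hv2, Real.norm_of_nonneg hs0] at h2
  rcases (Real.sqrt_nonneg s).eq_or_lt with h | h
  · rw [← h]; exact (norm_nonneg _).trans hk
  · refine le_of_mul_le_mul_right ?_ h
    calc √s * √s = s := Real.mul_self_sqrt hs0
      _ ≤ _ := h2
      _ ≤ k * √s := by gcongr

/-- The pairing of the differential of half the squared distance with the mean curvature. -/
lemma abs_sum_mul_meanCurvature_le {k : ℝ} (hf1 : 1 ≤ f x) (hk : 1 ≤ k) (hf₀ : 0 ≤ f₀)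
    (hfk : f₀ ≤ k) :
    |∑ c, ambientCovector f₀ u x₀ x c * meanCurvature (weightedMetric f) (gradGraph u) x c| ≤
      k * flatDist f₀ u x₀ x * meanCurvatureNorm (weightedMetric f) (gradGraph u) x := by
  set H := meanCurvature (weightedMetric f) (gradGraph u) x with hH
  have hf0 : f x ≠ 0 := by positivity
  have hHn : meanCurvatureNorm (weightedMetric f) (gradGraph u) x ^ 2 =
      f x ^ 2 * ∑ a, H (Sum.inl a) * H (Sum.inl a) + ∑ a, H (Sum.inr a) * H (Sum.inr a) := by
    rw [meanCurvatureNorm, ← hH, ambientInner_weightedMetric, Real.sq_sqrt]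
    have h1 : 0 ≤ ∑ a, H (Sum.inl a) * H (Sum.inl a) :=
      Finset.sum_nonneg fun a _ => mul_self_nonneg _
    have h2 : 0 ≤ ∑ a, H (Sum.inr a) * H (Sum.inr a) :=
      Finset.sum_nonneg fun a _ => mul_self_nonneg _
    positivity
  have hr := flatDist_nonneg f₀ u x₀ x
  have hHn0 : 0 ≤ meanCurvatureNorm (weightedMetric f) (gradGraph u) x := Real.sqrt_nonneg _
  refine abs_le_of_sq_le_sq ?_ (by positivity)
  have hCS := Finset.sum_mul_sq_le_sq_mul_sq Finset.univ
    (Sum.elim (fun a => f₀ ^ 2 * (x a - x₀ a) / f x) (fun a => pderiv a u x - pderiv a u x₀))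
    (Sum.elim (fun a => f x * H (Sum.inl a)) (fun a => H (Sum.inr a)))
  simp only [Fintype.sum_sum_type, Sum.elim_inl, Sum.elim_inr] at hCS
  have e1 : ∑ c, ambientCovector f₀ u x₀ x c * H c =
      ∑ a, f₀ ^ 2 * (x a - x₀ a) / f x * (f x * H (Sum.inl a)) +
        ∑ a, (pderiv a u x - pderiv a u x₀) * H (Sum.inr a) := by
    simp only [Fintype.sum_sum_type, ambientCovector, Sum.elim_inl, Sum.elim_inr]
    congr 1
    exact Finset.sum_congr rfl fun a _ => by field_simp
  have e2 : ∑ a, (f x * H (Sum.inl a)) ^ 2 + ∑ a, H (Sum.inr a) ^ 2 =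
      meanCurvatureNorm (weightedMetric f) (gradGraph u) x ^ 2 := by
    rw [hHn, Finset.mul_sum]
    congr 1 <;> exact Finset.sum_congr rfl fun a _ => by ring
  rw [e2] at hCS
  have e3 : ∑ a, (f₀ ^ 2 * (x a - x₀ a) / f x) ^ 2 + ∑ a, (pderiv a u x - pderiv a u x₀) ^ 2 ≤
      k ^ 2 * flatDist f₀ u x₀ x ^ 2 := by
    rw [flatDist_sq, mul_add, Finset.mul_sum, Finset.mul_sum]
    refine add_le_add (Finset.sum_le_sum fun a _ => ?_) ?_
    · rw [div_pow, div_le_iff₀ (by positivity)]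
      have h1 : f₀ ^ 2 ≤ k ^ 2 := by gcongr
      have h2 : k ^ 2 ≤ k ^ 2 * f x ^ 2 := le_mul_of_one_le_right (by positivity) (one_le_pow₀ hf1)
      calc (f₀ ^ 2 * (x a - x₀ a)) ^ 2 = f₀ ^ 2 * (f₀ ^ 2 * (x a - x₀ a) ^ 2) := by ring
        _ ≤ (k ^ 2 * f x ^ 2) * (f₀ ^ 2 * (x a - x₀ a) ^ 2) := by gcongr; exact h1.trans h2
        _ = _ := by ring
    · exact le_mul_of_one_le_left (by positivity) (one_le_pow₀ hk)
  rw [e1]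
  refine hCS.trans ?_
  rw [mul_pow, mul_pow]
  gcongr

/-- The comparison of the geometry of the gradient graph with the flat one, up to errors which are
controlled by the product of the distance with the trace of the inverse metric and with the mean
curvature. -/
theorem pointwise_estimates (hΩ : IsOpen Ω) (hu : ContDiffOn ℝ 3 u Ω) (hf : ContDiffOn ℝ 1 f Ω)
    (hf1 : ∀ x ∈ Ω, 1 ≤ f x) (hx : x ∈ Ω) (hx₀ : x₀ ∈ Ω) {k : ℝ} (hk : 1 ≤ k) (hk₀ : f x₀ ≤ k)
    (hkx : f x ≤ k) (hLip : |f x₀ - f x| ≤ k * ‖x - x₀‖) (hDf : ‖fderiv ℝ f x‖ ≤ k)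
    {r T H : ℝ} (hr : r = flatDist (f x₀) u x₀ x) (hT : T = ((graphMetric f u x)⁻¹).trace)
    (hH : H = meanCurvatureNorm (weightedMetric f) (gradGraph u) x) :
    (n - 5 * k ^ 3 * r * T - k * r * H ≤ lapOf f u (dHalfSq (f x₀) u x₀) x) ∧
    ((dHalfSq (f x₀) u x₀ · x) ⬝ᵥ ((graphMetric f u x)⁻¹ *ᵥ (dHalfSq (f x₀) u x₀ · x)) ≤
      r ^ 2 * (1 + 2 * k ^ 2 * r * T)) ∧
    ((dHalfSq (f x₀) u x₀ · x) ⬝ᵥ ((graphMetric f u x)⁻¹ *ᵥ (dHalfSq (f x₀) u x₀ · x)) ≤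
      k ^ 2 * r ^ 2) := by
  have h0 := hf1 x₀ hx₀
  have h1 := hf1 x hx
  have hT0 : 0 ≤ T := hT ▸ trace_inv_nonneg (posDef_graphMetric h1)
  have hvr : ‖x - x₀‖ ≤ r := hr ▸ norm_sub_le_flatDist h0 u x₀ x
  have hr0 : 0 ≤ r := (norm_nonneg _).trans hvr
  set v : Fin n → ℝ := fun a => x a - x₀ a with hv
  set y : Fin n → ℝ := fun a => pderiv a u x - pderiv a u x₀ with hy
  have hd : (dHalfSq (f x₀) u x₀ · x) = f x₀ ^ 2 • v + hess u x *ᵥ y := rfl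
  have hR : f x₀ ^ 2 * (v ⬝ᵥ v) + y ⬝ᵥ y = r ^ 2 := by
    rw [hr, flatDist_sq]
    simp only [dotProduct, hv, hy, sq]
  have hvn : √(v ⬝ᵥ v) = ‖x - x₀‖ := by
    rw [EuclideanSpace.norm_eq]
    congr 1
    refine Finset.sum_congr rfl fun a _ => ?_
    simp [hv, sq]
  have hff : |f x₀ ^ 2 - f x ^ 2| ≤ 2 * k ^ 2 * r := by
    rw [sq_sub_sq, abs_mul, abs_of_pos (by linarith : 0 < f x₀ + f x)]
    calc (f x₀ + f x) * |f x₀ - f x| ≤ (2 * k) * (k * r) := by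
          refine mul_le_mul (by linarith) (hLip.trans (by gcongr)) (abs_nonneg _) (by positivity)
      _ = _ := by ring
  have hquad := dotProduct_inv_mulVec_le h1 v y hd (g := graphMetric f u x) rfl
  rw [hR, ← hT] at hquad
  refine ⟨?_, hquad.1.trans (by gcongr), hquad.2 k hk hk₀ (by linarith)⟩
  rw [lapOf_dHalfSq hΩ hu hf hf1 hx, ← hT]
  have hHb := abs_sum_mul_meanCurvature_le (u := u) (x₀ := x₀) h1 hk (by linarith) hk₀
  rw [← hr, ← hH] at hHb
  have hdf : √((pderiv · f x) ⬝ᵥ (pderiv · f x)) ≤ k := sum_pderiv_sq_le hDf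
  have e1 : ∑ i, ∑ j, (graphMetric f u x)⁻¹ i j * ((x j - x₀ j) * pderiv i f x) =
      (pderiv · f x) ⬝ᵥ ((graphMetric f u x)⁻¹ *ᵥ v) := by
    simp only [dotProduct, mulVec, Finset.mul_sum, hv]
    exact Finset.sum_congr rfl fun i _ => Finset.sum_congr rfl fun j _ => by ring
  have b1 : |∑ i, ∑ j, (graphMetric f u x)⁻¹ i j * ((x j - x₀ j) * pderiv i f x)| ≤ T * (k * r) := by
    rw [e1, hT]
    refine (dotProduct_inv_graphMetric_mulVec_le h1 _ _).trans ?_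
    rw [← hT, hvn]
    gcongr
  have b2 : |∑ c, (x c - x₀ c) * pderiv c f x| ≤ k * r := by
    have h := dotProduct_sq_le v (pderiv · f x)
    have hvv : 0 ≤ v ⬝ᵥ v := by simpa using dotProduct_star_self_nonneg v
    have hpp : 0 ≤ (pderiv · f x) ⬝ᵥ (pderiv · f x) := by
      simpa using dotProduct_star_self_nonneg (pderiv · f x)
    have h' : |v ⬝ᵥ (pderiv · f x)| ≤ √(v ⬝ᵥ v) * √((pderiv · f x) ⬝ᵥ (pderiv · f x)) := by
      refine abs_le_of_sq_le_sq ?_ (by positivity)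
      rw [mul_pow, Real.sq_sqrt hvv, Real.sq_sqrt hpp]
      exact h
    refine h'.trans ?_
    rw [hvn, mul_comm]
    gcongr
  set S1 := ∑ i, ∑ j, (graphMetric f u x)⁻¹ i j * ((x j - x₀ j) * pderiv i f x) with hS1
  set S2 := ∑ c, (x c - x₀ c) * pderiv c f x with hS2
  have c1 : -(2 * k ^ 2 * r * T) ≤ (f x₀ ^ 2 - f x ^ 2) * T := by
    have := neg_le_of_abs_le hff
    nlinarith
  have c2 : f x₀ ^ 2 * (f x)⁻¹ * (2 * S1 - T * S2) ≤ 3 * k ^ 3 * r * T := by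
    have q1 : 2 * S1 - T * S2 ≤ 3 * (k * r * T) := by
      have a1 := le_of_abs_le b1
      have a2 := neg_le_of_abs_le b2
      nlinarith
    have q2 : f x₀ ^ 2 * (f x)⁻¹ ≤ k ^ 2 := by
      have a1 : f x₀ ^ 2 ≤ k ^ 2 := by gcongr
      have a2 : (f x)⁻¹ ≤ 1 := inv_le_one_of_one_le₀ h1
      have a3 : 0 ≤ (f x)⁻¹ := by positivity
      nlinarith
    have q3 : 0 ≤ f x₀ ^ 2 * (f x)⁻¹ := by positivity
    calc f x₀ ^ 2 * (f x)⁻¹ * (2 * S1 - T * S2) ≤ f x₀ ^ 2 * (f x)⁻¹ * (3 * (k * r * T)) := by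
          gcongr
      _ ≤ k ^ 2 * (3 * (k * r * T)) := by gcongr
      _ = _ := by ring
  have c3 := neg_le_of_abs_le hHb
  have c4 : 2 * k ^ 2 * r * T ≤ 2 * k ^ 3 * r * T := by
    have : k ^ 2 ≤ k ^ 3 := pow_le_pow_right₀ hk (by norm_num)
    gcongr
  linarith

end DistanceFunction

/-! ### Regularity of the geometric quantities -/

/-- The standing assumptions on the gradient graph of `u` over `Ω`, in the ambient metric with
weight `f`, where `f` has supremum and Lipschitz constant at most `k` on `U`. -/
structure IsAdmissible {n : ℕ} (k : ℝ) (Ω U : Set (EuclideanSpace ℝ (Fin n)))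
    (u f : EuclideanSpace ℝ (Fin n) → ℝ) : Prop where
  isOpen_domain : IsOpen Ω
  isOpen_subset : IsOpen U
  subset_domain : U ⊆ Ω
  contDiffOn_potential : ContDiffOn ℝ 3 u Ω
  contDiffOn_weight : ContDiffOn ℝ 1 f Ω
  one_le_weight : ∀ x ∈ Ω, 1 ≤ f x
  one_le_bound : 1 ≤ k
  weight_le : ∀ x ∈ U, f x ≤ k
  weight_lipschitz : ∀ x ∈ U, ∀ y ∈ U, |f x - f y| ≤ k * ‖x - y‖

/-- The energy density `|∇_g ψ| + ψ (|H| + √T)`. -/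
def energyDensity {n : ℕ} (f u ψ : EuclideanSpace ℝ (Fin n) → ℝ) (x : EuclideanSpace ℝ (Fin n)) :
    ℝ :=
  gradNorm (weightedMetric f) (gradGraph u) ψ x +
    ψ x * (meanCurvatureNorm (weightedMetric f) (gradGraph u) x +
      √(traceInv (weightedMetric f) (gradGraph u) x))

/-- The volume measure of the gradient graph. -/
abbrev graphVolume {n : ℕ} (f u : EuclideanSpace ℝ (Fin n) → ℝ)
    (Ω : Set (EuclideanSpace ℝ (Fin n))) : Measure (EuclideanSpace ℝ (Fin n)) :=
  volumeMeasure (weightedMetric f) (gradGraph u) Ω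

namespace IsAdmissible

variable {n : ℕ} {k : ℝ} {Ω U S : Set (EuclideanSpace ℝ (Fin n))}
  {u f ψ : EuclideanSpace ℝ (Fin n) → ℝ} {x₀ x : EuclideanSpace ℝ (Fin n)}

lemma norm_fderiv_weight_le (h : IsAdmissible k Ω U u f) (hx : x ∈ U) : ‖fderiv ℝ f x‖ ≤ k := by
  have hk : 0 ≤ k := zero_le_one.trans h.one_le_bound
  have hL : LipschitzOnWith ⟨k, hk⟩ f U := by
    refine LipschitzOnWith.of_dist_le_mul fun a ha b hb => ?_
    rw [Real.dist_eq, dist_eq_norm]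
    exact h.weight_lipschitz a ha b hb
  exact norm_fderiv_le_of_lipschitzOn ℝ (h.isOpen_subset.mem_nhds hx) hL

lemma continuousOn_inv (h : IsAdmissible k Ω U u f) (i j : Fin n) :
    ContinuousOn (fun y => (graphMetric f u y)⁻¹ i j) Ω :=
  (contDiffOn_inv_graphMetric h.isOpen_domain h.contDiffOn_potential h.contDiffOn_weight
    h.one_le_weight i j).continuousOn

lemma continuousOn_sqrt_det (h : IsAdmissible k Ω U u f) :
    ContinuousOn (fun y => √(graphMetric f u y).det) Ω :=
  (contDiffOn_sqrt_det h.isOpen_domain h.contDiffOn_potential h.contDiffOn_weight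
    h.one_le_weight).continuousOn

lemma continuousOn_traceInv (h : IsAdmissible k Ω U u f) :
    ContinuousOn (traceInv (weightedMetric f) (gradGraph u)) Ω := by
  have e : traceInv (weightedMetric f) (gradGraph u) =
      fun y => ∑ i, (graphMetric f u y)⁻¹ i i := by
    funext y; rw [traceInv, inducedMetric_eq]; rfl
  rw [e]
  exact continuousOn_finsetSum _ fun i _ => h.continuousOn_inv i i

lemma continuousOn_pderiv_weight (h : IsAdmissible k Ω U u f) (i : Fin n) :
    ContinuousOn (fun y => pderiv i f y) Ω :=
  (contDiffOn_pderiv (m := 0) h.isOpen_domain h.contDiffOn_weight (by norm_num)).continuousOn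

lemma continuousOn_covDeriv (h : IsAdmissible k Ω U u f) (i j : Fin n) (c : Fin n ⊕ Fin n) :
    ContinuousOn (fun y => covDeriv (weightedMetric f) (gradGraph u) y i j c) Ω := by
  have hfd : ∀ y ∈ Ω, DifferentiableAt ℝ f y := fun y hy =>
    h.contDiffOn_weight.differentiableAt_of_isOpen h.isOpen_domain hy
  have hf0 : ∀ y ∈ Ω, f y ≠ 0 := fun y hy => by have := h.one_le_weight y hy; positivity
  rcases c with c | c
  · refine ContinuousOn.congr ?_ fun y hy => covDeriv_inl (hfd y hy) (hf0 y hy) i j c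
    refine (h.contDiffOn_weight.continuousOn.inv₀ hf0).mul ((ContinuousOn.add ?_ ?_).sub ?_)
    · split_ifs
      · exact h.continuousOn_pderiv_weight i
      · exact continuousOn_const
    · split_ifs
      · exact h.continuousOn_pderiv_weight j
      · exact continuousOn_const
    · split_ifs
      · exact h.continuousOn_pderiv_weight c
      · exact continuousOn_const
  · refine ContinuousOn.congr ?_ fun y hy => covDeriv_inr (hfd y hy) (hf0 y hy) i j c
    exact continuousOn_thirdDeriv h.isOpen_domain h.contDiffOn_potential i j c

lemma continuousOn_tangentVec (h : IsAdmissible k Ω U u f) (i : Fin n) (c : Fin n ⊕ Fin n) :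
    ContinuousOn (fun y => tangentVec (gradGraph u) y i c) Ω := by
  rcases c with c | c
  · simp_rw [tangentVec_inl]
    exact continuousOn_const
  · exact (contDiffOn_hess h.isOpen_domain h.contDiffOn_potential i c).continuousOn

lemma continuousOn_ambientInner (h : IsAdmissible k Ω U u f)
    {V W : EuclideanSpace ℝ (Fin n) → Fin n ⊕ Fin n → ℝ}
    (hV : ∀ c, ContinuousOn (fun y => V y c) Ω) (hW : ∀ c, ContinuousOn (fun y => W y c) Ω) :
    ContinuousOn (fun y => ambientInner (weightedMetric f) (gradGraph u y) (V y) (W y)) Ω := by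
  simp_rw [ambientInner_weightedMetric]
  exact ((h.contDiffOn_weight.continuousOn.pow 2).mul
    (continuousOn_finsetSum _ fun c _ => (hV _).mul (hW _))).add
    (continuousOn_finsetSum _ fun c _ => (hV _).mul (hW _))

lemma continuousOn_meanCurvatureNorm (h : IsAdmissible k Ω U u f) :
    ContinuousOn (meanCurvatureNorm (weightedMetric f) (gradGraph u)) Ω := by
  have hH : ∀ c, ContinuousOn (fun y => meanCurvature (weightedMetric f) (gradGraph u) y c) Ω := by
    intro c
    simp only [meanCurvature, normalPart, inducedMetric_eq, Finset.sum_apply, Pi.smul_apply,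
      Pi.sub_apply, smul_eq_mul]
    refine continuousOn_finsetSum _ fun i _ => continuousOn_finsetSum _ fun j _ =>
      (h.continuousOn_inv i j).mul ((h.continuousOn_covDeriv i j c).sub ?_)
    exact continuousOn_finsetSum _ fun a _ => continuousOn_finsetSum _ fun b _ =>
      ((h.continuousOn_inv a b).mul (h.continuousOn_ambientInner (h.continuousOn_covDeriv i j)
        (h.continuousOn_tangentVec a))).mul (h.continuousOn_tangentVec b c)
  exact (h.continuousOn_ambientInner hH hH).sqrt

lemma gradNorm_eq (f u ψ : EuclideanSpace ℝ (Fin n) → ℝ) (x : EuclideanSpace ℝ (Fin n)) :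
    gradNorm (weightedMetric f) (gradGraph u) ψ x =
      √((pderiv · ψ x) ⬝ᵥ ((graphMetric f u x)⁻¹ *ᵥ (pderiv · ψ x))) := by
  rw [gradNorm, inducedMetric_eq]
  congr 1
  simp only [dotProduct, mulVec, Finset.mul_sum]
  exact Finset.sum_congr rfl fun i _ => Finset.sum_congr rfl fun j _ => by ring

lemma continuousOn_gradNorm (h : IsAdmissible k Ω U u f) (hψ : ContDiff ℝ 1 ψ) :
    ContinuousOn (gradNorm (weightedMetric f) (gradGraph u) ψ) Ω := by
  have hp : ∀ i, ContinuousOn (fun y => pderiv i ψ y) Ω := fun i =>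
    (contDiffOn_pderiv (m := 0) h.isOpen_domain hψ.contDiffOn (by norm_num)).continuousOn
  unfold gradNorm
  simp_rw [inducedMetric_eq]
  exact (continuousOn_finsetSum _ fun i _ => continuousOn_finsetSum _ fun j _ =>
    ((h.continuousOn_inv i j).mul (hp i)).mul (hp j)).sqrt

lemma continuousOn_energyDensity (h : IsAdmissible k Ω U u f) (hψ : ContDiff ℝ 1 ψ) :
    ContinuousOn (energyDensity f u ψ) Ω :=
  (h.continuousOn_gradNorm hψ).add (hψ.continuous.continuousOn.mul
    (h.continuousOn_meanCurvatureNorm.add h.continuousOn_traceInv.sqrt))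

lemma gradNorm_eq_zero (hS : IsCompact S) (hψ : ∀ x, x ∉ S → ψ x = 0) (hx : x ∉ S) :
    gradNorm (weightedMetric f) (gradGraph u) ψ x = 0 := by
  have : ∀ i, pderiv i ψ x = 0 := fun i => by
    rw [pderiv_congr (eventually_eq_zero_of_notMem hS hψ hx), pderiv_const]
  simp [gradNorm, this]

lemma energyDensity_eq_zero (hS : IsCompact S) (hψ : ∀ x, x ∉ S → ψ x = 0) (hx : x ∉ S) :
    energyDensity f u ψ x = 0 := by
  rw [energyDensity, gradNorm_eq_zero hS hψ hx, hψ x hx]; ring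

lemma energyDensity_nonneg (hψ : 0 ≤ ψ x) : 0 ≤ energyDensity f u ψ x := by
  have h1 : 0 ≤ gradNorm (weightedMetric f) (gradGraph u) ψ x := Real.sqrt_nonneg _
  have h2 : 0 ≤ meanCurvatureNorm (weightedMetric f) (gradGraph u) x := Real.sqrt_nonneg _
  unfold energyDensity
  positivity

lemma aemeasurable_density (h : IsAdmissible k Ω U u f) :
    AEMeasurable (fun y => ENNReal.ofReal (√(graphMetric f u y).det)) (volume.restrict Ω) :=
  (h.continuousOn_sqrt_det.aemeasurable h.isOpen_domain.measurableSet).ennreal_ofReal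

lemma graphVolume_eq (f u : EuclideanSpace ℝ (Fin n) → ℝ) (Ω : Set (EuclideanSpace ℝ (Fin n))) :
    graphVolume f u Ω = (volume.restrict Ω).withDensity
      fun y => ENNReal.ofReal (√(graphMetric f u y).det) := by
  rw [graphVolume, volumeMeasure]
  simp_rw [inducedMetric_eq]

lemma lintegral_graphVolume (h : IsAdmissible k Ω U u f)
    (a : EuclideanSpace ℝ (Fin n) → ℝ≥0∞) :
    ∫⁻ x, a x ∂(graphVolume f u Ω) =
      ∫⁻ x in Ω, ENNReal.ofReal (√(graphMetric f u x).det) * a x := by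
  rw [graphVolume_eq, lintegral_withDensity_eq_lintegral_mul_non_measurable₀ _
    h.aemeasurable_density (Filter.Eventually.of_forall fun _ => ENNReal.ofReal_lt_top)]
  rfl

lemma continuous_sqrt_det_mul (h : IsAdmissible k Ω U u f) (hSU : S ⊆ U) (hS : IsCompact S)
    {a : EuclideanSpace ℝ (Fin n) → ℝ} (ha : ContinuousOn a U) (ha0 : ∀ x, x ∉ S → a x = 0) :
    Continuous fun x => √(graphMetric f u x).det * a x :=
  continuous_of_continuousOn_of_eq_zero h.isOpen_subset hSU hS
    ((h.continuousOn_sqrt_det.mono h.subset_domain).mul ha)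
    fun x hx => by rw [ha0 x hx, mul_zero]

lemma integrable_sqrt_det_mul (h : IsAdmissible k Ω U u f) (hSU : S ⊆ U) (hS : IsCompact S)
    {a : EuclideanSpace ℝ (Fin n) → ℝ} (ha : ContinuousOn a U) (ha0 : ∀ x, x ∉ S → a x = 0) :
    Integrable fun x => √(graphMetric f u x).det * a x :=
  (h.continuous_sqrt_det_mul hSU hS ha ha0).integrable_of_hasCompactSupport
    (HasCompactSupport.intro hS fun x hx => by rw [ha0 x hx, mul_zero])

lemma lintegral_ofReal_graphVolume (h : IsAdmissible k Ω U u f) (hSU : S ⊆ U) (hS : IsCompact S)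
    {a : EuclideanSpace ℝ (Fin n) → ℝ} (ha : ContinuousOn a U) (ha0 : ∀ x, x ∉ S → a x = 0)
    (hann : ∀ x, 0 ≤ a x) :
    ∫⁻ x, ENNReal.ofReal (a x) ∂(graphVolume f u Ω) =
      ENNReal.ofReal (∫ x, √(graphMetric f u x).det * a x) := by
  rw [ofReal_integral_eq_lintegral_ofReal (h.integrable_sqrt_det_mul hSU hS ha ha0)
    (Filter.Eventually.of_forall fun x => mul_nonneg (Real.sqrt_nonneg _) (hann x)),
    h.lintegral_graphVolume, ← lintegral_indicator h.isOpen_domain.measurableSet]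
  refine lintegral_congr fun x => ?_
  rw [ENNReal.ofReal_mul (Real.sqrt_nonneg _)]
  by_cases hx : x ∈ Ω
  · rw [Set.indicator_of_mem hx]
  · rw [Set.indicator_of_notMem hx, ha0 x fun hxS => hx (h.subset_domain (hSU hxS))]; simp

lemma traceInv_eq (f u : EuclideanSpace ℝ (Fin n) → ℝ) (x : EuclideanSpace ℝ (Fin n)) :
    traceInv (weightedMetric f) (gradGraph u) x = ((graphMetric f u x)⁻¹).trace := by
  rw [traceInv, inducedMetric_eq]

/-- Linear errors in the trace are controlled by its square root, since `g ≥ f² δ ≥ δ` bounds the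
trace by `n`. -/
lemma traceInv_le (h : IsAdmissible k Ω U u f) (hx : x ∈ Ω) :
    traceInv (weightedMetric f) (gradGraph u) x ≤
      n * √(traceInv (weightedMetric f) (gradGraph u) x) := by
  have hg := posDef_graphMetric (u := u) (h.one_le_weight x hx)
  rw [traceInv_eq]
  have h0 := trace_inv_nonneg hg
  have h1 : (graphMetric f u x)⁻¹.trace ≤ n := trace_inv_le hg fun ξ => by
    rw [graphMetric, dotProduct_graphMetric_mulVec]
    have a1 : 0 ≤ ξ ⬝ᵥ ξ := by simpa using dotProduct_star_self_nonneg ξ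
    have a2 : 0 ≤ ((hess u x)ᵀ *ᵥ ξ) ⬝ᵥ ((hess u x)ᵀ *ᵥ ξ) := by
      simpa using dotProduct_star_self_nonneg ((hess u x)ᵀ *ᵥ ξ)
    have a3 := le_mul_of_one_le_left a1 (one_le_pow₀ (n := 2) (h.one_le_weight x hx))
    linarith
  set t := (graphMetric f u x)⁻¹.trace with ht
  have h2 : √t ≤ n := by
    rcases Nat.eq_zero_or_pos n with h3 | h3
    · subst h3
      have : t = 0 := le_antisymm (by simpa using h1) h0
      rw [this]; simp
    · have h4 : (1 : ℝ) ≤ n := by exact_mod_cast h3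
      rw [Real.sqrt_le_left (by positivity)]
      nlinarith
  calc t = √t * √t := (Real.mul_self_sqrt h0).symm
    _ ≤ n * √t := by gcongr

end IsAdmissible

/-! ### The monotonicity inequality -/

namespace IsAdmissible

variable {n : ℕ} {k : ℝ} {Ω U S : Set (EuclideanSpace ℝ (Fin n))}
  {u f ψ : EuclideanSpace ℝ (Fin n) → ℝ} {x₀ x : EuclideanSpace ℝ (Fin n)}

/-- Green's formula: the divergence of `ζ ∇_g p` integrates to zero, where `p` is a family of
functions in the role of the differential. -/
lemma integral_divergence_eq_zero (h : IsAdmissible k Ω U u f) (hSU : S ⊆ U) (hS : IsCompact S)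
    {ζ : EuclideanSpace ℝ (Fin n) → ℝ} (hζ : ContDiffOn ℝ 1 ζ U) (hζ0 : ∀ x, x ∉ S → ζ x = 0)
    {p : Fin n → EuclideanSpace ℝ (Fin n) → ℝ} (hp : ∀ l, ContDiffOn ℝ 1 (p l) Ω) :
    Integrable (fun x => √(graphMetric f u x).det * (ζ x * lapOf f u p x +
      (pderiv · ζ x) ⬝ᵥ ((graphMetric f u x)⁻¹ *ᵥ (p · x)))) ∧
    ∫ x, √(graphMetric f u x).det * (ζ x * lapOf f u p x +
      (pderiv · ζ x) ⬝ᵥ ((graphMetric f u x)⁻¹ *ᵥ (p · x))) = 0 := by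
  have hflux : ∀ i, ContDiffOn ℝ 1 (fun y => √(graphMetric f u y).det *
      ∑ l, (graphMetric f u y)⁻¹ i l * p l y) Ω := fun i =>
    (contDiffOn_sqrt_det h.isOpen_domain h.contDiffOn_potential h.contDiffOn_weight
      h.one_le_weight).mul (ContDiffOn.sum fun l _ => (contDiffOn_inv_graphMetric h.isOpen_domain
        h.contDiffOn_potential h.contDiffOn_weight h.one_le_weight i l).mul (hp l))
  set V : Fin n → EuclideanSpace ℝ (Fin n) → ℝ := fun i y => ζ y * (√(graphMetric f u y).det *
      ∑ l, (graphMetric f u y)⁻¹ i l * p l y) with hV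
  have hV0 : ∀ i x, x ∉ S → V i x = 0 := fun i x hx => by simp [hV, hζ0 x hx]
  have hVc : ∀ i, ContDiff ℝ 1 (V i) := fun i =>
    contDiff_of_contDiffOn_of_eq_zero h.isOpen_subset hSU hS
      (hζ.mul ((hflux i).mono h.subset_domain)) (hV0 i)
  have hint : ∀ i, Integrable (fun x => pderiv i (V i) x) := fun i =>
    (((hVc i).continuous_fderiv (by norm_num)).clm_apply
      continuous_const).integrable_of_hasCompactSupport
      ((HasCompactSupport.intro hS (hV0 i)).fderiv_apply ℝ _)
  have hsum : ∫ x, ∑ i, pderiv i (V i) x = 0 := by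
    rw [integral_finsetSum _ fun i _ => hint i]
    exact Finset.sum_eq_zero fun i _ => integral_pderiv_eq_zero (hVc i) hS (hV0 i)
  have heq : (fun x => √(graphMetric f u x).det * (ζ x * lapOf f u p x +
      (pderiv · ζ x) ⬝ᵥ ((graphMetric f u x)⁻¹ *ᵥ (p · x)))) =
      fun x => ∑ i, pderiv i (V i) x := by
    funext x
    by_cases hx : x ∈ U
    · have hxΩ := h.subset_domain hx
      have hζd := hζ.differentiableAt_of_isOpen h.isOpen_subset hx
      have hfd : ∀ i, DifferentiableAt ℝ (fun y => √(graphMetric f u y).det *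
          ∑ l, (graphMetric f u y)⁻¹ i l * p l y) x := fun i =>
        (hflux i).differentiableAt_of_isOpen h.isOpen_domain hxΩ
      have e : ∀ i, pderiv i (V i) x = ζ x * pderiv i (fun y => √(graphMetric f u y).det *
          ∑ l, (graphMetric f u y)⁻¹ i l * p l y) x + pderiv i ζ x * (√(graphMetric f u x).det *
          ∑ l, (graphMetric f u x)⁻¹ i l * p l x) := fun i => pderiv_mul hζd (hfd i)
      simp only [e, Finset.sum_add_distrib, ← Finset.mul_sum]
      rw [sum_pderiv_flux h.isOpen_domain h.contDiffOn_potential h.contDiffOn_weight h.one_le_weight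
        (fun l => (hp l).differentiableAt_of_isOpen h.isOpen_domain hxΩ) hxΩ]
      simp only [dotProduct, mulVec, Finset.mul_sum, mul_add]
      congr 1
      · ring
      · exact Finset.sum_congr rfl fun i _ => Finset.sum_congr rfl fun j _ => by ring
    · have hxS : x ∉ S := fun h' => hx (hSU h')
      have e1 : ∀ i, pderiv i ζ x = 0 := fun i => by
        rw [pderiv_congr (eventually_eq_zero_of_notMem hS hζ0 hxS), pderiv_const]
      have e2 : ∀ i, pderiv i (V i) x = 0 := fun i => by
        rw [pderiv_congr (eventually_eq_zero_of_notMem hS (hV0 i) hxS), pderiv_const]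
      simp [e1, e2, hζ0 x hxS, dotProduct]
  rw [heq]
  exact ⟨integrable_finsetSum _ fun i _ => hint i, hsum⟩

/-- The kernel `(σ² + |·|²)^α` around `x₀`, in the flat metric frozen at `x₀`. -/
def kernelPow (f u : EuclideanSpace ℝ (Fin n) → ℝ) (x₀ : EuclideanSpace ℝ (Fin n)) (σ α : ℝ)
    (x : EuclideanSpace ℝ (Fin n)) : ℝ :=
  (σ ^ 2 + 2 * halfSq (f x₀) u x₀ x) ^ α

lemma kernel_base_pos {σ : ℝ} (hσ : 0 < σ) (f₀ : ℝ) (u : EuclideanSpace ℝ (Fin n) → ℝ)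
    (x₀ x : EuclideanSpace ℝ (Fin n)) : 0 < σ ^ 2 + 2 * halfSq f₀ u x₀ x := by
  have := halfSq_nonneg f₀ u x₀ x; positivity

lemma kernelPow_pos {σ : ℝ} (hσ : 0 < σ) (α : ℝ) : 0 < kernelPow f u x₀ σ α x :=
  Real.rpow_pos_of_pos (kernel_base_pos hσ _ _ _ _) _

lemma contDiffOn_kernelPow (h : IsAdmissible k Ω U u f) {σ : ℝ} (hσ : 0 < σ) (α : ℝ) :
    ContDiffOn ℝ 1 (kernelPow f u x₀ σ α) Ω :=
  ContDiffOn.rpow_const_of_ne (contDiffOn_const.add (contDiffOn_const.mul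
    ((contDiffOn_halfSq h.isOpen_domain h.contDiffOn_potential).of_le (by norm_num))))
    fun _ _ => (kernel_base_pos hσ _ _ _ _).ne'

lemma pderiv_kernelPow (h : IsAdmissible k Ω U u f) {σ : ℝ} (hσ : 0 < σ) (α : ℝ) (hx : x ∈ Ω)
    (i : Fin n) : pderiv i (kernelPow f u x₀ σ α) x =
      2 * α * kernelPow f u x₀ σ (α - 1) x * dHalfSq (f x₀) u x₀ i x := by
  have hq : DifferentiableAt ℝ (halfSq (f x₀) u x₀) x :=
    ((contDiffOn_halfSq h.isOpen_domain h.contDiffOn_potential).of_le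
      (by norm_num)).differentiableAt_of_isOpen h.isOpen_domain hx
  have hβ : HasDerivAt (fun t : ℝ => (σ ^ 2 + 2 * t) ^ α)
      (2 * α * kernelPow f u x₀ σ (α - 1) x) (halfSq (f x₀) u x₀ x) := by
    have h1 : HasDerivAt (fun t : ℝ => σ ^ 2 + 2 * t) 2 (halfSq (f x₀) u x₀ x) := by
      simpa using ((hasDerivAt_id (halfSq (f x₀) u x₀ x)).const_mul 2).const_add (σ ^ 2)
    have := h1.rpow_const (p := α) (Or.inl (kernel_base_pos hσ (f x₀) u x₀ x).ne')
    simpa [kernelPow] using this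
  have := pderiv_comp (i := i) hβ hq
  rw [pderiv_halfSq h.isOpen_domain h.contDiffOn_potential hx] at this
  exact this

/-- The algebra of `divergence_lower_bound`: `γ` stands for `(σ² + r²)^(-n/2-1)`, `N` and `X` for
the products of `∇_g (r²/2)` with itself and with `∇_g ψ`, and `L` for its divergence. -/
lemma divergence_algebra {n k γ σ r T H L D X N s P : ℝ} (hk : 1 ≤ k) (hn0 : 0 ≤ n) (hγ : 0 ≤ γ)
    (hr0 : 0 ≤ r) (hT0 : 0 ≤ T) (hH0 : 0 ≤ H) (hD : 0 ≤ D) (hs0 : 0 ≤ s) (hP : 0 ≤ P)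
    (hTn : T ≤ n * s) (p1 : n - 5 * k ^ 3 * r * T - k * r * H ≤ L) (hXb : -(D * (k * r)) ≤ X)
    (p2 : N ≤ r ^ 2 * (1 + 2 * k ^ 2 * r * T)) :
    n * σ ^ 2 * (P * γ) - (5 * k ^ 3 + 2 * n * k ^ 2 + 1) * (n + 1) *
      (γ * (σ ^ 2 + r ^ 2) * r * (D + P * (H + s))) ≤
    P * (γ * (σ ^ 2 + r ^ 2)) * L + (γ * (σ ^ 2 + r ^ 2) * X - n * P * γ * N) := by
  -- all error terms carry the common factor `γ (σ² + r²) r`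
  have q1 : (P * (γ * (σ ^ 2 + r ^ 2))) * (n - 5 * k ^ 3 * r * T - k * r * H) ≤
      (P * (γ * (σ ^ 2 + r ^ 2))) * L := by gcongr
  have q2 : γ * (σ ^ 2 + r ^ 2) * (-(D * (k * r))) ≤ γ * (σ ^ 2 + r ^ 2) * X := by gcongr
  have q3 : n * P * γ * N ≤ n * P * γ * (r ^ 2 * (1 + 2 * k ^ 2 * r * T)) := by gcongr
  have q4 : n * P * γ * (r ^ 2 * (2 * k ^ 2 * r * T)) ≤
      n * P * γ * ((σ ^ 2 + r ^ 2) * (2 * k ^ 2 * r * T)) := by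
    gcongr
    nlinarith [sq_nonneg σ]
  have q5 : D * k + P * (k * H + (5 * k ^ 3 + 2 * n * k ^ 2) * T) ≤
      (5 * k ^ 3 + 2 * n * k ^ 2 + 1) * (n + 1) * (D + P * (H + s)) := by
    have hkk : k ≤ (5 * k ^ 3 + 2 * n * k ^ 2 + 1) * (n + 1) := by
      have a1 : k ≤ k ^ 3 := le_self_pow₀ hk (by norm_num)
      have a2 : 0 ≤ 2 * n * k ^ 2 := by positivity
      have a3 : (5 * k ^ 3 + 2 * n * k ^ 2 + 1) ≤ (5 * k ^ 3 + 2 * n * k ^ 2 + 1) * (n + 1) :=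
        le_mul_of_one_le_right (by positivity) (by linarith)
      have a4 : 0 ≤ k ^ 3 := by positivity
      linarith
    have b1 : (5 * k ^ 3 + 2 * n * k ^ 2) * T ≤ (5 * k ^ 3 + 2 * n * k ^ 2 + 1) * (n + 1) * s := by
      calc (5 * k ^ 3 + 2 * n * k ^ 2) * T ≤ (5 * k ^ 3 + 2 * n * k ^ 2 + 1) * (n * s) := by
            gcongr ?_ * ?_
            linarith
        _ ≤ (5 * k ^ 3 + 2 * n * k ^ 2 + 1) * ((n + 1) * s) := by
            gcongr; linarith
        _ = _ := by ring
    calc D * k + P * (k * H + (5 * k ^ 3 + 2 * n * k ^ 2) * T)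
        ≤ D * ((5 * k ^ 3 + 2 * n * k ^ 2 + 1) * (n + 1)) +
          P * ((5 * k ^ 3 + 2 * n * k ^ 2 + 1) * (n + 1) * H +
            (5 * k ^ 3 + 2 * n * k ^ 2 + 1) * (n + 1) * s) := by gcongr
      _ = _ := by ring
  have q6 := mul_le_mul_of_nonneg_left q5
    (by positivity : 0 ≤ γ * (σ ^ 2 + r ^ 2) * r)
  linarith

/-- Pointwise lower bound for the divergence of `ψ (σ² + r²)^(-n/2) ∇_g (r²/2)`. The exponent is
chosen so that the terms of order zero combine to
`n (σ² + r²)^(-n/2) - n r² (σ² + r²)^(-n/2-1) = n σ² (σ² + r²)^(-n/2-1)`. -/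
lemma divergence_lower_bound (h : IsAdmissible k Ω U u f) (hx : x ∈ U) (hx₀ : x₀ ∈ U)
    (hψ : DifferentiableAt ℝ ψ x) (hψ0 : 0 ≤ ψ x) {σ : ℝ} (hσ : 0 < σ) :
    n * σ ^ 2 * (ψ x * kernelPow f u x₀ σ (-(n : ℝ) / 2 - 1) x) -
      (5 * k ^ 3 + 2 * n * k ^ 2 + 1) * (n + 1) * (kernelPow f u x₀ σ (-(n : ℝ) / 2) x *
        flatDist (f x₀) u x₀ x * energyDensity f u ψ x) ≤
    (ψ x * kernelPow f u x₀ σ (-(n : ℝ) / 2) x) * lapOf f u (dHalfSq (f x₀) u x₀) x +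
      (pderiv · (fun y => ψ y * kernelPow f u x₀ σ (-(n : ℝ) / 2) y) x) ⬝ᵥ
        ((graphMetric f u x)⁻¹ *ᵥ (dHalfSq (f x₀) u x₀ · x)) := by
  have hxΩ := h.subset_domain hx
  have hk := h.one_le_bound
  have hg := posDef_graphMetric (u := u) (h.one_le_weight x hxΩ)
  have hTn := h.traceInv_le hxΩ
  rw [traceInv_eq] at hTn
  rw [energyDensity, traceInv_eq, gradNorm_eq]
  have hH0 : 0 ≤ meanCurvatureNorm (weightedMetric f) (gradGraph u) x := Real.sqrt_nonneg _
  have hT0 := trace_inv_nonneg hg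
  have hr0 := flatDist_nonneg (f x₀) u x₀ x
  obtain ⟨p1, p2, p3⟩ := pointwise_estimates h.isOpen_domain h.contDiffOn_potential
    h.contDiffOn_weight h.one_le_weight hxΩ (h.subset_domain hx₀) hk (h.weight_le x₀ hx₀)
    (h.weight_le x hx) (by rw [norm_sub_rev]; exact h.weight_lipschitz x₀ hx₀ x hx)
    (h.norm_fderiv_weight_le hx) rfl rfl rfl
  have hs : σ ^ 2 + 2 * halfSq (f x₀) u x₀ x = σ ^ 2 + flatDist (f x₀) u x₀ x ^ 2 := by
    rw [flatDist, Real.sq_sqrt (by have := halfSq_nonneg (f x₀) u x₀ x; positivity)]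
  have hβ : kernelPow f u x₀ σ (-(n : ℝ) / 2) x =
      kernelPow f u x₀ σ (-(n : ℝ) / 2 - 1) x * (σ ^ 2 + flatDist (f x₀) u x₀ x ^ 2) := by
    have hpos := kernel_base_pos hσ (f x₀) u x₀ x
    rw [kernelPow, kernelPow, ← hs, ← Real.rpow_add_one hpos.ne']
    congr 1; ring
  have hγpos := kernelPow_pos (f := f) (u := u) (x₀ := x₀) (x := x) hσ (-(n : ℝ) / 2 - 1)
  have hpd : ∀ i, pderiv i (fun y => ψ y * kernelPow f u x₀ σ (-(n : ℝ) / 2) y) x =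
      kernelPow f u x₀ σ (-(n : ℝ) / 2) x * pderiv i ψ x -
        n * ψ x * kernelPow f u x₀ σ (-(n : ℝ) / 2 - 1) x * dHalfSq (f x₀) u x₀ i x := by
    intro i
    rw [pderiv_mul hψ ((h.contDiffOn_kernelPow hσ _).differentiableAt_of_isOpen h.isOpen_domain hxΩ),
      h.pderiv_kernelPow hσ _ hxΩ]
    ring
  have hdot : (pderiv · (fun y => ψ y * kernelPow f u x₀ σ (-(n : ℝ) / 2) y) x) ⬝ᵥ
        ((graphMetric f u x)⁻¹ *ᵥ (dHalfSq (f x₀) u x₀ · x)) =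
      kernelPow f u x₀ σ (-(n : ℝ) / 2) x *
        ((pderiv · ψ x) ⬝ᵥ ((graphMetric f u x)⁻¹ *ᵥ (dHalfSq (f x₀) u x₀ · x))) -
      n * ψ x * kernelPow f u x₀ σ (-(n : ℝ) / 2 - 1) x *
        ((dHalfSq (f x₀) u x₀ · x) ⬝ᵥ
          ((graphMetric f u x)⁻¹ *ᵥ (dHalfSq (f x₀) u x₀ · x))) := by
    simp only [hpd, dotProduct, sub_mul, Finset.sum_sub_distrib, Finset.mul_sum, mul_assoc]
  rw [hdot, hβ]
  have hCS := dotProduct_mulVec_sq_le hg.inv.posSemidef (pderiv · ψ x) (dHalfSq (f x₀) u x₀ · x)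
  have hD0 := dotProduct_mulVec_self_nonneg hg.inv.posSemidef (pderiv · ψ x)
  set D := √((pderiv · ψ x) ⬝ᵥ ((graphMetric f u x)⁻¹ *ᵥ (pderiv · ψ x))) with hD
  have hDnn : 0 ≤ D := Real.sqrt_nonneg _
  rw [← Real.sq_sqrt hD0, ← hD] at hCS
  set X := (pderiv · ψ x) ⬝ᵥ ((graphMetric f u x)⁻¹ *ᵥ (dHalfSq (f x₀) u x₀ · x)) with hX
  set N := (dHalfSq (f x₀) u x₀ · x) ⬝ᵥ
          ((graphMetric f u x)⁻¹ *ᵥ (dHalfSq (f x₀) u x₀ · x)) with hN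
  set r := flatDist (f x₀) u x₀ x with hr
  set T := ((graphMetric f u x)⁻¹).trace with hT
  set H := meanCurvatureNorm (weightedMetric f) (gradGraph u) x with hH
  set γ := kernelPow f u x₀ σ (-(n : ℝ) / 2 - 1) x with hγ
  set L := lapOf f u (dHalfSq (f x₀) u x₀) x with hL
  have hXb : -(D * (k * r)) ≤ X := by
    refine neg_le_of_abs_le (abs_le_of_sq_le_sq (hCS.trans ?_) (by positivity))
    calc D ^ 2 * N ≤ D ^ 2 * (k ^ 2 * r ^ 2) := by gcongr
      _ = _ := by ring
  set s := √T with hs'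
  have hs0 : 0 ≤ s := Real.sqrt_nonneg _
  have hn0 : (0 : ℝ) ≤ n := Nat.cast_nonneg n
  exact divergence_algebra hk hn0 hγpos.le hr0 hT0 hH0 hDnn hs0 hψ0 hTn p1 hXb p2

lemma continuousOn_flatDist (h : IsAdmissible k Ω U u f) (f₀ : ℝ) :
    ContinuousOn (flatDist f₀ u x₀) Ω :=
  (continuousOn_const.mul
    (contDiffOn_halfSq h.isOpen_domain h.contDiffOn_potential).continuousOn).sqrt

lemma _root_.ContinuousOn.aemeasurable_graphVolume {a : EuclideanSpace ℝ (Fin n) → ℝ}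
    (ha : ContinuousOn a Ω) (hΩ : IsOpen Ω) : AEMeasurable a (graphVolume f u Ω) :=
  (ha.aemeasurable hΩ.measurableSet).mono_ac (withDensity_absolutelyContinuous _ _)

lemma nullMeasurableSet_flatDist_lt (h : IsAdmissible k Ω U u f) (f₀ σ : ℝ) :
    NullMeasurableSet {x | flatDist f₀ u x₀ x < σ} (graphVolume f u Ω) :=
  nullMeasurableSet_lt ((h.continuousOn_flatDist f₀).aemeasurable_graphVolume h.isOpen_domain)
    aemeasurable_const

lemma le_kernelPow_of_flatDist_lt (hn : 1 ≤ n) {σ : ℝ} (hσ : 0 < σ)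
    (hx : flatDist (f x₀) u x₀ x < σ) :
    1 ≤ 2 ^ (n + 1) * σ ^ n * (n * σ ^ 2 * kernelPow f u x₀ σ (-(n : ℝ) / 2 - 1) x) := by
  have hs : σ ^ 2 + 2 * halfSq (f x₀) u x₀ x = σ ^ 2 + flatDist (f x₀) u x₀ x ^ 2 := by
    rw [flatDist, Real.sq_sqrt (by have := halfSq_nonneg (f x₀) u x₀ x; positivity)]
  have hn' : (1 : ℝ) ≤ n := by exact_mod_cast hn
  have hr := flatDist_nonneg (f x₀) u x₀ x
  have hle : σ ^ 2 + 2 * halfSq (f x₀) u x₀ x ≤ 2 * σ ^ 2 := by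
    rw [hs]; nlinarith
  have h1 : (2 * σ ^ 2) ^ (-(n : ℝ) / 2 - 1) ≤ kernelPow f u x₀ σ (-(n : ℝ) / 2 - 1) x :=
    Real.rpow_le_rpow_of_nonpos (kernel_base_pos hσ _ _ _ _) hle (by linarith)
  have h2 : (2 * σ ^ 2) ^ ((n : ℝ) / 2 + 1) ≤ 2 ^ (n + 1) * σ ^ (n + 2) := by
    rw [Real.mul_rpow (by norm_num) (by positivity)]
    have e1 : (σ ^ 2) ^ ((n : ℝ) / 2 + 1) = σ ^ (n + 2) := by
      rw [← Real.rpow_natCast σ 2, ← Real.rpow_mul hσ.le, ← Real.rpow_natCast σ (n + 2)]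
      congr 1; push_cast; ring
    rw [e1]
    gcongr
    rw [← Real.rpow_natCast 2 (n + 1)]
    refine Real.rpow_le_rpow_of_exponent_le (by norm_num) ?_
    push_cast; linarith
  have h3 : (2 * σ ^ 2) ^ (-(n : ℝ) / 2 - 1) * (2 * σ ^ 2) ^ ((n : ℝ) / 2 + 1) = 1 := by
    rw [← Real.rpow_add (by positivity), show -(n : ℝ) / 2 - 1 + ((n : ℝ) / 2 + 1) = 0 by ring,
      Real.rpow_zero]
  have h4 : 0 < (2 * σ ^ 2) ^ (-(n : ℝ) / 2 - 1) := by positivity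
  calc (1 : ℝ) = (2 * σ ^ 2) ^ (-(n : ℝ) / 2 - 1) * (2 * σ ^ 2) ^ ((n : ℝ) / 2 + 1) := h3.symm
    _ ≤ kernelPow f u x₀ σ (-(n : ℝ) / 2 - 1) x * (2 ^ (n + 1) * σ ^ (n + 2)) := by
        gcongr
        exact (kernelPow_pos hσ _).le
    _ ≤ kernelPow f u x₀ σ (-(n : ℝ) / 2 - 1) x * (2 ^ (n + 1) * σ ^ (n + 2)) * n :=
        le_mul_of_one_le_right (mul_nonneg (kernelPow_pos hσ _).le (by positivity)) hn'
    _ = _ := by ring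

lemma kernelPow_mul_flatDist_le (σ : ℝ) :
    kernelPow f u x₀ σ (-(n : ℝ) / 2) x * flatDist (f x₀) u x₀ x ≤
      flatDist (f x₀) u x₀ x / flatDist (f x₀) u x₀ x ^ n := by
  have hs : σ ^ 2 + 2 * halfSq (f x₀) u x₀ x = σ ^ 2 + flatDist (f x₀) u x₀ x ^ 2 := by
    rw [flatDist, Real.sq_sqrt (by have := halfSq_nonneg (f x₀) u x₀ x; positivity)]
  rcases (flatDist_nonneg (f x₀) u x₀ x).eq_or_lt with h0 | h0
  · rw [← h0]; simp
  have h1 : kernelPow f u x₀ σ (-(n : ℝ) / 2) x ≤ (flatDist (f x₀) u x₀ x ^ 2) ^ (-(n : ℝ) / 2) := by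
    refine Real.rpow_le_rpow_of_nonpos (by positivity) ?_ ?_
    · rw [hs]; nlinarith
    · have : (0 : ℝ) ≤ n := Nat.cast_nonneg n
      linarith
  have h2 : (flatDist (f x₀) u x₀ x ^ 2) ^ (-(n : ℝ) / 2) = (flatDist (f x₀) u x₀ x ^ n)⁻¹ := by
    rw [← Real.rpow_natCast _ 2, ← Real.rpow_mul h0.le, ← Real.rpow_natCast _ n,
      ← Real.rpow_neg h0.le]
    congr 1; push_cast; ring
  rw [h2] at h1
  calc _ ≤ (flatDist (f x₀) u x₀ x ^ n)⁻¹ * flatDist (f x₀) u x₀ x := by gcongr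
    _ = _ := by rw [div_eq_inv_mul]

/-- The monotonicity inequality in integrated form: the density ratios of `ψ` at `x₀` are controlled
by the Riesz potential of the energy density. The test field `ψ (σ² + r²)^(-n/2) ∇_g (r²/2)` needs
no cutoff, since `ψ` has compact support. -/
theorem lintegral_le_kernel (h : IsAdmissible k Ω U u f) (hSU : S ⊆ U) (hS : IsCompact S)
    (hn : 1 ≤ n) (hψ : ContDiff ℝ 1 ψ) (hψS : ∀ x, x ∉ S → ψ x = 0) (hψ0 : ∀ x, 0 ≤ ψ x)
    (hx₀ : x₀ ∈ U) {σ : ℝ} (hσ : 0 < σ) :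
    ∫⁻ x in {x | flatDist (f x₀) u x₀ x < σ}, ENNReal.ofReal (ψ x) ∂(graphVolume f u Ω) ≤
      ENNReal.ofReal (2 ^ (n + 1) * ((5 * k ^ 3 + 2 * n * k ^ 2 + 1) * (n + 1)) * σ ^ n) *
      ∫⁻ x, ENNReal.ofReal (flatDist (f x₀) u x₀ x / flatDist (f x₀) u x₀ x ^ n) *
        ENNReal.ofReal (energyDensity f u ψ x) ∂(graphVolume f u Ω) := by
  have hk := h.one_le_bound
  set C := (5 * k ^ 3 + 2 * n * k ^ 2 + 1) * ((n : ℝ) + 1) with hC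
  have hC0 : 0 ≤ C := by positivity
  set a₁ : EuclideanSpace ℝ (Fin n) → ℝ := fun x =>
    n * σ ^ 2 * (ψ x * kernelPow f u x₀ σ (-(n : ℝ) / 2 - 1) x) with ha₁
  set a₂ : EuclideanSpace ℝ (Fin n) → ℝ := fun x =>
    kernelPow f u x₀ σ (-(n : ℝ) / 2) x * flatDist (f x₀) u x₀ x * energyDensity f u ψ x with ha₂
  have ha₁0 : ∀ x, x ∉ S → a₁ x = 0 := fun x hx => by simp [ha₁, hψS x hx]
  have ha₂0 : ∀ x, x ∉ S → a₂ x = 0 := fun x hx => by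
    simp [ha₂, energyDensity_eq_zero hS hψS hx]
  have hker : ∀ α, ContinuousOn (kernelPow f u x₀ σ α) U := fun α =>
    (h.contDiffOn_kernelPow hσ α).continuousOn.mono h.subset_domain
  have ha₁c : ContinuousOn a₁ U :=
    continuousOn_const.mul (hψ.continuous.continuousOn.mul (hker _))
  have ha₂c : ContinuousOn a₂ U :=
    ((hker _).mul ((h.continuousOn_flatDist _).mono h.subset_domain)).mul
      ((h.continuousOn_energyDensity hψ).mono h.subset_domain)
  have ha₁nn : ∀ x, 0 ≤ a₁ x := fun x => by
    have := hψ0 x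
    have := (kernelPow_pos (f := f) (u := u) (x₀ := x₀) (x := x) hσ (-(n : ℝ) / 2 - 1)).le
    simp only [ha₁]; positivity
  have ha₂nn : ∀ x, 0 ≤ a₂ x := fun x => by
    have h1 := energyDensity_nonneg (f := f) (u := u) (hψ0 x)
    have h2 := (kernelPow_pos (f := f) (u := u) (x₀ := x₀) (x := x) hσ (-(n : ℝ) / 2)).le
    have h3 := flatDist_nonneg (f x₀) u x₀ x
    simp only [ha₂]; positivity
  have hi₁ := h.integrable_sqrt_det_mul hSU hS ha₁c ha₁0
  have hi₂ := h.integrable_sqrt_det_mul hSU hS ha₂c ha₂0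
  have hmain : ∫ x, √(graphMetric f u x).det * a₁ x ≤
      C * ∫ x, √(graphMetric f u x).det * a₂ x := by
    obtain ⟨hdi, hd0⟩ := h.integral_divergence_eq_zero hSU hS
      (ζ := fun y => ψ y * kernelPow f u x₀ σ (-(n : ℝ) / 2) y)
      (hψ.contDiffOn.mul ((h.contDiffOn_kernelPow hσ _).mono h.subset_domain))
      (fun x hx => by rw [hψS x hx, zero_mul])
      (p := dHalfSq (f x₀) u x₀)
      (fun l => contDiffOn_dHalfSq h.isOpen_domain h.contDiffOn_potential l)
    have hle : ∫ x, (√(graphMetric f u x).det * a₁ x - C * (√(graphMetric f u x).det * a₂ x)) ≤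
        0 := by
      rw [← hd0]
      refine integral_mono (hi₁.sub (hi₂.const_mul C)) hdi fun x => ?_
      by_cases hx : x ∈ U
      · have := h.divergence_lower_bound hx hx₀ (hψ.differentiable (by norm_num) x) (hψ0 x) hσ
        have h2 := mul_le_mul_of_nonneg_left this (Real.sqrt_nonneg (graphMetric f u x).det)
        simp only [ha₁, ha₂]
        linarith
      · have hxS : x ∉ S := fun h' => hx (hSU h')
        have e1 : ∀ i, pderiv i (fun y => ψ y * kernelPow f u x₀ σ (-(n : ℝ) / 2) y) x = 0 :=
          fun i => by
            rw [pderiv_congr (eventually_eq_zero_of_notMem hS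
              (fun x hx => by rw [hψS x hx, zero_mul]) hxS), pderiv_const]
        simp [ha₁0 x hxS, ha₂0 x hxS, e1, hψS x hxS, dotProduct]
    rw [integral_sub hi₁ (hi₂.const_mul C), integral_const_mul] at hle
    linarith
  set A : ℝ := 2 ^ (n + 1) * σ ^ n with hA
  have hA0 : 0 ≤ A := by positivity
  calc ∫⁻ x in {x | flatDist (f x₀) u x₀ x < σ}, ENNReal.ofReal (ψ x) ∂(graphVolume f u Ω)
      = ∫⁻ x, {x | flatDist (f x₀) u x₀ x < σ}.indicator (fun x => ENNReal.ofReal (ψ x)) x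
          ∂(graphVolume f u Ω) :=
        (lintegral_indicator₀ (h.nullMeasurableSet_flatDist_lt _ _) _).symm
    _ ≤ ∫⁻ x, ENNReal.ofReal A * ENNReal.ofReal (a₁ x) ∂(graphVolume f u Ω) := by
        refine lintegral_mono fun x => ?_
        by_cases hx : flatDist (f x₀) u x₀ x < σ
        · rw [Set.indicator_of_mem (by exact hx), ← ENNReal.ofReal_mul hA0]
          apply ENNReal.ofReal_le_ofReal
          have := mul_le_mul_of_nonneg_left
            (le_kernelPow_of_flatDist_lt (f := f) (u := u) hn hσ hx) (hψ0 x)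
          simp only [ha₁]
          linarith
        · rw [Set.indicator_of_notMem (by exact hx)]
          exact zero_le
    _ = ENNReal.ofReal A * ENNReal.ofReal (∫ x, √(graphMetric f u x).det * a₁ x) := by
        rw [lintegral_const_mul' _ _ ENNReal.ofReal_ne_top,
          h.lintegral_ofReal_graphVolume hSU hS ha₁c ha₁0 ha₁nn]
    _ ≤ ENNReal.ofReal A * ENNReal.ofReal (C * ∫ x, √(graphMetric f u x).det * a₂ x) := by
        gcongr
    _ = ENNReal.ofReal (2 ^ (n + 1) * C * σ ^ n) *
          ∫⁻ x, ENNReal.ofReal (a₂ x) ∂(graphVolume f u Ω) := by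
        rw [h.lintegral_ofReal_graphVolume hSU hS ha₂c ha₂0 ha₂nn, ENNReal.ofReal_mul hC0,
          ← mul_assoc, ← ENNReal.ofReal_mul hA0]
        congr 2
        rw [hA]; ring
    _ ≤ _ := by
        gcongr with x
        rw [← ENNReal.ofReal_mul (by have := flatDist_nonneg (f x₀) u x₀ x; positivity)]
        apply ENNReal.ofReal_le_ofReal
        exact mul_le_mul_of_nonneg_right (kernelPow_mul_flatDist_le σ)
          (energyDensity_nonneg (hψ0 x))

/-! ### Densities -/

/-- The density ratios of `ψ` are bounded. The bound depends on `u` and `ψ`; it is used only to know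
that their supremum is finite, so that it can be absorbed. -/
lemma exists_lintegral_le_pow (h : IsAdmissible k Ω U u f) (hSU : S ⊆ U) (hS : IsCompact S)
    (hψ : ContDiff ℝ 1 ψ) (hψS : ∀ x, x ∉ S → ψ x = 0) (hx₀ : x₀ ∈ U) :
    ∃ M : ℝ, ∀ σ, 0 < σ → ∫⁻ x in {x | flatDist (f x₀) u x₀ x < σ}, ENNReal.ofReal (ψ x)
      ∂(graphVolume f u Ω) ≤ ENNReal.ofReal (M * σ ^ n) := by
  have hc := h.continuous_sqrt_det_mul hSU hS hψ.continuous.continuousOn hψS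
  obtain ⟨B, hB⟩ := hc.bounded_above_of_compact_support
    (HasCompactSupport.intro hS fun x hx => by rw [hψS x hx, mul_zero])
  have hB0 : 0 ≤ B := (norm_nonneg _).trans (hB x₀)
  refine ⟨B * (volume (Metric.ball (0 : EuclideanSpace ℝ (Fin n)) 1)).toReal, fun σ hσ => ?_⟩
  rw [← lintegral_indicator₀ (h.nullMeasurableSet_flatDist_lt _ _), h.lintegral_graphVolume]
  calc ∫⁻ x in Ω, ENNReal.ofReal (√(graphMetric f u x).det) *
        {x | flatDist (f x₀) u x₀ x < σ}.indicator (fun x => ENNReal.ofReal (ψ x)) x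
      ≤ ∫⁻ x in Ω, (Metric.ball x₀ σ).indicator (fun _ => ENNReal.ofReal B) x := by
        refine lintegral_mono fun x => ?_
        by_cases hx : flatDist (f x₀) u x₀ x < σ
        · have hxb : x ∈ Metric.ball x₀ σ := by
            rw [mem_ball_iff_norm]
            exact (norm_sub_le_flatDist (h.one_le_weight x₀ (h.subset_domain hx₀)) u x₀ x).trans_lt hx
          rw [Set.indicator_of_mem (by exact hx), Set.indicator_of_mem hxb,
            ← ENNReal.ofReal_mul (Real.sqrt_nonneg _)]
          exact ENNReal.ofReal_le_ofReal ((le_abs_self _).trans (hB x))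
        · rw [Set.indicator_of_notMem (by exact hx), mul_zero]
          exact zero_le
    _ ≤ ∫⁻ x, (Metric.ball x₀ σ).indicator (fun _ => ENNReal.ofReal B) x :=
        setLIntegral_le_lintegral _ _
    _ = ENNReal.ofReal (B * (volume (Metric.ball (0 : EuclideanSpace ℝ (Fin n)) 1)).toReal *
          σ ^ n) := by
        rw [lintegral_indicator measurableSet_ball, setLIntegral_const,
          Measure.addHaar_ball_of_pos _ _ hσ, finrank_euclideanSpace_fin, mul_assoc,
          ENNReal.ofReal_mul hB0, ENNReal.ofReal_mul ENNReal.toReal_nonneg,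
          ENNReal.ofReal_toReal measure_ball_lt_top.ne, mul_comm (volume _)]

/-- A lower bound for the density ratios at small scales: near `x₀` the graph is close to its
tangent plane, over which the ball of radius `σ` is an ellipsoid of volume `σ ^ n / √(det g)` times that of
the unit ball. -/
lemma exists_pow_le_lintegral (h : IsAdmissible k Ω U u f) (hψ : ContDiff ℝ 1 ψ) (hx₀ : x₀ ∈ U)
    (hψ1 : 1 ≤ ψ x₀) :
    ∃ σ, 0 < σ ∧ ENNReal.ofReal
      ((volume (Metric.ball (0 : EuclideanSpace ℝ (Fin n)) 1)).toReal / 2 ^ (n + 1) * σ ^ n) ≤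
      ∫⁻ x in {x | flatDist (f x₀) u x₀ x < σ}, ENNReal.ofReal (ψ x) ∂(graphVolume f u Ω) := by
  have hx₀Ω := h.subset_domain hx₀
  have hf1 := h.one_le_weight x₀ hx₀Ω
  have hg := posDef_graphMetric (u := u) hf1
  obtain ⟨B, hB⟩ := hg.posSemidef.exists_eq_transpose_mul_self
  set w₀ := √(graphMetric f u x₀).det with hw₀
  have hw₀pos : 0 < w₀ := Real.sqrt_pos.2 hg.det_pos
  have hdetB : |B.det| = w₀ := by
    rw [hw₀, hB, det_mul, det_transpose, Real.sqrt_mul_self_eq_abs]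
  set L := Matrix.toLpLin 2 2 B with hL
  have hLdet : LinearMap.det L = B.det := by
    rw [hL, Matrix.toLpLin_eq_toLin]
    exact LinearMap.det_toLin _ _
  have hLnorm : ∀ v, ‖L v‖ ^ 2 = f x₀ ^ 2 * ∑ a, v a ^ 2 +
      ∑ a, ((hess u x₀)ᵀ *ᵥ v.ofLp) a ^ 2 := by
    intro v
    have e1 : ‖L v‖ ^ 2 = (B *ᵥ v.ofLp) ⬝ᵥ (B *ᵥ v.ofLp) := by
      rw [EuclideanSpace.real_norm_sq_eq]
      simp only [dotProduct, ← sq]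
      rfl
    rw [e1, ← dotProduct_transpose_mul_self_mulVec, ← hB, graphMetric,
      dotProduct_graphMetric_mulVec]
    simp only [dotProduct, sq]
  have hLge : ∀ v, ‖v‖ ≤ ‖L v‖ := by
    intro v
    refine le_of_sq_le_sq ?_ (norm_nonneg _)
    rw [hLnorm, EuclideanSpace.real_norm_sq_eq]
    have h1 : 0 ≤ ∑ a, ((hess u x₀)ᵀ *ᵥ v.ofLp) a ^ 2 := by positivity
    have h2 : 0 ≤ ∑ a, v a ^ 2 := by positivity
    have h3 := le_mul_of_one_le_left h2 (one_le_pow₀ (n := 2) hf1)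
    linarith
  -- first-order expansion of the gradient at `x₀`
  have hexp : ∀ a, ∀ᶠ x in 𝓝 x₀, |pderiv a u x - pderiv a u x₀ -
      ((hess u x₀)ᵀ *ᵥ (x - x₀).ofLp) a| ≤ 1 / ((n : ℝ) + 1) * ‖x - x₀‖ := by
    intro a
    have hd : HasFDerivAt (fun y => pderiv a u y) (fderiv ℝ (fun y => pderiv a u y) x₀) x₀ :=
      ((contDiffOn_pderiv (m := 1) h.isOpen_domain h.contDiffOn_potential
        (by norm_num)).differentiableAt_of_isOpen h.isOpen_domain hx₀Ω).hasFDerivAt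
    have e : ∀ v : EuclideanSpace ℝ (Fin n), fderiv ℝ (fun y => pderiv a u y) x₀ v =
        ((hess u x₀)ᵀ *ᵥ v.ofLp) a := by
      intro v
      have hv : v = ∑ i, v i • EuclideanSpace.single i (1 : ℝ) := by
        ext c
        simp [Pi.single_apply]
      conv_lhs => rw [hv]
      rw [map_sum]
      simp only [map_smul, smul_eq_mul, mulVec, dotProduct, transpose_apply]
      exact Finset.sum_congr rfl fun i _ => mul_comm _ _
    have := hd.isLittleO.def (by positivity : 0 < 1 / ((n : ℝ) + 1))
    filter_upwards [this] with x hx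
    rwa [e, Real.norm_eq_abs] at hx
  have hcont : ContinuousAt (fun x => √(graphMetric f u x).det * ψ x) x₀ :=
    (h.continuousOn_sqrt_det.continuousAt (h.isOpen_domain.mem_nhds hx₀Ω)).mul
      hψ.continuous.continuousAt
  have hev : ∀ᶠ x in 𝓝 x₀, x ∈ Ω ∧ w₀ / 2 ≤ √(graphMetric f u x).det * ψ x ∧
      ∀ a, |pderiv a u x - pderiv a u x₀ -
        ((hess u x₀)ᵀ *ᵥ (x - x₀).ofLp) a| ≤ 1 / ((n : ℝ) + 1) * ‖x - x₀‖ := by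
    refine Filter.Eventually.and (h.isOpen_domain.mem_nhds hx₀Ω) (Filter.Eventually.and ?_
      (Filter.eventually_all.2 hexp))
    have : w₀ / 2 < √(graphMetric f u x₀).det * ψ x₀ := by
      rw [← hw₀]; nlinarith
    exact (hcont.eventually_const_lt this).mono fun x hx => hx.le
  obtain ⟨σ, hσ, hball⟩ := Metric.eventually_nhds_iff_ball.1 hev
  refine ⟨σ, hσ, ?_⟩
  set E : Set (EuclideanSpace ℝ (Fin n)) :=
    (fun x => x - x₀) ⁻¹' (L ⁻¹' Metric.ball 0 (σ / 2)) with hE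
  have hEm : MeasurableSet E := by
    have hLc : Continuous L := L.continuous_of_finiteDimensional
    exact ((Metric.isOpen_ball.preimage hLc).preimage (continuous_id.sub
      continuous_const)).measurableSet
  have hEvol : volume E = ENNReal.ofReal (w₀⁻¹ * (σ / 2) ^ n) *
      volume (Metric.ball (0 : EuclideanSpace ℝ (Fin n)) 1) := by
    simp_rw [hE, sub_eq_add_neg]
    rw [measure_preimage_add_right]
    have hdet : LinearMap.det L ≠ 0 := by
      rw [hLdet, ← abs_pos, hdetB]; exact hw₀pos
    rw [Measure.addHaar_preimage_linearMap _ hdet, hLdet, abs_inv, hdetB,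
      Measure.addHaar_ball_of_pos _ _ (by positivity), finrank_euclideanSpace_fin,
      ENNReal.ofReal_mul (by positivity), mul_assoc]
  have hin : ∀ x ∈ E, x ∈ Ω ∧ flatDist (f x₀) u x₀ x < σ ∧
      w₀ / 2 ≤ √(graphMetric f u x).det * ψ x := by
    intro x hx
    have hLx : ‖L (x - x₀)‖ < σ / 2 := by simpa [hE] using hx
    have hxball : x ∈ Metric.ball x₀ σ := by
      rw [mem_ball_iff_norm]
      have := hLge (x - x₀)
      linarith
    obtain ⟨b1, b2, b3⟩ := hball x hxball
    refine ⟨b1, ?_, b2⟩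
    have hle : flatDist (f x₀) u x₀ x ≤ 2 * ‖L (x - x₀)‖ := by
      refine le_of_sq_le_sq ?_ (by positivity)
      rw [mul_pow, hLnorm, flatDist_sq]
      have hcomp : ∀ a, (pderiv a u x - pderiv a u x₀) ^ 2 ≤
          2 * ((hess u x₀)ᵀ *ᵥ (x - x₀).ofLp) a ^ 2 +
            2 * (1 / ((n : ℝ) + 1) * ‖x - x₀‖) ^ 2 := by
        intro a
        have h1 := sq_le_sq' (neg_le_of_abs_le (b3 a)) (le_of_abs_le (b3 a))
        nlinarith [sq_nonneg (pderiv a u x - pderiv a u x₀ -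
          2 * ((hess u x₀)ᵀ *ᵥ (x - x₀).ofLp) a)]
      have hsum := Finset.sum_le_sum fun a (_ : a ∈ Finset.univ) => hcomp a
      rw [Finset.sum_add_distrib, ← Finset.mul_sum, Finset.sum_const, Finset.card_univ,
        Fintype.card_fin, nsmul_eq_mul] at hsum
      have hnorm : ‖x - x₀‖ ^ 2 = ∑ a, (x a - x₀ a) ^ 2 := by
        rw [EuclideanSpace.real_norm_sq_eq]
        simp only [PiLp.sub_apply]
      have hsmall : (n : ℝ) * (2 * (1 / ((n : ℝ) + 1) * ‖x - x₀‖) ^ 2) ≤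
          2 * ∑ a, (x a - x₀ a) ^ 2 := by
        rw [← hnorm, mul_pow]
        have hn0 : (0 : ℝ) ≤ n := Nat.cast_nonneg n
        have : (n : ℝ) * (1 / ((n : ℝ) + 1)) ^ 2 ≤ 1 := by
          rw [div_pow, one_pow, mul_one_div, div_le_one (by positivity)]
          nlinarith
        nlinarith [sq_nonneg ‖x - x₀‖]
      have h2 : 0 ≤ ∑ a, (x a - x₀ a) ^ 2 := by positivity
      have h3 := le_mul_of_one_le_left h2 (one_le_pow₀ (n := 2) hf1)
      have h4 : 0 ≤ ∑ a, ((hess u x₀)ᵀ *ᵥ (x - x₀).ofLp) a ^ 2 := by positivity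
      simp only [PiLp.sub_apply] at hsum ⊢
      linarith
    linarith
  rw [← lintegral_indicator₀ (h.nullMeasurableSet_flatDist_lt _ _), h.lintegral_graphVolume,
    ← lintegral_indicator h.isOpen_domain.measurableSet]
  calc ENNReal.ofReal
        ((volume (Metric.ball (0 : EuclideanSpace ℝ (Fin n)) 1)).toReal / 2 ^ (n + 1) * σ ^ n)
      = ENNReal.ofReal (w₀ / 2) * volume E := by
        rw [hEvol, ← mul_assoc, ← ENNReal.ofReal_mul (by positivity)]
        conv_rhs => rw [← ENNReal.ofReal_toReal (measure_ball_lt_top (μ := volume)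
          (x := (0 : EuclideanSpace ℝ (Fin n))) (r := 1)).ne]
        rw [← ENNReal.ofReal_mul (by positivity)]
        congr 1
        rw [div_pow, pow_succ]
        field_simp
    _ = ∫⁻ x, E.indicator (fun _ => ENNReal.ofReal (w₀ / 2)) x := by
        rw [lintegral_indicator hEm, setLIntegral_const]
    _ ≤ _ := by
        refine lintegral_mono fun x => ?_
        by_cases hx : x ∈ E
        · obtain ⟨b1, b2, b3⟩ := hin x hx
          rw [Set.indicator_of_mem hx, Set.indicator_of_mem b1, Set.indicator_of_mem (by exact b2),
            ← ENNReal.ofReal_mul (Real.sqrt_nonneg _)]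
          exact ENNReal.ofReal_le_ofReal b3
        · rw [Set.indicator_of_notMem hx]
          exact zero_le

end IsAdmissible

/-! ### The weak-type inequality on the gradient graph -/

lemma dist_gradGraph_le_flatDist {n : ℕ} {f₀ : ℝ} (hf₀ : 1 ≤ f₀)
    (u : EuclideanSpace ℝ (Fin n) → ℝ) (x₀ x : EuclideanSpace ℝ (Fin n)) :
    dist (gradGraph u x) (gradGraph u x₀) ≤ flatDist f₀ u x₀ x := by
  have h1 : 0 ≤ ∑ a, (pderiv a u x - pderiv a u x₀) ^ 2 := by positivity
  have h2 : 0 ≤ ∑ a, (x a - x₀ a) ^ 2 := by positivity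
  have h3 := le_mul_of_one_le_left h2 (one_le_pow₀ (n := 2) hf₀)
  refine (dist_pi_le_iff (flatDist_nonneg _ _ _ _)).2 fun c => ?_
  rw [Real.dist_eq]
  refine abs_le_of_sq_le_sq ?_ (flatDist_nonneg _ _ _ _)
  rw [flatDist_sq]
  rcases c with c | c
  · have : (x c - x₀ c) ^ 2 ≤ ∑ a, (x a - x₀ a) ^ 2 :=
      Finset.single_le_sum (f := fun a => (x a - x₀ a) ^ 2) (fun a _ => sq_nonneg _)
        (Finset.mem_univ c)
    simp only [gradGraph, Sum.elim_inl]
    linarith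
  · have : (pderiv c u x - pderiv c u x₀) ^ 2 ≤ ∑ a, (pderiv a u x - pderiv a u x₀) ^ 2 :=
      Finset.single_le_sum (f := fun a => (pderiv a u x - pderiv a u x₀) ^ 2)
        (fun a _ => sq_nonneg _) (Finset.mem_univ c)
    simp only [gradGraph, Sum.elim_inr]
    linarith

/-- The distance frozen at `x₀` is comparable with the fixed metric of the ambient coordinate space,
in which the covering lemma is applied. -/
lemma flatDist_le_mul_dist_gradGraph {n : ℕ} {k f₀ : ℝ} (hf₀ : 1 ≤ f₀) (hk : f₀ ≤ k)
    (u : EuclideanSpace ℝ (Fin n) → ℝ) (x₀ x : EuclideanSpace ℝ (Fin n)) :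
    flatDist f₀ u x₀ x ≤ (2 * n * k + 1) * dist (gradGraph u x) (gradGraph u x₀) := by
  set d := dist (gradGraph u x) (gradGraph u x₀) with hd
  have hd0 : 0 ≤ d := dist_nonneg
  have hk1 : 1 ≤ k := hf₀.trans hk
  have hcoord : ∀ c, (gradGraph u x c - gradGraph u x₀ c) ^ 2 ≤ d ^ 2 := fun c => by
    rw [← sq_abs]
    exact pow_le_pow_left₀ (abs_nonneg _) (dist_le_pi_dist (gradGraph u x) (gradGraph u x₀) c) 2
  have h1 : ∑ a, (x a - x₀ a) ^ 2 ≤ n * d ^ 2 := by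
    refine (Finset.sum_le_sum fun a _ => hcoord (Sum.inl a)).trans ?_
    simp
  have h2 : ∑ a, (pderiv a u x - pderiv a u x₀) ^ 2 ≤ n * d ^ 2 := by
    refine (Finset.sum_le_sum fun a _ => hcoord (Sum.inr a)).trans ?_
    simp
  refine le_of_sq_le_sq ?_ (by positivity)
  rw [flatDist_sq]
  have hf2 : f₀ ^ 2 ≤ k ^ 2 := by gcongr
  have hk2 : 1 ≤ k ^ 2 := one_le_pow₀ hk1
  have hn2 : (n : ℝ) ≤ (n : ℝ) ^ 2 := by exact_mod_cast Nat.le_self_pow (by norm_num) n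
  have hnd : 0 ≤ (n : ℝ) * d ^ 2 := by positivity
  calc f₀ ^ 2 * ∑ a, (x a - x₀ a) ^ 2 + ∑ a, (pderiv a u x - pderiv a u x₀) ^ 2
      ≤ k ^ 2 * (n * d ^ 2) + 1 * (n * d ^ 2) := by
        rw [one_mul]; gcongr
    _ ≤ k ^ 2 * (n * d ^ 2) + k ^ 2 * (n * d ^ 2) := by gcongr
    _ = 2 * k ^ 2 * n * d ^ 2 := by ring
    _ ≤ 2 * k ^ 2 * n ^ 2 * d ^ 2 := by gcongr
    _ ≤ (4 * k ^ 2 * n ^ 2 + 4 * n * k + 1) * d ^ 2 := by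
        gcongr
        have : 0 ≤ k ^ 2 * (n : ℝ) ^ 2 := by positivity
        have : 0 ≤ (n : ℝ) * k := by positivity
        linarith
    _ = _ := by ring

/-- The constant in the monotonicity inequality. -/
def monotonicityConst (n : ℕ) (k : ℝ) : ℝ :=
  2 ^ (n + 1) * ((5 * k ^ 3 + 2 * n * k ^ 2 + 1) * (n + 1))

/-- The constant in the weak-type inequality. -/
def weakTypeConst (n : ℕ) (k : ℝ) : ℝ :=
  monotonicityConst n k * 2 ^ (n + 1) * (6 * (2 * n * k + 1)) ^ n *
    (4 * monotonicityConst n k /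
      ((volume (Metric.ball (0 : EuclideanSpace ℝ (Fin n)) 1)).toReal / 2 ^ (n + 1))) ^
        (1 / ((n : ℝ) - 1))

lemma unitBall_volume_pos (n : ℕ) :
    0 < (volume (Metric.ball (0 : EuclideanSpace ℝ (Fin n)) 1)).toReal :=
  ENNReal.toReal_pos (Metric.measure_ball_pos _ _ one_pos).ne' measure_ball_lt_top.ne

lemma monotonicityConst_pos (n : ℕ) {k : ℝ} (hk : 1 ≤ k) : 0 < monotonicityConst n k := by
  unfold monotonicityConst; positivity

lemma weakTypeConst_pos (n : ℕ) {k : ℝ} (hk : 1 ≤ k) : 0 < weakTypeConst n k := by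
  have h1 := monotonicityConst_pos n hk
  have h2 := unitBall_volume_pos n
  unfold weakTypeConst
  positivity

namespace IsAdmissible

variable {n : ℕ} {k : ℝ} {Ω U S : Set (EuclideanSpace ℝ (Fin n))}
  {u f ψ φ : EuclideanSpace ℝ (Fin n) → ℝ}

/-- The weak-type inequality for the energy on the gradient graph. -/
theorem measure_le_rpow_energy (h : IsAdmissible k Ω U u f) (hSU : S ⊆ U) (hS : IsCompact S)
    (hn : 2 ≤ n) (hψ : ContDiff ℝ 1 ψ) (hψS : ∀ x, x ∉ S → ψ x = 0) (hψ0 : ∀ x, 0 ≤ ψ x) :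
    graphVolume f u Ω {x | 1 ≤ ψ x} ≤ ENNReal.ofReal (weakTypeConst n k) *
      (∫⁻ x, ENNReal.ofReal (energyDensity f u ψ x) ∂(graphVolume f u Ω)) ^
        ((n : ℝ) / ((n : ℝ) - 1)) := by
  have hk := h.one_le_bound
  have hU : ∀ x ∈ {x | 1 ≤ ψ x}, x ∈ U := fun x hx => by
    by_contra hxU
    have h0 := hψS x fun h' => hxU (hSU h')
    have h1 : 1 ≤ ψ x := hx
    linarith
  have hf : ∀ x ∈ {x | 1 ≤ ψ x}, 1 ≤ f x := fun x hx =>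
    h.one_le_weight x (h.subset_domain (hU x hx))
  refine measure_le_rpow_lintegral (F := gradGraph u) (r := fun x₀ x => flatDist (f x₀) u x₀ x)
    (ψ := fun x => ENNReal.ofReal (ψ x)) hn
    (div_pos (unitBall_volume_pos n) (by positivity)) (monotonicityConst_pos n hk)
    (by have : 0 ≤ 2 * (n : ℝ) * k := by positivity
        linarith)
    (fun x₀ _ => (h.continuousOn_flatDist _).aemeasurable_graphVolume h.isOpen_domain)
    hψ.continuous.measurable.ennreal_ofReal.aemeasurable
    ((h.continuousOn_energyDensity hψ).aemeasurable_graphVolume h.isOpen_domain).ennreal_ofReal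
    (fun x₀ hx₀ x => dist_gradGraph_le_flatDist (hf x₀ hx₀) u x₀ x)
    (fun x₀ hx₀ x => flatDist_le_mul_dist_gradGraph (hf x₀ hx₀) (h.weight_le x₀ (hU x₀ hx₀)) u x₀ x)
    (fun x hx => ENNReal.one_le_ofReal.2 hx)
    (fun x₀ hx₀ σ hσ => h.lintegral_le_kernel hSU hS (by omega) hψ hψS hψ0 (hU x₀ hx₀) hσ)
    (fun x₀ hx₀ => h.exists_lintegral_le_pow hSU hS hψ hψS (hU x₀ hx₀))
    (fun x₀ hx₀ => h.exists_pow_le_lintegral hψ (hU x₀ hx₀) hx₀)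

end IsAdmissible

/-! ### The Sobolev inequality -/

/-- A smooth nondecreasing step, equal to `0` below `1` and to `1` above `2`. -/
lemma exists_smooth_step : ∃ (γ : ℝ → ℝ) (c : ℝ), ContDiff ℝ 1 γ ∧ 1 ≤ c ∧ (∀ s, 0 ≤ γ s) ∧
    (∀ s, γ s ≤ 1) ∧ (∀ s, s ≤ 1 → γ s = 0) ∧ (∀ s, 2 ≤ s → γ s = 1) ∧
    (∀ s, |deriv γ s| ≤ c) ∧ ∀ s, s ∉ Set.Icc (1 : ℝ) 2 → deriv γ s = 0 := by
  set γ : ℝ → ℝ := fun s => Real.smoothTransition (s - 1) with hγ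
  have hsm : ContDiff ℝ 1 γ := Real.smoothTransition.contDiff.comp (contDiff_id.sub contDiff_const)
  have h0 : ∀ s, s ≤ 1 → γ s = 0 := fun s hs =>
    Real.smoothTransition.zero_of_nonpos (by linarith)
  have h1 : ∀ s, 2 ≤ s → γ s = 1 := fun s hs =>
    Real.smoothTransition.one_of_one_le (by linarith)
  have hd : ∀ s, s ∉ Set.Icc (1 : ℝ) 2 → deriv γ s = 0 := by
    intro s hs
    rcases lt_or_ge s 1 with h | h
    · have : γ =ᶠ[𝓝 s] fun _ => 0 := by
        filter_upwards [Iio_mem_nhds h] with y hy using h0 y (le_of_lt hy)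
      rw [this.deriv_eq, deriv_const]
    · have h2 : 2 < s := not_le.1 fun h' => hs ⟨h, h'⟩
      have : γ =ᶠ[𝓝 s] fun _ => 1 := by
        filter_upwards [Ioi_mem_nhds h2] with y hy using h1 y (le_of_lt hy)
      rw [this.deriv_eq, deriv_const]
  obtain ⟨c, hc⟩ := (hsm.continuous_deriv (by norm_num)).bounded_above_of_compact_support
    (HasCompactSupport.intro isCompact_Icc hd)
  exact ⟨γ, max c 1, hsm, le_max_right _ _, fun s => Real.smoothTransition.nonneg _,
    fun s => Real.smoothTransition.le_one _, h0, h1, fun s => (hc s).trans (le_max_left _ _), hd⟩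

lemma gradNorm_comp {n : ℕ} {f u φ : EuclideanSpace ℝ (Fin n) → ℝ} {β : ℝ → ℝ} {β' : ℝ}
    {x : EuclideanSpace ℝ (Fin n)} (hβ : HasDerivAt β β' (φ x)) (hφ : DifferentiableAt ℝ φ x) :
    gradNorm (weightedMetric f) (gradGraph u) (fun y => β (φ y)) x =
      |β'| * gradNorm (weightedMetric f) (gradGraph u) φ x := by
  rw [gradNorm, gradNorm, ← Real.sqrt_sq_eq_abs, ← Real.sqrt_mul (sq_nonneg _), Finset.mul_sum]
  congr 1
  refine Finset.sum_congr rfl fun i _ => ?_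
  rw [Finset.mul_sum]
  refine Finset.sum_congr rfl fun j _ => ?_
  rw [pderiv_comp hβ hφ, pderiv_comp hβ hφ]
  ring

lemma measurable_indicator_ofReal {n : ℕ} {Ω : Set (EuclideanSpace ℝ (Fin n))}
    {a : EuclideanSpace ℝ (Fin n) → ℝ} (hΩ : IsOpen Ω) (ha : ContinuousOn a Ω) :
    Measurable (Ω.indicator fun x => ENNReal.ofReal (a x)) := by
  classical
  rw [← Set.piecewise_eq_indicator]
  exact ContinuousOn.measurable_piecewise (ENNReal.continuous_ofReal.comp_continuousOn ha)
    continuousOn_const hΩ.measurableSet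

instance {n : ℕ} (f u : EuclideanSpace ℝ (Fin n) → ℝ) (Ω : Set (EuclideanSpace ℝ (Fin n))) :
    SFinite (graphVolume f u Ω) := by
  unfold graphVolume volumeMeasure
  infer_instance

/-- The Michael–Simon Sobolev inequality on the gradient graph, in terms of lower integrals. -/
theorem exists_lintegral_rpow_le (n : ℕ) (hn : 2 ≤ n) {k : ℝ} (hk : 1 ≤ k) :
    ∃ C : ℝ, 0 < C ∧ ∀ {Ω U S : Set (EuclideanSpace ℝ (Fin n))}
      {u f φ : EuclideanSpace ℝ (Fin n) → ℝ}, IsAdmissible k Ω U u f → S ⊆ U → IsCompact S →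
      ContDiff ℝ 1 φ → (∀ x, 0 ≤ φ x) → (∀ x, x ∉ S → φ x = 0) →
      ∫⁻ x, ENNReal.ofReal (φ x ^ ((n : ℝ) / ((n : ℝ) - 1))) ∂(graphVolume f u Ω) ≤
        ENNReal.ofReal C * (∫⁻ x, ENNReal.ofReal (energyDensity f u φ x) ∂(graphVolume f u Ω)) ^
          ((n : ℝ) / ((n : ℝ) - 1)) := by
  obtain ⟨γ, c, hγ, hc, hγ0, hγ1, hγz, hγo, hγd, hγd0⟩ := exists_smooth_step
  have hn' : (2 : ℝ) ≤ n := by exact_mod_cast hn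
  set p : ℝ := (n : ℝ) / ((n : ℝ) - 1) with hp
  have hp1 : 1 ≤ p := by rw [hp, one_le_div (by linarith)]; linarith
  have hW := weakTypeConst_pos n hk
  refine ⟨2 ^ p * p * weakTypeConst n k * c ^ p, by positivity, ?_⟩
  intro Ω U S u f φ h hSU hS hφ hφ0 hφS
  -- the restriction to `Ω` makes these functions measurable; outside `Ω` they are uncontrolled
  set D : EuclideanSpace ℝ (Fin n) → ℝ≥0∞ := Ω.indicator fun x =>
    ENNReal.ofReal (gradNorm (weightedMetric f) (gradGraph u) φ x) with hD
  set w : EuclideanSpace ℝ (Fin n) → ℝ := fun x =>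
    meanCurvatureNorm (weightedMetric f) (gradGraph u) x +
      √(traceInv (weightedMetric f) (gradGraph u) x) with hw
  have hw0 : ∀ x, 0 ≤ w x := fun x => add_nonneg (Real.sqrt_nonneg _) (Real.sqrt_nonneg _)
  have hG0 : ∀ x, 0 ≤ gradNorm (weightedMetric f) (gradGraph u) φ x := fun x => Real.sqrt_nonneg _
  have hwc : ContinuousOn w Ω := h.continuousOn_meanCurvatureNorm.add h.continuousOn_traceInv.sqrt
  have hweak : ∀ t, 0 < t → graphVolume f u Ω {x | 2 * t ≤ φ x} ≤
      ENNReal.ofReal (weakTypeConst n k) *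
        (∫⁻ x, truncEnergy c φ D (Ω.indicator fun x => ENNReal.ofReal (w x)) t x
          ∂(graphVolume f u Ω)) ^ p := by
    intro t ht
    have hψ : ContDiff ℝ 1 fun x => γ (φ x / t) := hγ.comp (hφ.div_const t)
    have hψS : ∀ x, x ∉ S → γ (φ x / t) = 0 := fun x hx => by
      rw [hφS x hx, zero_div, hγz 0 zero_le_one]
    have hmeas := h.measure_le_rpow_energy hSU hS hn hψ hψS (fun x => hγ0 _)
    refine (measure_mono ?_).trans (hmeas.trans ?_)
    · intro x hx
      have : 2 ≤ φ x / t := by rw [le_div_iff₀ ht]; exact hx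
      exact (hγo _ this).ge
    gcongr with x
    by_cases hxS : x ∈ S
    · have hxΩ : x ∈ Ω := h.subset_domain (hSU hxS)
      have hd : HasDerivAt (fun s => γ (s / t)) (deriv γ (φ x / t) * (1 / t)) (φ x) :=
        HasDerivAt.comp (φ x) ((hγ.differentiable (by norm_num)) _).hasDerivAt
          ((hasDerivAt_id (φ x)).div_const t)
      have he : energyDensity f u (fun x => γ (φ x / t)) x =
          gradNorm (weightedMetric f) (gradGraph u) (fun x => γ (φ x / t)) x +
            γ (φ x / t) * w x := rfl
      rw [he, gradNorm_comp hd (hφ.differentiable (by norm_num) x), truncEnergy, hD,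
        Set.indicator_of_mem hxΩ, Set.indicator_of_mem hxΩ,
        ENNReal.ofReal_add (mul_nonneg (abs_nonneg _) (hG0 x))
          (mul_nonneg (hγ0 _) (hw0 x))]
      refine add_le_add ?_ ?_
      · split_ifs with hx
        · rw [← ENNReal.ofReal_mul (by positivity), abs_mul, abs_of_pos (one_div_pos.2 ht),
            mul_one_div]
          apply ENNReal.ofReal_le_ofReal
          have := hγd (φ x / t)
          have h2 := hG0 x
          gcongr
        · rw [hγd0 _ fun h' => hx ⟨(one_le_div ht).1 h'.1, (div_le_iff₀ ht).1 h'.2⟩]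
          simp
      · split_ifs with hx
        · exact ENNReal.ofReal_le_ofReal (mul_le_of_le_one_left (hw0 x) (hγ1 _))
        · rw [hγz _ ((div_le_one ht).2 (not_lt.1 hx))]
          simp
    · rw [IsAdmissible.energyDensity_eq_zero hS hψS hxS]
      simp
  have hmain := lintegral_rpow_le_of_truncation hp1 hc hφ0 hφ.continuous.measurable
    (measurable_indicator_ofReal h.isOpen_domain (h.continuousOn_gradNorm hφ))
    (measurable_indicator_ofReal h.isOpen_domain hwc) hweak
  refine hmain.trans ?_
  rw [ENNReal.mul_rpow_of_nonneg _ _ (by linarith), ENNReal.ofReal_rpow_of_pos (by linarith),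
    ← mul_assoc, ← ENNReal.ofReal_mul (by positivity), ← ENNReal.ofReal_mul (by positivity)]
  gcongr with x
  have he : energyDensity f u φ x =
      gradNorm (weightedMetric f) (gradGraph u) φ x + φ x * w x := rfl
  rw [he, ENNReal.ofReal_add (hG0 x) (mul_nonneg (hφ0 x) (hw0 x)),
    ENNReal.ofReal_mul (hφ0 x)]
  gcongr
  · exact Set.indicator_le_self _ _ _
  · exact Set.indicator_le_self _ _ _

lemma IsAdmissible.ofReal_integral_graphVolume {n : ℕ} {k : ℝ}
    {Ω U S : Set (EuclideanSpace ℝ (Fin n))} {u f a : EuclideanSpace ℝ (Fin n) → ℝ}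
    (h : IsAdmissible k Ω U u f) (hSU : S ⊆ U) (hS : IsCompact S)
    (ha : ContinuousOn a U) (ha0 : ∀ x, x ∉ S → a x = 0) (hann : ∀ x, 0 ≤ a x) :
    ENNReal.ofReal (∫ x, a x ∂(graphVolume f u Ω)) =
      ∫⁻ x, ENNReal.ofReal (a x) ∂(graphVolume f u Ω) := by
  rw [integral_eq_lintegral_of_nonneg_ae (Filter.Eventually.of_forall hann)
    (continuous_of_continuousOn_of_eq_zero h.isOpen_subset hSU hS ha ha0).aestronglyMeasurable,
    ENNReal.ofReal_toReal]
  rw [h.lintegral_ofReal_graphVolume hSU hS ha ha0 hann]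
  exact ENNReal.ofReal_ne_top

/-- The Michael–Simon Sobolev inequality on the gradient graph. -/
theorem exists_integral_rpow_le (n : ℕ) (hn : 2 ≤ n) {k : ℝ} (hk : 1 ≤ k) :
    ∃ C : ℝ, 0 < C ∧ ∀ {Ω U S : Set (EuclideanSpace ℝ (Fin n))}
      {u f φ : EuclideanSpace ℝ (Fin n) → ℝ}, IsAdmissible k Ω U u f → S ⊆ U → IsCompact S →
      ContDiff ℝ 1 φ → (∀ x, 0 ≤ φ x) → (∀ x, x ∉ S → φ x = 0) →
      (∫ x, φ x ^ ((n : ℝ) / ((n : ℝ) - 1)) ∂(graphVolume f u Ω)) ^ (((n : ℝ) - 1) / (n : ℝ)) ≤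
        C * ∫ x, energyDensity f u φ x ∂(graphVolume f u Ω) := by
  obtain ⟨C, hC, hmain⟩ := exists_lintegral_rpow_le n hn hk
  have hn' : (2 : ℝ) ≤ n := by exact_mod_cast hn
  refine ⟨C ^ (((n : ℝ) - 1) / (n : ℝ)), by positivity, ?_⟩
  intro Ω U S u f φ h hSU hS hφ hφ0 hφS
  have hp : 0 < (n : ℝ) / ((n : ℝ) - 1) := div_pos (by linarith) (by linarith)
  have hle := hmain h hSU hS hφ hφ0 hφS
  rw [← h.ofReal_integral_graphVolume hSU hS
      (hφ.continuous.rpow_const fun _ => Or.inr hp.le).continuousOn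
      (fun x hx => by rw [hφS x hx, Real.zero_rpow hp.ne'])
      (fun x => Real.rpow_nonneg (hφ0 x) _),
    ← h.ofReal_integral_graphVolume hSU hS
      ((h.continuousOn_energyDensity hφ).mono h.subset_domain)
      (fun x hx => IsAdmissible.energyDensity_eq_zero hS hφS hx)
      (fun x => IsAdmissible.energyDensity_nonneg (hφ0 x))] at hle
  have hX : 0 ≤ ∫ x, φ x ^ ((n : ℝ) / ((n : ℝ) - 1)) ∂(graphVolume f u Ω) :=
    integral_nonneg fun x => Real.rpow_nonneg (hφ0 x) _
  have hY : 0 ≤ ∫ x, energyDensity f u φ x ∂(graphVolume f u Ω) :=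
    integral_nonneg fun x => IsAdmissible.energyDensity_nonneg (hφ0 x)
  rw [ENNReal.ofReal_rpow_of_nonneg hY hp.le, ← ENNReal.ofReal_mul hC.le,
    ENNReal.ofReal_le_ofReal_iff (by positivity)] at hle
  have hq : (n : ℝ) / ((n : ℝ) - 1) * (((n : ℝ) - 1) / (n : ℝ)) = 1 := by
    have h1 : (n : ℝ) - 1 ≠ 0 := by linarith
    have h2 : (n : ℝ) ≠ 0 := by linarith
    field_simp
  calc _ ≤ (C * (∫ x, energyDensity f u φ x ∂(graphVolume f u Ω)) ^ ((n : ℝ) / ((n : ℝ) - 1))) ^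
        (((n : ℝ) - 1) / (n : ℝ)) :=
        Real.rpow_le_rpow hX hle (div_nonneg (by linarith) (by linarith))
    _ = _ := by
        rw [Real.mul_rpow hC.le (by positivity), ← Real.rpow_mul hY, hq, Real.rpow_one]

lemma traceInv_nonneg {n : ℕ} {f u : EuclideanSpace ℝ (Fin n) → ℝ} {x : EuclideanSpace ℝ (Fin n)}
    (hf : 1 ≤ f x) : 0 ≤ traceInv (weightedMetric f) (gradGraph u) x := by
  rw [IsAdmissible.traceInv_eq]
  exact trace_inv_nonneg (posDef_graphMetric hf)

lemma isAdmissible_of_c01Norm_le {n : ℕ} {K : ℝ≥0} {Ω U : Set (EuclideanSpace ℝ (Fin n))}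
    {u f : EuclideanSpace ℝ (Fin n) → ℝ} (hΩ : IsOpen Ω) (hU : IsOpen U) (hUΩ : U ⊆ Ω)
    (hu : ContDiffOn ℝ 3 u Ω) (hf : ContDiffOn ℝ 1 f Ω) (hf1 : ∀ x ∈ Ω, 1 ≤ f x)
    (hK : c01Norm f U ≤ (K : ℝ≥0∞)) : IsAdmissible (K + 1) Ω U u f where
  isOpen_domain := hΩ
  isOpen_subset := hU
  subset_domain := hUΩ
  contDiffOn_potential := hu
  contDiffOn_weight := hf
  one_le_weight := hf1
  one_le_bound := le_add_of_nonneg_left K.2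
  weight_le := fun x hx => by
    have h1 : ‖f x‖ₑ ≤ (K : ℝ≥0∞) :=
      (le_iSup₂ (f := fun x (_ : x ∈ U) => ‖f x‖ₑ) x hx).trans (le_self_add.trans hK)
    have h2 : ‖f x‖ ≤ K := by exact_mod_cast (enorm_le_coe.1 h1)
    have h3 := Real.le_norm_self (f x)
    linarith
  weight_lipschitz := fun x hx y hy => by
    rcases eq_or_ne x y with rfl | hxy
    · simp
    have h1 : edist (f x) (f y) / edist x y ≤ (K : ℝ≥0∞) :=
      (le_iSup₂ (f := fun y (_ : y ∈ U) => edist (f x) (f y) / edist x y) y hy).trans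
        ((le_iSup₂ (f := fun x (_ : x ∈ U) => ⨆ y ∈ U, edist (f x) (f y) / edist x y) x hx).trans
          (le_add_self.trans hK))
    rw [ENNReal.div_le_iff (edist_pos.2 hxy).ne' (edist_ne_top _ _), edist_nndist, edist_nndist]
      at h1
    have h2 : dist (f x) (f y) ≤ K * dist x y := by exact_mod_cast h1
    rw [Real.dist_eq, dist_eq_norm] at h2
    have := norm_nonneg (x - y)
    linarith

end GradientGraph

end

theorem proposition2p2 (n : ℕ) (hn : 3 ≤ n) (K : ℝ≥0) :
    ∃ C : ℝ, 0 < C ∧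
      ∀ (Ω U : Set (EuclideanSpace ℝ (Fin n))) (u f φ : EuclideanSpace ℝ (Fin n) → ℝ),
        IsOpen Ω → IsOpen U → U ⊆ Ω →
        ContDiffOn ℝ 3 u Ω → ContDiffOn ℝ 1 f Ω → (∀ x ∈ Ω, 1 ≤ f x) →
        GradientGraph.c01Norm f U ≤ (K : ℝ≥0∞) →
        ContDiffOn ℝ 1 φ U → (∀ x, 0 ≤ φ x) →
        (∃ S ⊆ U, IsCompact S ∧ ∀ x, x ∉ S → φ x = 0) →
        (∫ x, φ x ^ ((n : ℝ) / ((n : ℝ) - 1))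
            ∂(GradientGraph.volumeMeasure (GradientGraph.weightedMetric f)
              (GradientGraph.gradGraph u) Ω)) ^ (((n : ℝ) - 1) / (n : ℝ))
          ≤ C * (1 + (∫ x in tsupport φ,
                GradientGraph.traceInv (GradientGraph.weightedMetric f)
                  (GradientGraph.gradGraph u) x
                ∂(GradientGraph.volumeMeasure (GradientGraph.weightedMetric f)
                  (GradientGraph.gradGraph u) Ω)) ^ (1 / ((n : ℝ) * ((n : ℝ) - 1))))
            * ∫ x, (GradientGraph.gradNorm (GradientGraph.weightedMetric f)
                  (GradientGraph.gradGraph u) φ x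
                + φ x * (GradientGraph.meanCurvatureNorm (GradientGraph.weightedMetric f)
                    (GradientGraph.gradGraph u) x
                  + Real.sqrt (GradientGraph.traceInv (GradientGraph.weightedMetric f)
                    (GradientGraph.gradGraph u) x)))
              ∂(GradientGraph.volumeMeasure (GradientGraph.weightedMetric f)
                (GradientGraph.gradGraph u) Ω) := by
  obtain ⟨C, hC, hmain⟩ := GradientGraph.exists_integral_rpow_le n (by omega)
    (le_add_of_nonneg_left K.2 : (1 : ℝ) ≤ K + 1)
  refine ⟨C, hC, ?_⟩
  rintro Ω U u f φ hΩ hU hUΩ hu hf hf1 hK hφ hφ0 ⟨S, hSU, hS, hφS⟩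
  have h := GradientGraph.isAdmissible_of_c01Norm_le hΩ hU hUΩ hu hf hf1 hK
  have hφ' := GradientGraph.contDiff_of_contDiffOn_of_eq_zero hU hSU hS hφ hφS
  refine (hmain h hSU hS hφ' hφ0 hφS).trans ?_
  have hY : 0 ≤ ∫ x, GradientGraph.energyDensity f u φ x ∂(GradientGraph.graphVolume f u Ω) :=
    integral_nonneg fun x => GradientGraph.IsAdmissible.energyDensity_nonneg (hφ0 x)
  refine mul_le_mul_of_nonneg_right (le_mul_of_one_le_right hC.le ?_) hY
  -- the trace is nonnegative on the support of `φ`, which is contained in `S`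
  refine le_add_of_nonneg_right (Real.rpow_nonneg (setIntegral_nonneg
    (isClosed_tsupport φ).measurableSet fun x hx => ?_) _)
  have hxS : x ∈ S := closure_minimal (fun y hy => by
    by_contra hyS
    exact hy (hφS y hyS)) hS.isClosed hx
  exact GradientGraph.traceInv_nonneg (hf1 x (hUΩ (hSU hxS)))
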